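/- Let $T$ be a torus and let $(M,\sigma)$ be a compact, connected symplectic manifold equipped with an effective action of $T$ by symplectomorphisms, such that at least one $T$-orbit is a $\dim T$-dimensional symplectic submanifold of $(M,\sigma)$. Let $\pi\colon M\to M/T$ be the projection onto the orbit space, let $T_x$ be the stabilizer of $x\in M$, and put $k=\dim M-\dim T$. A tube at $x\in M$ consists of an open disk $D_x\subset\mathbb R^k$ centered at $0$, a linear action of $T_x$ on $\mathbb R^k$ preserving $D_x$, and a $T$-equivariant diffeomorphism $\Phi_x$ from $T\times_{T_x}D_x$ onto an open neighborhood $U_x$ of $T\cdot x$ with $\Phi_x([1,0])=x$. Here $T\times_{T_x}D_x$ is the quotient of $T\times D_x$ by the action $h\cdot(t,z)=(th^{-1},h\cdot z)$ of $T_x$. Put $\phi_x(z)=\pi(\Phi_x([1,z]))$ for $z\in D_x$. Then: 1. Every $T$-orbit is a $\dim T$-dimensional symplectic submanifold of $(M,\sigma)$. 2. The $\sigma_x$-orthogonal complements $\Omega_x\subset T_xM$ of the tangent spaces $T_x(T\cdot x)$ to the orbits form a smooth $T$-invariant distribution $\Omega$ on $M$, of rank $k$. 3. The space $M/T$ is metrizable,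 and there is a tube at every $x\in M$. For every choice of a tube at each $x\in M$, the group $T_x$ acts effectively on $D_x$ and $\{(\pi(U_x),D_x,\phi_x,T_x)\}_{x\in M}$ is an orbifold atlas of $M/T$: the groups $T_x$ are finite and act by diffeomorphisms on the connected open sets $D_x\subset\mathbb R^k$, the sets $\pi(U_x)$ are open and cover $M/T$, each $\phi_x$ is continuous and factors through a homeomorphism $D_x/T_x\to\pi(U_x)$, and whenever $\phi_x(z)=\phi_y(w)$ there is a diffeomorphism $\psi$ from a neighborhood of $z$ onto a neighborhood of $w$ with $\psi(z)=w$ and $\phi_y\circ\psi=\phi_x$. The atlases that belong to two choices of tubes are equivalent, that is, their union is an orbifold atlas. 4. With respect to each of these atlases $\pi\colon M\to M/T$ is a smooth principal $T$-orbibundle. That is, $\pi$ is continuous and surjective, $T$ preserves the fibers of $\pi$ and acts on them transitively and with finite stabilizers, and for all $p\in M/T$ and $x\in M$ with $p\in\pi(U_x)$ there are a $T_x$-invariant open set $\widetilde U\subset D_x$ with $p\in\phi_x(\widetilde U)$ and a $T$-equivariant map $\psi\colon T\times\widetilde U\to M$ which induces a diffeomorphism from $T\times_{T_x}\widetilde U$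 onto $\pi^{-1}(\phi_x(\widetilde U))$ and satisfies $\pi(\psi(t,z))=\phi_x(z)$. 5. $\Omega$ is a flat connection for $\pi$: it is a smooth subbundle of $TM$, each $\Omega_x$ is a direct complement in $T_xM$ of the tangent space at $x$ to the fiber of $\pi$ through $x$, and $\Omega$ is integrable, that is, through every point of $M$ there passes an integral manifold of $\Omega$ of dimension $k$. -/

import Mathlib

open Set TopologicalSpace
open scoped Manifold ContDiff Topology

noncomputable section

/-! ### Tori -/

/-- A torus: a Lie group `T` isomorphic to `ℝᵏ / ℤᵏ`, where `k = dim T`. The isomorphism is given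
by the homomorphism `p : ℝᵏ → T` it corresponds to: smooth and locally diffeomorphic, onto, with
kernel `ℤᵏ`. -/
def IsTorus {F : Type*} [NormedAddCommGroup F] [NormedSpace ℝ F]
    (T : Type*) [CommGroup T] [TopologicalSpace T] [ChartedSpace F T] : Prop :=
  ∃ p : (Fin (Module.finrank ℝ F) → ℝ) → T,
    IsLocalDiffeomorph 𝓘(ℝ, Fin (Module.finrank ℝ F) → ℝ) 𝓘(ℝ, F) ∞ p ∧
    Function.Surjective p ∧
    (∀ u v, p (u + v) = p u * p v) ∧
    (∀ u, p u = 1 ↔ ∃ m : Fin (Module.finrank ℝ F) → ℤ, u = fun i => (m i : ℝ))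

section Manifold

variable {E : Type*} [NormedAddCommGroup E] [NormedSpace ℝ E]
  {M : Type*} [TopologicalSpace M] [ChartedSpace E M]

/-! ### Submanifolds and distributions -/

/-- `S` is an embedded `d`-dimensional submanifold of `M`, whose tangent space at `p ∈ S` is `τ p`:
near each point `p` of `S` there is a chart of `M` that carries `S` to the affine subspace through
the image of `p` with a `d`-dimensional direction `W`, and whose differential pulls `W` back
to `τ p`. -/
def IsEmbeddedSubmanifold (S : Set M) (τ : ∀ p : M, Submodule ℝ (TangentSpace 𝓘(ℝ, E) p))
    (d : ℕ) : Prop :=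
  ∀ p ∈ S, ∃ e ∈ IsManifold.maximalAtlas 𝓘(ℝ, E) ∞ M, p ∈ e.source ∧
    ∃ W : Submodule ℝ E, Module.finrank ℝ W = d ∧
      (∀ q ∈ e.source, q ∈ S ↔ e q - e p ∈ W) ∧
      ∀ v : TangentSpace 𝓘(ℝ, E) p, v ∈ τ p ↔ mfderiv 𝓘(ℝ, E) 𝓘(ℝ, E) e p v ∈ W

/-- `H` is a smooth distribution of rank `r`, that is, a smooth rank `r` subbundle of the tangent
bundle: it has local frames of `r` smooth vector fields. -/
def IsSmoothDistribution [IsManifold 𝓘(ℝ, E) ∞ M]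
    (H : ∀ x : M, Submodule ℝ (TangentSpace 𝓘(ℝ, E) x)) (r : ℕ) : Prop :=
  ∀ x : M, ∃ U : Set M, IsOpen U ∧ x ∈ U ∧
    ∃ X : Fin r → ∀ y : M, TangentSpace 𝓘(ℝ, E) y,
      (∀ i, ContMDiffOn 𝓘(ℝ, E) 𝓘(ℝ, E).tangent ∞
        (fun y => (⟨y, X i y⟩ : TangentBundle 𝓘(ℝ, E) M)) U) ∧
      ∀ y ∈ U, LinearIndependent ℝ (fun i => X i y) ∧
        Submodule.span ℝ (Set.range fun i => X i y) = H y

/-- The rank `r` distribution `H` is integrable: through each point `x` there passes an integral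
manifold, parametrized by an injective immersion `f` of an open neighbourhood of `0` in `ℝʳ`. -/
def IsIntegrable (H : ∀ x : M, Submodule ℝ (TangentSpace 𝓘(ℝ, E) x)) (r : ℕ) : Prop :=
  ∀ x : M, ∃ (f : EuclideanSpace ℝ (Fin r) → M) (W : Set (EuclideanSpace ℝ (Fin r))),
    IsOpen W ∧ 0 ∈ W ∧ f 0 = x ∧
    ContMDiffOn 𝓘(ℝ, EuclideanSpace ℝ (Fin r)) 𝓘(ℝ, E) ∞ f W ∧ InjOn f W ∧
    ∀ v ∈ W,
      Function.Injective (mfderiv 𝓘(ℝ, EuclideanSpace ℝ (Fin r)) 𝓘(ℝ, E) f v) ∧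
      ∀ u : TangentSpace 𝓘(ℝ, E) (f v), u ∈ H (f v) ↔
        ∃ w, mfderiv 𝓘(ℝ, EuclideanSpace ℝ (Fin r)) 𝓘(ℝ, E) f v w = u

/-! ### Symplectic forms -/

variable (E M) in
/-- (Not necessarily smooth) differential two-forms on `M`. -/
abbrev TwoForm : Type _ := ∀ x : M, TangentSpace 𝓘(ℝ, E) x [⋀^Fin 2]→L[ℝ] ℝ

/-- The expression of `σ` in the preferred chart at `x₀`: its pullback by the inverse chart. It is
meaningful on the target of the chart. -/
def TwoForm.inChart (σ : TwoForm E M) (x₀ : M) (u : E) : E [⋀^Fin 2]→L[ℝ] ℝ :=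
  (σ ((chartAt E x₀).symm u)).compContinuousLinearMap
    (mfderiv 𝓘(ℝ, E) 𝓘(ℝ, E) (chartAt E x₀).symm u)

/-- A symplectic form: a smooth, closed, nondegenerate two-form. -/
structure IsSymplecticForm (σ : TwoForm E M) : Prop where
  smooth : ∀ x₀ : M, ContDiffOn ℝ ∞ (σ.inChart x₀) (chartAt E x₀).target
  closed : ∀ x₀ : M, ∀ u ∈ (chartAt E x₀).target, extDeriv (σ.inChart x₀) u = 0
  nondegenerate : ∀ (x : M) (v : TangentSpace 𝓘(ℝ, E) x), (∀ w, σ x ![v, w] = 0) → v = 0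

end Manifold

/-! ### Torus actions -/

section Action

variable {E : Type*} [NormedAddCommGroup E] [NormedSpace ℝ E]
  {F : Type*} [NormedAddCommGroup F] [NormedSpace ℝ F]
  {M : Type*} [TopologicalSpace M] [ChartedSpace E M]
  (T : Type*) [CommGroup T] [TopologicalSpace T] [ChartedSpace F T] [MulAction T M]

/-- The action of `T` preserves the two-form `σ`. -/
def IsInvariantForm (σ : TwoForm E M) : Prop :=
  ∀ (t : T) (x : M),
    (σ (t • x)).compContinuousLinearMap
      (mfderiv 𝓘(ℝ, E) 𝓘(ℝ, E) (fun y : M => t • y) x) = σ x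

/-- The distribution `H` is `T`-invariant. -/
def IsInvariantDistribution (H : ∀ x : M, Submodule ℝ (TangentSpace 𝓘(ℝ, E) x)) : Prop :=
  ∀ (t : T) (x : M),
    (H x).map (mfderiv 𝓘(ℝ, E) 𝓘(ℝ, E) (fun y : M => t • y) x).toLinearMap = H (t • x)

variable (E F) in
/-- `T_x(T · x)`: the values at `x` of the infinitesimal action of the Lie algebra of `T`. -/
def orbitTangent (x : M) : Submodule ℝ (TangentSpace 𝓘(ℝ, E) x) :=
  LinearMap.range (mfderiv 𝓘(ℝ, F) 𝓘(ℝ, E) (fun t : T => t • x) 1).toLinearMap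

variable (F) in
/-- The orbit `T · x` is a `dim T`-dimensional symplectic submanifold of `(M, σ)`: an embedded
submanifold of dimension `dim T`, on whose tangent spaces `σ` is nondegenerate. -/
def IsSymplecticOrbit (σ : TwoForm E M) (x : M) : Prop :=
  IsEmbeddedSubmanifold (MulAction.orbit T x) (orbitTangent E F T) (Module.finrank ℝ F) ∧
  ∀ y ∈ MulAction.orbit T x, ∀ v ∈ orbitTangent E F T y,
    (∀ w ∈ orbitTangent E F T y, σ y ![v, w] = 0) → v = 0

variable (F) in
/-- `Ω_x`: the `σ_x`-orthogonal complement of `T_x(T · x)` in `T_x M`. -/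
def orbitOrthogonal (σ : TwoForm E M) (x : M) : Submodule ℝ (TangentSpace 𝓘(ℝ, E) x) where
  carrier := {v | ∀ w ∈ orbitTangent E F T x, σ x ![v, w] = 0}
  zero_mem' := fun w _ => (σ x).map_coord_zero (m := ![0, w]) 0 rfl
  add_mem' := by
    intro a b ha hb w hw
    have h := (σ x).toAlternatingMap.map_vecCons_add ![w] a b
    exact h.trans (by
      rw [show (σ x).toAlternatingMap (Matrix.vecCons a ![w]) = 0 from ha w hw,
        show (σ x).toAlternatingMap (Matrix.vecCons b ![w]) = 0 from hb w hw, add_zero])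
  smul_mem' := by
    intro c a ha w hw
    have h := (σ x).toAlternatingMap.map_vecCons_smul ![w] c a
    exact h.trans (by
      rw [show (σ x).toAlternatingMap (Matrix.vecCons a ![w]) = 0 from ha w hw, smul_zero])

/-- The orbit space `M/T`, with the quotient topology. -/
abbrev OrbitSpace (M : Type*) (T : Type*) [CommGroup T] [MulAction T M] : Type _ :=
  MulAction.orbitRel.Quotient T M

/-- The projection `π : M → M/T`. -/
def orbitProj {M : Type*} (T : Type*) [CommGroup T] [MulAction T M] (x : M) : OrbitSpace M T :=
  Quotient.mk _ x

end Action

/-! ### Orbifold atlases -/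

/-- The data `(U, Ũ, φ, Γ)` of an `n`-dimensional orbifold chart on `X`; what is required of them
is part of `IsOrbifoldAtlas`. -/
structure OrbifoldChart (n : ℕ) (X : Type*) where
  /-- the range `U` of the chart -/
  U : Set X
  /-- the domain `Ũ ⊆ ℝⁿ` of the chart -/
  dom : Opens (EuclideanSpace ℝ (Fin n))
  /-- the chart `φ : Ũ → U` -/
  φ : dom → X
  /-- the group `Γ` of transformations of `Ũ` -/
  Γ : Subgroup (Equiv.Perm dom)

/-- The charts `A i` form an orbifold atlas of the topological space `X`. -/
structure IsOrbifoldAtlas {n : ℕ} {X : Type*} [TopologicalSpace X] {ι : Type*}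
    (A : ι → OrbifoldChart n X) : Prop where
  isOpen_U : ∀ i, IsOpen (A i).U
  isConnected_dom : ∀ i, IsConnected ((A i).dom : Set (EuclideanSpace ℝ (Fin n)))
  continuous_φ : ∀ i, Continuous (A i).φ
  finite_Γ : ∀ i, Finite (A i).Γ
  smooth_Γ : ∀ i, ∀ g ∈ (A i).Γ, ContMDiff 𝓘(ℝ, EuclideanSpace ℝ (Fin n))
    𝓘(ℝ, EuclideanSpace ℝ (Fin n)) ∞ (g : (A i).dom → (A i).dom)
  cover : ⋃ i, (A i).U = univ
  /-- `φ` factors through a homeomorphism `Ũ/Γ → U` -/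
  factors : ∀ i, ∃ h : MulAction.orbitRel.Quotient (A i).Γ (A i).dom ≃ₜ (A i).U,
    ∀ z : (A i).dom, (h (Quotient.mk _ z) : X) = (A i).φ z
  /-- the charts are compatible -/
  compatible : ∀ i j, ∀ (z : (A i).dom) (w : (A j).dom), (A i).φ z = (A j).φ w →
    ∃ ψ : OpenPartialHomeomorph (A i).dom (A j).dom,
      z ∈ ψ.source ∧ ψ z = w ∧
      ContMDiffOn 𝓘(ℝ, EuclideanSpace ℝ (Fin n)) 𝓘(ℝ, EuclideanSpace ℝ (Fin n)) ∞ ψ ψ.source ∧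
      ContMDiffOn 𝓘(ℝ, EuclideanSpace ℝ (Fin n)) 𝓘(ℝ, EuclideanSpace ℝ (Fin n)) ∞
        ψ.symm ψ.target ∧
      ∀ y ∈ ψ.source, (A j).φ (ψ y) = (A i).φ y

/-- Two orbifold atlases are equivalent: their union is an orbifold atlas. -/
def AtlasEquivalent {n : ℕ} {X : Type*} [TopologicalSpace X] {ι κ : Type*}
    (A : ι → OrbifoldChart n X) (B : κ → OrbifoldChart n X) : Prop :=
  IsOrbifoldAtlas (Sum.elim A B)

/-! ### Tubes, and the atlas they define on the orbit space -/

section Tube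

/-- Let the subgroup `Γ` of `T` act linearly on `ℝⁿ` by `ρ`, let `D ⊆ ℝⁿ` be open and
`Γ`-invariant, and let `Γ` act on `T × D` by `h · (t, z) = (t h⁻¹, ρ(h) z)`. The predicate says
that `ψ : T × D → Y` induces a diffeomorphism of `T ×_Γ D = (T × D)/Γ` onto the (open) range of `ψ`.
As `T × D → T ×_Γ D` is a surjective local diffeomorphism when `Γ` is finite, this means that `ψ`
is a local diffeomorphism and that its fibres are the `Γ`-orbits. -/
def InducesDiffeo {F : Type*} [NormedAddCommGroup F] [NormedSpace ℝ F]
    {T : Type*} [CommGroup T] [TopologicalSpace T] [ChartedSpace F T]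
    {E' : Type*} [NormedAddCommGroup E'] [NormedSpace ℝ E']
    {Y : Type*} [TopologicalSpace Y] [ChartedSpace E' Y]
    {n : ℕ} {Γ : Subgroup T} (ρ : Representation ℝ Γ (EuclideanSpace ℝ (Fin n)))
    (D : Opens (EuclideanSpace ℝ (Fin n))) (ψ : T × D → Y) : Prop :=
  IsLocalDiffeomorph (𝓘(ℝ, F).prod 𝓘(ℝ, EuclideanSpace ℝ (Fin n))) 𝓘(ℝ, E') ∞ ψ ∧
  ∀ a b : T × D, ψ a = ψ b ↔
    ∃ h : Γ, b.1 = a.1 * (h : T)⁻¹ ∧ (b.2 : EuclideanSpace ℝ (Fin n)) = ρ h a.2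

/-- The open disk of radius `r` centred at the origin of `ℝⁿ`. -/
def disk (n : ℕ) (r : ℝ) : Opens (EuclideanSpace ℝ (Fin n)) :=
  ⟨Metric.ball 0 r, Metric.isOpen_ball⟩

/-- `dim M - dim T`. -/
abbrev sliceDim (E F : Type*) [NormedAddCommGroup E] [NormedSpace ℝ E]
    [NormedAddCommGroup F] [NormedSpace ℝ F] : ℕ :=
  Module.finrank ℝ E - Module.finrank ℝ F

variable (E : Type*) [NormedAddCommGroup E] [NormedSpace ℝ E]
  (F : Type*) [NormedAddCommGroup F] [NormedSpace ℝ F]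
  {M : Type*} [TopologicalSpace M] [ChartedSpace E M]
  (T : Type*) [CommGroup T] [TopologicalSpace T] [ChartedSpace F T] [MulAction T M]

/-- A tube at `x`: an open disk `D_x` in `ℝᵏ`, `k = dim M - dim T`, centred at the origin, preserved
by a linear action of the stabilizer `T_x`, and a `T`-equivariant diffeomorphism of the associated
bundle `T ×_{T_x} D_x` onto a neighbourhood `U_x` of the orbit `T · x`, which takes
`[1, 0]` to `x`. The diffeomorphism is given by the map `Φ` on `T × D_x` that induces it. -/
structure Tube (x : M) where
  /-- the radius of `D_x` -/
  r : ℝ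
  r_pos : 0 < r
  /-- the linear action of `T_x` -/
  ρ : Representation ℝ (MulAction.stabilizer T x) (EuclideanSpace ℝ (Fin (sliceDim E F)))
  ρ_mem : ∀ h, ∀ z ∈ disk (sliceDim E F) r, ρ h z ∈ disk (sliceDim E F) r
  /-- the map `(t, z) ↦ Φ_x([t, z])` -/
  Φ : T × disk (sliceDim E F) r → M
  Φ_center : ∀ z : disk (sliceDim E F) r, (z : EuclideanSpace ℝ (Fin (sliceDim E F))) = 0 →
    Φ (1, z) = x
  Φ_equivariant : ∀ (s t : T) (z : disk (sliceDim E F) r), Φ (s * t, z) = s • Φ (t, z)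
  Φ_induces : InducesDiffeo (F := F) (E' := E) ρ (disk (sliceDim E F) r) Φ

variable {E F T}

/-- The action of `T_x` on `D_x`. -/
def Tube.permHom {x : M} (τ : Tube E F T x) :
    MulAction.stabilizer T x →* Equiv.Perm (disk (sliceDim E F) τ.r) :=
  MonoidHom.toHomPerm
    { toFun := fun h z => ⟨τ.ρ h z, τ.ρ_mem h z z.2⟩
      map_one' := by
        funext z
        refine Subtype.ext ?_
        change τ.ρ 1 z = z
        simp
      map_mul' := by
        intro g h
        funext z
        refine Subtype.ext ?_
        change τ.ρ (g * h) z = τ.ρ g (τ.ρ h z)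
        simp }

/-- The orbifold chart `(π(U_x), D_x, φ_x, T_x)` with `φ_x(z) = π(Φ_x([1, z]))`. The group is the
image of `T_x` in the group of permutations of `D_x`. -/
def Tube.chart {x : M} (τ : Tube E F T x) : OrbifoldChart (sliceDim E F) (OrbitSpace M T) where
  U := orbitProj T '' range τ.Φ
  dom := disk (sliceDim E F) τ.r
  φ := fun z => orbitProj T (τ.Φ (1, z))
  Γ := τ.permHom.range

/-- The collection of the charts of the tubes `τ x`, `x ∈ M`. -/
def tubeAtlas (τ : ∀ x : M, Tube E F T x) (x : M) :
    OrbifoldChart (sliceDim E F) (OrbitSpace M T) :=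
  (τ x).chart

/-! ### Principal orbibundles and connections -/

variable {E' : Type*} [NormedAddCommGroup E'] [NormedSpace ℝ E']
  {Y : Type*} [TopologicalSpace Y] [ChartedSpace E' Y] [MulAction T Y]

variable (E') in
/-- `p : Y → M/T` is a smooth principal `T`-orbibundle over `M/T` with the orbifold atlas of the
tubes `τ`. -/
structure IsPrincipalOrbibundle [IsManifold 𝓘(ℝ, E') ∞ Y]
    [ContMDiffSMul 𝓘(ℝ, F) 𝓘(ℝ, E') ∞ T Y] [FaithfulSMul T Y]
    (τ : ∀ x : M, Tube E F T x) (p : Y → OrbitSpace M T) : Prop where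
  continuous_p : Continuous p
  surjective_p : Function.Surjective p
  /-- `T` preserves the fibres of `p` and is transitive on them -/
  fibres : ∀ y y' : Y, p y = p y' ↔ ∃ t : T, t • y = y'
  finite_stabilizer : ∀ y : Y, Finite (MulAction.stabilizer T y)
  /-- the local models -/
  exists_model : ∀ (z : OrbitSpace M T) (x : M), z ∈ (τ x).chart.U →
    ∃ (V : Opens (EuclideanSpace ℝ (Fin (sliceDim E F)))) (hV : V ≤ (τ x).chart.dom),
      (∀ h, ∀ v ∈ V, (τ x).ρ h v ∈ V) ∧
      (∃ v : V, (τ x).chart.φ ⟨v, hV v.2⟩ = z) ∧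
      ∃ ψ : T × V → Y,
        (∀ (s t : T) (v : V), ψ (s * t, v) = s • ψ (t, v)) ∧
        InducesDiffeo (F := F) (E' := E') (τ x).ρ V ψ ∧
        range ψ = p ⁻¹' (range fun v : V => (τ x).chart.φ ⟨v, hV v.2⟩) ∧
        ∀ (t : T) (v : V), p (ψ (t, v)) = (τ x).chart.φ ⟨v, hV v.2⟩

/-- `H` is a connection for `p : Y → B`: a smooth subbundle of the tangent bundle of `Y` such that
each `H y` is a direct complement of the tangent space at `y` of the fibre of `p` through `y`. -/
def IsConnection [IsManifold 𝓘(ℝ, E') ∞ Y] {B : Type*} (p : Y → B)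
    (H : ∀ y : Y, Submodule ℝ (TangentSpace 𝓘(ℝ, E') y)) (r : ℕ) : Prop :=
  IsSmoothDistribution H r ∧
  ∀ y : Y, ∃ (V : ∀ q : Y, Submodule ℝ (TangentSpace 𝓘(ℝ, E') q)) (d : ℕ),
    IsEmbeddedSubmanifold (p ⁻¹' {p y}) V d ∧ IsCompl (H y) (V y)

/-- `H` is a flat connection for `p`: a connection which is integrable as a distribution. -/
def IsFlatConnection [IsManifold 𝓘(ℝ, E') ∞ Y] {B : Type*} (p : Y → B)
    (H : ∀ y : Y, Submodule ℝ (TangentSpace 𝓘(ℝ, E') y)) (r : ℕ) : Prop :=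
  IsConnection p H r ∧ IsIntegrable H r

end Tube

end

open Set TopologicalSpace
open scoped Manifold ContDiff Topology

noncomputable section

/-! ### The inverse function theorem on manifolds -/

section InverseFunction

/-! Let `V = ℝᵏ` be the Lie algebra of `T`, mapped onto `T` by the homomorphism `p`, and let `X_a`
be the vector field on `M` generated by `a ∈ V`. Everything rests on two consequences of `dσ = 0`
for an abelian group. Pull `σ` back along the action map `V × E → M`, the second variable being read
in a chart. The result is a closed two-form `η` that is invariant under translations in `V`, so its
derivatives along `V` vanish. Evaluating `dη = 0` on `(a, b, v)` with `a, b ∈ V` and `v ∈ E` shows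
that `σ(X_a, X_b)` is locally constant. Evaluating it on `(a, v, w)` shows that the one-form `σ(X_a,
·)` is closed, hence locally the differential of a component of a moment map `μ`.

By the first consequence, nondegeneracy of `σ` along one orbit spreads over the connected manifold
`M` (`IsTorusParam.nondegenerate`). Hence the action is locally free, and `Ω_x` is a complement of
the tangent space of the orbit at every point. By the second, `Ω` is locally the kernel of the
submersion `μ`. Completing `μ` to a system of coordinates (`exists_flat_chart`) gives smooth local
frames of `Ω` and its integral manifolds.

The stabilizers are compact and, by local freeness, discrete, so they are finite. Averaging a chart
over `T_x` and restricting its inverse to `Ω_x` yields an equivariant slice, and compactness of `T`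
turns it into a tube (`nonempty_tube`). Once tubes exist, orbits are visibly embedded. The orbifold
atlas, its independence of choices and the principal orbibundle are formal: `Φ_x` is an equivariant
local diffeomorphism whose fibres are `T_x`-orbits. Effectiveness of `T_x` on `D_x` holds because a
linear map that fixes an open set is the identity, so the interior of the fixed point set of a group
element is closed as well as open. -/

theorem exists_smooth_inverse_of_fderiv {E₁ E₂ : Type*} [NormedAddCommGroup E₁] [NormedSpace ℝ E₁]
    [CompleteSpace E₁] [NormedAddCommGroup E₂] [NormedSpace ℝ E₂] {f : E₁ → E₂} {U : Set E₁}
    {x : E₁} (hU : IsOpen U) (hx : x ∈ U) (hf : ContDiffOn ℝ ∞ f U) (f' : E₁ ≃L[ℝ] E₂)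
    (hf' : HasFDerivAt f (f' : E₁ →L[ℝ] E₂) x) :
    ∃ (g : E₂ → E₁) (A : Set E₁) (B : Set E₂), IsOpen A ∧ A ⊆ U ∧ IsOpen B ∧ x ∈ A ∧ f x ∈ B ∧
      ContDiffOn ℝ ∞ g B ∧ (∀ a ∈ A, g (f a) = a) ∧ (∀ b ∈ B, f (g b) = b) ∧
      MapsTo g B A := by
  have hfx : ContDiffAt ℝ ∞ f x := hf.contDiffAt (hU.mem_nhds hx)
  set h := hfx.toOpenPartialHomeomorph f hf' (by simp) with hh
  have hcoe : (h : E₁ → E₂) = f := hfx.toOpenPartialHomeomorph_coe hf' (by simp)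
  have hxs : x ∈ h.source := hfx.mem_toOpenPartialHomeomorph_source hf' (by simp)
  have hcont : ContinuousOn (fderiv ℝ f) U := hf.continuousOn_fderiv_of_isOpen hU (by simp)
  have hR : IsOpen (range ((↑) : (E₁ ≃L[ℝ] E₂) → E₁ →L[ℝ] E₂)) := ContinuousLinearEquiv.isOpen
  -- Restricting to the points where the derivative is invertible, an open condition, makes the
  -- inverse smooth on all of its domain and not only at `f x`.
  set A : Set E₁ := (U ∩ fderiv ℝ f ⁻¹' range ((↑) : (E₁ ≃L[ℝ] E₂) → E₁ →L[ℝ] E₂)) ∩ h.source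
  have hA : IsOpen A := (hcont.isOpen_inter_preimage hU hR).inter h.open_source
  have hxA : x ∈ A := ⟨⟨hx, f', hf'.fderiv.symm⟩, hxs⟩
  refine ⟨h.symm, A, h.target ∩ h.symm ⁻¹' A, hA, fun a ha => ha.1.1,
    h.symm.isOpen_inter_preimage hA, hxA, ?_, ?_, ?_, ?_, fun b hb => hb.2⟩
  · rw [← hcoe]
    refine ⟨h.map_source hxs, ?_⟩
    rw [mem_preimage, h.left_inv hxs]
    exact hxA
  · intro b hb
    obtain ⟨⟨hbU, e, he⟩, hbs⟩ := hb.2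
    have hd : DifferentiableAt ℝ f (h.symm b) :=
      (hf.contDiffAt (hU.mem_nhds hbU)).differentiableAt (by simp)
    refine (h.contDiffAt_symm (f₀' := e) hb.1 ?_ ?_).contDiffWithinAt
    · rw [hcoe, he]
      exact hd.hasFDerivAt
    · rw [hcoe]
      exact hf.contDiffAt (hU.mem_nhds hbU)
  · intro a ha
    rw [← hcoe]
    exact h.left_inv ha.2
  · intro b hb
    rw [← hcoe]
    exact h.right_inv hb.1

variable {E₁ : Type*} [NormedAddCommGroup E₁] [NormedSpace ℝ E₁] {H₁ : Type*} [TopologicalSpace H₁]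
  {I : ModelWithCorners ℝ E₁ H₁} {N : Type*} [TopologicalSpace N] [ChartedSpace H₁ N]
  {E₂ : Type*} [NormedAddCommGroup E₂] [NormedSpace ℝ E₂] {H₂ : Type*} [TopologicalSpace H₂]
  {J : ModelWithCorners ℝ E₂ H₂} {P : Type*} [TopologicalSpace P] [ChartedSpace H₂ P]

/-- The partial diffeomorphism given by two smooth maps on open sets which are inverse to each
other. -/
def PartialDiffeomorph.ofInverse {f : N → P} {g : P → N} {A : Set N} {B : Set P}
    (hA : IsOpen A) (hB : IsOpen B) (hf : ContMDiffOn I J ∞ f A) (hg : ContMDiffOn J I ∞ g B)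
    (hgf : ∀ a ∈ A, g (f a) = a) (hfg : ∀ b ∈ B, f (g b) = b) :
    PartialDiffeomorph I J N P ∞ where
  toFun := f
  invFun := g
  source := A ∩ f ⁻¹' B
  target := B ∩ g ⁻¹' A
  map_source' a ha := ⟨ha.2, by rw [mem_preimage, hgf a ha.1]; exact ha.1⟩
  map_target' b hb := ⟨hb.2, by rw [mem_preimage, hfg b hb.1]; exact hb.1⟩
  left_inv' a ha := hgf a ha.1
  right_inv' b hb := hfg b hb.1
  open_source := hf.continuousOn.isOpen_inter_preimage hA hB
  open_target := hg.continuousOn.isOpen_inter_preimage hB hA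
  contMDiffOn_toFun := hf.mono inter_subset_left
  contMDiffOn_invFun := hg.mono inter_subset_left

theorem IsLocalDiffeomorphAt.of_inverse {f : N → P} {g : P → N} {A : Set N} {B : Set P} {x : N}
    (hA : IsOpen A) (hB : IsOpen B) (hxA : x ∈ A) (hxB : f x ∈ B)
    (hf : ContMDiffOn I J ∞ f A) (hg : ContMDiffOn J I ∞ g B)
    (hgf : ∀ a ∈ A, g (f a) = a) (hfg : ∀ b ∈ B, f (g b) = b) :
    IsLocalDiffeomorphAt I J ∞ f x :=
  ⟨PartialDiffeomorph.ofInverse hA hB hf hg hgf hfg, ⟨hxA, hxB⟩, fun _ _ => rfl⟩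

/-- This is the inverse function theorem for `f` read in the extended charts. Without boundary their
targets are open, and the derivative on the manifold is an ordinary `fderiv`. -/
theorem isLocalDiffeomorphAt_of_bijective_mfderiv [I.Boundaryless] [J.Boundaryless]
    [IsManifold I ∞ N] [IsManifold J ∞ P] [FiniteDimensional ℝ E₁] [FiniteDimensional ℝ E₂]
    {f : N → P} {U : Set N} {x : N} (hU : IsOpen U) (hx : x ∈ U) (hf : ContMDiffOn I J ∞ f U)
    (hbij : Function.Bijective (mfderiv I J f x)) : IsLocalDiffeomorphAt I J ∞ f x := by
  have : CompleteSpace E₁ := FiniteDimensional.complete ℝ E₁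
  set c := extChartAt I x with hc
  set c' := extChartAt J (f x) with hc'
  set U₀ : Set E₁ := c.target ∩ c.symm ⁻¹' (U ∩ f ⁻¹' c'.source) with hU₀
  have hV : IsOpen (U ∩ f ⁻¹' c'.source) :=
    hf.continuousOn.isOpen_inter_preimage hU (isOpen_extChartAt_source (f x))
  have hU₀o : IsOpen U₀ :=
    (continuousOn_extChartAt_symm x).isOpen_inter_preimage (isOpen_extChartAt_target x) hV
  have hxV : x ∈ U ∩ f ⁻¹' c'.source := ⟨hx, mem_extChartAt_source (f x)⟩
  have hxU₀ : c x ∈ U₀ := by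
    refine ⟨mem_extChartAt_target x, ?_⟩
    rw [mem_preimage, extChartAt_to_inv]
    exact hxV
  have hcs : ContMDiffOn J 𝓘(ℝ, E₂) ∞ c' c'.source := by
    rw [hc', extChartAt_source]
    exact contMDiffOn_extChartAt
  have hF : ContDiffOn ℝ ∞ (c' ∘ f ∘ c.symm) U₀ := by
    rw [← contMDiffOn_iff_contDiffOn]
    refine hcs.comp ?_ fun u hu => hu.2.2
    exact hf.comp ((contMDiffOn_extChartAt_symm x).mono inter_subset_left) fun u hu => hu.2.1
  have hfx : MDifferentiableAt I J f x :=
    (hf.contMDiffAt (hU.mem_nhds hx)).mdifferentiableAt (by simp)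
  have hder : fderiv ℝ (c' ∘ f ∘ c.symm) (c x) = mfderiv I J f x := by
    rw [hfx.mfderiv, I.range_eq_univ, fderivWithin_univ]
    rfl
  let L : E₁ ≃L[ℝ] E₂ := (LinearEquiv.ofBijective
    (fderiv ℝ (c' ∘ f ∘ c.symm) (c x)).toLinearMap
      (by rw [hder]; exact hbij)).toContinuousLinearEquiv
  obtain ⟨g, A, B, hA, hAU, hB, hxA, hxB, hg, hgf, hfg, hgA⟩ :=
    exists_smooth_inverse_of_fderiv hU₀o hxU₀ hF L
      ((hF.contDiffAt (hU₀o.mem_nhds hxU₀)).differentiableAt (by simp)).hasFDerivAt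
  have hcx : c.symm (c x) = x := extChartAt_to_inv x
  refine IsLocalDiffeomorphAt.of_inverse (g := c.symm ∘ g ∘ c')
    (A := (c.source ∩ c ⁻¹' A)) (B := c'.source ∩ c' ⁻¹' B) ?_ ?_ ?_ ?_ ?_ ?_ ?_ ?_
  · exact (continuousOn_extChartAt x).isOpen_inter_preimage (isOpen_extChartAt_source x) hA
  · exact (continuousOn_extChartAt (f x)).isOpen_inter_preimage (isOpen_extChartAt_source (f x)) hB
  · exact ⟨mem_extChartAt_source x, hxA⟩
  · refine ⟨mem_extChartAt_source (f x), ?_⟩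
    simpa [hcx] using hxB
  · refine hf.mono fun a ha => ?_
    have := (hAU ha.2).2.1
    rwa [c.left_inv ha.1] at this
  · refine (contMDiffOn_extChartAt_symm x).comp (t := c.target) ?_ fun b hb => (hAU (hgA hb.2)).1
    exact (contMDiffOn_iff_contDiffOn.2 hg).comp
      (hcs.mono inter_subset_left) fun b hb => hb.2
  · intro a ha
    have := hgf (c a) ha.2
    simp only [Function.comp_apply, c.left_inv ha.1] at this ⊢
    rw [this, c.left_inv ha.1]
  · intro b hb
    have h1 := hfg (c' b) hb.2
    have h2 := (hAU (hgA hb.2)).2.2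
    simp only [Function.comp_apply] at h1 ⊢
    exact c'.injOn h2 hb.1 h1

end InverseFunction

/-! ### Tori and their orbit spaces -/

section Torus

variable {F : Type*} [NormedAddCommGroup F] [NormedSpace ℝ F]
  {T : Type*} [CommGroup T] [TopologicalSpace T] [ChartedSpace F T]

/-- `p` exhibits `T` as the torus `ℝᵏ / ℤᵏ`, `k = dim T`. -/
structure IsTorusParam (p : (Fin (Module.finrank ℝ F) → ℝ) → T) : Prop where
  isLocalDiffeomorph : IsLocalDiffeomorph 𝓘(ℝ, Fin (Module.finrank ℝ F) → ℝ) 𝓘(ℝ, F) ∞ p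
  surjective : Function.Surjective p
  map_add : ∀ u v, p (u + v) = p u * p v
  map_eq_one_iff : ∀ u, p u = 1 ↔ ∃ m : Fin (Module.finrank ℝ F) → ℤ, u = fun i => (m i : ℝ)

variable {p : (Fin (Module.finrank ℝ F) → ℝ) → T}

theorem IsTorusParam.map_zero (hp : IsTorusParam p) : p 0 = 1 :=
  (hp.map_eq_one_iff 0).2 ⟨0, by ext; simp⟩

theorem IsTorusParam.map_int (hp : IsTorusParam p) (m : Fin (Module.finrank ℝ F) → ℤ) :
    p (fun i => (m i : ℝ)) = 1 :=
  (hp.map_eq_one_iff _).2 ⟨m, rfl⟩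

theorem IsTorusParam.contMDiff (hp : IsTorusParam p) :
    ContMDiff 𝓘(ℝ, Fin (Module.finrank ℝ F) → ℝ) 𝓘(ℝ, F) ∞ p :=
  hp.isLocalDiffeomorph.contMDiff

theorem IsTorusParam.continuous (hp : IsTorusParam p) : Continuous p :=
  hp.contMDiff.continuous

/-- `T` is already the image of the unit cube, since fractional parts differ from the original
coordinates by an integer vector. -/
theorem IsTorusParam.compactSpace (hp : IsTorusParam p) : CompactSpace T := by
  have h : p '' Icc 0 1 = univ := by
    refine eq_univ_of_forall fun t => ?_
    obtain ⟨u, rfl⟩ := hp.surjective t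
    refine ⟨fun i => Int.fract (u i), ⟨fun i => Int.fract_nonneg _, fun i =>
      (Int.fract_lt_one _).le⟩,
      ?_⟩
    have : u = (fun i => Int.fract (u i)) + fun i => ((⌊u i⌋ : ℤ) : ℝ) := by
      ext i
      simp [Int.fract_add_floor]
    conv_rhs => rw [this, hp.map_add, hp.map_int, mul_one]
  exact ⟨h ▸ isCompact_Icc.image hp.continuous⟩

/-- The open surjection `p` is a quotient map and `ℤᵏ` is closed in `ℝᵏ`, so `{1}` is closed. For a
topological group this suffices. -/
theorem IsTorusParam.t2Space [IsTopologicalGroup T] (hp : IsTorusParam p) : T2Space T := by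
  have hq : IsOpenQuotientMap p :=
    ⟨hp.surjective, hp.continuous, hp.isLocalDiffeomorph.isOpenMap⟩
  have hc : IsClosed ({1} : Set T) := by
    rw [← hq.isQuotientMap.isClosed_preimage]
    have : p ⁻¹' {1} = univ.pi fun _ => range ((↑) : ℤ → ℝ) := by
      ext u
      simp only [mem_preimage, mem_singleton_iff, hp.map_eq_one_iff, mem_univ_pi, mem_range]
      constructor
      · rintro ⟨m, rfl⟩ i
        exact ⟨m i, rfl⟩
      · intro h
        choose m hm using h
        exact ⟨m, funext fun i => (hm i).symm⟩
    rw [this]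
    exact isClosed_set_pi fun _ _ => Int.isClosedEmbedding_coe_real.isClosed_range
  have : T1Space T := IsTopologicalGroup.t1Space T hc
  infer_instance

theorem IsTorusParam.surjective_mfderiv (hp : IsTorusParam p) (u) :
    Function.Surjective (mfderiv 𝓘(ℝ, Fin (Module.finrank ℝ F) → ℝ) 𝓘(ℝ, F) p u) :=
  ((hp.isLocalDiffeomorph u).mfderivToContinuousLinearEquiv (by simp)).surjective

end Torus

section OrbitSpace

theorem isOpenQuotientMap_orbitProj {M T : Type*} [TopologicalSpace M] [TopologicalSpace T]
    [CommGroup T] [MulAction T M] [ContinuousSMul T M] :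
    IsOpenQuotientMap (orbitProj T : M → OrbitSpace M T) :=
  MulAction.isOpenQuotientMap_quotientMk

theorem orbitProj_eq_iff {M T : Type*} [CommGroup T] [MulAction T M] {x y : M} :
    orbitProj T x = orbitProj T y ↔ ∃ t : T, t • y = x :=
  Quotient.eq.trans MulAction.orbitRel_apply

theorem orbitProj_smul {M T : Type*} [CommGroup T] [MulAction T M] (t : T) (x : M) :
    orbitProj T (t • x) = orbitProj T x :=
  orbitProj_eq_iff.2 ⟨t, rfl⟩

/-- The action of a compact group on a compact Hausdorff space is proper, so the quotient is
Hausdorff. It is also compact and second countable, and Urysohn's theorem applies. -/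
theorem metrizableSpace_orbitSpace (E : Type*) [NormedAddCommGroup E] [NormedSpace ℝ E]
    [FiniteDimensional ℝ E] (M : Type*) [TopologicalSpace M] [ChartedSpace E M] [T2Space M]
    [CompactSpace M] (T : Type*) [CommGroup T] [TopologicalSpace T] [CompactSpace T] [T2Space T]
    [MulAction T M] [ContinuousSMul T M] : MetrizableSpace (OrbitSpace M T) := by
  have : SecondCountableTopology M := ChartedSpace.secondCountable_of_sigmaCompact E M
  have : SecondCountableTopology (OrbitSpace M T) :=
    ContinuousConstSMul.secondCountableTopology
  have : ProperSMul T M :=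
    ⟨Continuous.isProperMap (by fun_prop)⟩
  have : T2Space (OrbitSpace M T) := t2Space_quotient_mulAction_of_properSMul
  have : CompactSpace (OrbitSpace M T) := inferInstance
  infer_instance

end OrbitSpace

/-! ### The pullback of an invariant form by the action in a chart -/

section ActChart

variable {E : Type*} [NormedAddCommGroup E] [NormedSpace ℝ E]
  {F : Type*} [NormedAddCommGroup F] [NormedSpace ℝ F]
  {V : Type*} [NormedAddCommGroup V] [NormedSpace ℝ V]
  {M : Type*} [TopologicalSpace M] [ChartedSpace E M]
  {T : Type*} [CommGroup T] [TopologicalSpace T] [ChartedSpace F T] [MulAction T M]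

/-- The infinitesimal action of `V` on `M` defined by a homomorphism `p : V → T`. -/
def infAct (E : Type*) [NormedAddCommGroup E] [NormedSpace ℝ E] [ChartedSpace E M]
    (p : V → T) (x : M) : V →L[ℝ] TangentSpace 𝓘(ℝ, E) x :=
  mfderiv 𝓘(ℝ, V) 𝓘(ℝ, E) (fun a : V => p a • x) 0

/-- The action of `V` through `p`, on points given in the preferred chart at `x₀`. -/
def actChart (p : V → T) (x₀ : M) (q : V × E) : M := p q.1 • (chartAt E x₀).symm q.2

/-- The pullback of `σ` by `actChart p x₀`. -/
def pullForm (σ : TwoForm E M) (p : V → T) (x₀ : M) (q : V × E) : (V × E) [⋀^Fin 2]→L[ℝ] ℝ :=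
  (σ (actChart p x₀ q)).compContinuousLinearMap
    (mfderiv 𝓘(ℝ, V × E) 𝓘(ℝ, E) (actChart p x₀) q)

theorem isOpen_univ_prod_chart_target {V E M : Type*} [TopologicalSpace V] [TopologicalSpace E]
    [TopologicalSpace M] [ChartedSpace E M] (x₀ : M) :
    IsOpen ((univ : Set V) ×ˢ (chartAt E x₀).target) :=
  isOpen_univ.prod (chartAt E x₀).open_target

variable [IsManifold 𝓘(ℝ, E) ∞ M] [ContMDiffSMul 𝓘(ℝ, F) 𝓘(ℝ, E) ∞ T M]
  {σ : TwoForm E M} {p : V → T} {x₀ : M}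

theorem contMDiffOn_actChart (hp : ContMDiff 𝓘(ℝ, V) 𝓘(ℝ, F) ∞ p) (x₀ : M) :
    ContMDiffOn 𝓘(ℝ, V × E) 𝓘(ℝ, E) ∞ (actChart p x₀) (univ ×ˢ (chartAt E x₀).target) := by
  refine ContMDiffOn.smul (I := 𝓘(ℝ, F)) (f := fun q : V × E => p q.1)
    (g := fun q : V × E => (chartAt E x₀).symm q.2) ?_ ?_
  · exact (hp.comp contDiff_fst.contMDiff).contMDiffOn
  · exact (contMDiffOn_chart_symm (I := 𝓘(ℝ, E))).comp contDiff_snd.contMDiff.contMDiffOn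
      fun q hq => hq.2

theorem mdifferentiableAt_actChart (hp : ContMDiff 𝓘(ℝ, V) 𝓘(ℝ, F) ∞ p) {q : V × E}
    (hq : q.2 ∈ (chartAt E x₀).target) :
    MDifferentiableAt 𝓘(ℝ, V × E) 𝓘(ℝ, E) (actChart p x₀) q :=
  ((contMDiffOn_actChart hp x₀).contMDiffAt
    ((isOpen_univ_prod_chart_target x₀).mem_nhds ⟨mem_univ _, hq⟩)).mdifferentiableAt (by simp)

/-- As `p` is a homomorphism, a translation by `a` before the action map amounts to the
diffeomorphism `p a` after it, and that one preserves `σ`. -/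
theorem pullForm_translate (hp : ContMDiff 𝓘(ℝ, V) 𝓘(ℝ, F) ∞ p)
    (hadd : ∀ u v, p (u + v) = p u * p v) (hσT : IsInvariantForm T σ) (a b : V) {u : E}
    (hu : u ∈ (chartAt E x₀).target) :
    pullForm σ p x₀ (a + b, u) = pullForm σ p x₀ (b, u) := by
  have h1 : (fun q : V × E => actChart p x₀ ((a, 0) + q)) =
      fun q => p a • actChart p x₀ q := by
    funext q
    simp [actChart, hadd, mul_smul]
  have hd := mdifferentiableAt_actChart (x₀ := x₀) hp (q := (b, u)) hu
  have hd' := mdifferentiableAt_actChart (x₀ := x₀) hp (q := (a, 0) + (b, u)) (by simpa using hu)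
  have hs : MDifferentiableAt 𝓘(ℝ, E) 𝓘(ℝ, E) (fun y : M => p a • y) (actChart p x₀ (b, u)) :=
    ((ContMDiffSMul.contMDiff_const_smul (I := 𝓘(ℝ, F)) (I' := 𝓘(ℝ, E)) (n := ∞) (p a)
      ).contMDiffAt).mdifferentiableAt (by simp)
  have e1 : mfderiv 𝓘(ℝ, V × E) 𝓘(ℝ, E) (fun q : V × E => actChart p x₀ ((a, 0) + q)) (b, u) =
      mfderiv 𝓘(ℝ, V × E) 𝓘(ℝ, E) (actChart p x₀) ((a, 0) + (b, u)) := by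
    have ht : HasMFDerivAt 𝓘(ℝ, V × E) 𝓘(ℝ, V × E) (fun q : V × E => (a, (0 : E)) + q) (b, u)
        (ContinuousLinearMap.id ℝ (V × E)) :=
      ((hasFDerivAt_id (𝕜 := ℝ) (b, u)).const_add (a, (0 : E))).hasMFDerivAt
    have := (hd'.hasMFDerivAt.comp (b, u) ht).mfderiv
    exact this.trans (ContinuousLinearMap.comp_id _)
  have e2 : mfderiv 𝓘(ℝ, V × E) 𝓘(ℝ, E) (fun q : V × E => p a • actChart p x₀ q) (b, u) =
      (mfderiv 𝓘(ℝ, E) 𝓘(ℝ, E) (fun y : M => p a • y) (actChart p x₀ (b, u))).comp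
        (mfderiv 𝓘(ℝ, V × E) 𝓘(ℝ, E) (actChart p x₀) (b, u)) :=
    mfderiv_comp (b, u) hs hd
  have h2 : ((a + b, u) : V × E) = (a, 0) + (b, u) := by simp
  have h3 : actChart p x₀ ((a, 0) + (b, u)) = p a • actChart p x₀ (b, u) := congrFun h1 (b, u)
  rw [h2, pullForm, pullForm, ← hσT (p a) (actChart p x₀ (b, u))]
  rw [h1] at e1
  rw [← e1, e2]
  -- All tangent spaces unfold to `E`. Viewing `σ` as a non-dependent function allows its base point
  -- to be rewritten.
  let σ' : M → E [⋀^Fin 2]→L[ℝ] ℝ := σ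
  change (σ' _).compContinuousLinearMap _ =
    ((σ' _).compContinuousLinearMap _).compContinuousLinearMap _
  rw [h3]
  rfl

/-- Smoothness and closedness of `σ` are given for its chart expressions. Near `(0, u)` the action
does not leave the chart, so the pullback is that of a form on `E` under a smooth map of vector
spaces, and both properties carry over. -/
theorem pullForm_eventuallyEq (hp : ContMDiff 𝓘(ℝ, V) 𝓘(ℝ, F) ∞ p) (h0 : p 0 = 1) {u : E}
    (hu : u ∈ (chartAt E x₀).target) :
    (ContDiffAt ℝ ∞ (chartAt E x₀ ∘ actChart p x₀) (0, u)) ∧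
    (chartAt E x₀ ∘ actChart p x₀) (0, u) = u ∧
    pullForm σ p x₀ =ᶠ[𝓝 (0, u)] fun q =>
      (σ.inChart x₀ ((chartAt E x₀ ∘ actChart p x₀) q)).compContinuousLinearMap
        (fderiv ℝ (chartAt E x₀ ∘ actChart p x₀) q) := by
  set c := chartAt E x₀ with hc
  set N : Set (V × E) := (univ ×ˢ c.target) ∩ actChart p x₀ ⁻¹' c.source with hN
  have hNo : IsOpen N := (contMDiffOn_actChart hp x₀).continuousOn.isOpen_inter_preimage
    (isOpen_univ_prod_chart_target x₀) c.open_source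
  have h00 : actChart p x₀ (0, u) = c.symm u := by simp [actChart, h0, hc]
  have hmem : (0, u) ∈ N := ⟨⟨mem_univ _, hu⟩, by rw [mem_preimage, h00]; exact c.map_target hu⟩
  have hsm : ContDiffOn ℝ ∞ (c ∘ actChart p x₀) N := by
    rw [← contMDiffOn_iff_contDiffOn]
    exact (contMDiffOn_chart (I := 𝓘(ℝ, E))).comp
      ((contMDiffOn_actChart hp x₀).mono inter_subset_left) fun q hq => hq.2
  refine ⟨hsm.contDiffAt (hNo.mem_nhds hmem), ?_, ?_⟩
  · simp only [Function.comp_apply, h00]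
    exact c.right_inv hu
  · filter_upwards [hNo.mem_nhds hmem] with q hq
    have hcs : c (actChart p x₀ q) ∈ c.target := c.map_source hq.2
    have e1 : actChart p x₀ =ᶠ[𝓝 q] c.symm ∘ (c ∘ actChart p x₀) := by
      filter_upwards [hNo.mem_nhds hq] with q' hq'
      exact (c.left_inv hq'.2).symm
    have hd : MDifferentiableAt 𝓘(ℝ, E) 𝓘(ℝ, E) c.symm ((c ∘ actChart p x₀) q) :=
      ((contMDiffOn_chart_symm (I := 𝓘(ℝ, E)) (n := ∞)).contMDiffAt
        (c.open_target.mem_nhds hcs)).mdifferentiableAt (by simp)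
    have hd' : DifferentiableAt ℝ (c ∘ actChart p x₀) q :=
      (hsm.contDiffAt (hNo.mem_nhds hq)).differentiableAt (by simp)
    have e2 : mfderiv 𝓘(ℝ, V × E) 𝓘(ℝ, E) (actChart p x₀) q =
        (mfderiv 𝓘(ℝ, E) 𝓘(ℝ, E) c.symm ((c ∘ actChart p x₀) q)).comp
          (fderiv ℝ (c ∘ actChart p x₀) q) := by
      exact e1.mfderiv_eq.trans
        (hd.hasMFDerivAt.comp q hd'.hasFDerivAt.hasMFDerivAt).mfderiv
    let σ' : M → E [⋀^Fin 2]→L[ℝ] ℝ := σ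
    change (σ' _).compContinuousLinearMap _ =
      ((σ' (c.symm (c (actChart p x₀ q)))).compContinuousLinearMap _).compContinuousLinearMap _
    rw [e2, c.left_inv hq.2]
    rfl

end ActChart

/-! ### Closed two-forms invariant under translations -/

section TranslationInvariant

variable {E : Type*} [NormedAddCommGroup E] [NormedSpace ℝ E]
  {V : Type*} [NormedAddCommGroup V] [NormedSpace ℝ V]

theorem extDeriv_two_form_apply {η : E → E [⋀^Fin 2]→L[ℝ] ℝ} {x : E}
    (h : DifferentiableAt ℝ η x) (u v w : E) :
    extDeriv η x ![u, v, w] = fderiv ℝ (fun y => η y ![v, w]) x u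
      - fderiv ℝ (fun y => η y ![u, w]) x v + fderiv ℝ (fun y => η y ![u, v]) x w := by
  have h0 : (0 : Fin 3).removeNth ![u, v, w] = ![v, w] := by
    funext i; fin_cases i <;> rfl
  have h1 : (1 : Fin 3).removeNth ![u, v, w] = ![u, w] := by
    funext i; fin_cases i <;> rfl
  have h2 : (2 : Fin 3).removeNth ![u, v, w] = ![u, v] := by
    funext i; fin_cases i <;> rfl
  rw [extDeriv_apply h, Fin.sum_univ_three, h0, h1, h2]
  simp
  ring

variable {η : V × E → (V × E) [⋀^Fin 2]→L[ℝ] ℝ} {U : Set E}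

theorem differentiableAt_two_form_apply {η : E → E [⋀^Fin 2]→L[ℝ] ℝ} {x : E}
    (h : DifferentiableAt ℝ η x) (m : Fin 2 → E) : DifferentiableAt ℝ (fun y => η y m) x := by
  fun_prop

/-- Translation invariance lets `η` factor through the second projection near `(0, u)`, so only the
`E`-component of the direction counts. -/
theorem fderiv_apply_of_translate (hU : IsOpen U) (hη : ∀ u ∈ U, DifferentiableAt ℝ η (0, u))
    (hinv : ∀ u ∈ U, ∀ a, η (a, u) = η (0, u)) {u : E} (hu : u ∈ U) (m : Fin 2 → V × E)
    (a : V) (v : E) :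
    fderiv ℝ (fun q => η q m) (0, u) (a, v) = fderiv ℝ (fun u' => η (0, u') m) u v := by
  have h1 : (fun q => η q m) =ᶠ[𝓝 ((0, u) : V × E)] fun q => (fun u' => η (0, u') m) q.2 := by
    have : ∀ᶠ q : V × E in 𝓝 (0, u), q.2 ∈ U :=
      continuous_snd.continuousAt.eventually (hU.mem_nhds hu)
    filter_upwards [this] with q hq
    rw [← hinv q.2 hq q.1]
  have h2 : DifferentiableAt ℝ (fun u' => η ((0 : V), u') m) u := by
    have h3 : DifferentiableAt ℝ (fun u' : E => ((0 : V), u')) u := by fun_prop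
    exact differentiableAt_two_form_apply (x := (0, u)) (hη u hu) m |>.comp u h3
  rw [h1.fderiv_eq]
  have := (h2.hasFDerivAt.comp ((0, u) : V × E) (hasFDerivAt_snd (𝕜 := ℝ))).fderiv
  exact (congrArg (fun L => L (a, v)) this).trans rfl

/-- Of the three terms of `dη(a, b, v)`, the two that differentiate along `V` vanish; the third is
the derivative of `η(a, b)` along `v`. -/
theorem fderiv_two_form_eq_zero (hU : IsOpen U) (hη : ∀ u ∈ U, DifferentiableAt ℝ η (0, u))
    (hinv : ∀ u ∈ U, ∀ a, η (a, u) = η (0, u)) (hcl : ∀ u ∈ U, extDeriv η (0, u) = 0)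
    {u : E} (hu : u ∈ U) (a b : V) :
    fderiv ℝ (fun u' => η (0, u') ![(a, 0), (b, 0)]) u = 0 := by
  ext v
  have h := extDeriv_two_form_apply (hη u hu) (a, 0) (b, 0) (0, v)
  rw [hcl u hu] at h
  simp only [fderiv_apply_of_translate hU hη hinv hu] at h
  simpa using h.symm

/-- In `dη(a, v, w)` the derivative along `a` vanishes, and what remains is, up to sign, the
exterior derivative of the one-form `η(a, ·)` on `E`. Symmetry is its closedness, in the form needed
for the Poincaré lemma. -/
theorem fderiv_two_form_symm (hU : IsOpen U) (hη : ∀ u ∈ U, DifferentiableAt ℝ η (0, u))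
    (hinv : ∀ u ∈ U, ∀ a, η (a, u) = η (0, u)) (hcl : ∀ u ∈ U, extDeriv η (0, u) = 0)
    {u : E} (hu : u ∈ U) (a : V) (v w : E) :
    fderiv ℝ (fun u' => η (0, u') ![(a, 0), (0, v)]) u w =
      fderiv ℝ (fun u' => η (0, u') ![(a, 0), (0, w)]) u v := by
  have h := extDeriv_two_form_apply (hη u hu) (a, 0) (0, v) (0, w)
  rw [hcl u hu] at h
  simp only [fderiv_apply_of_translate hU hη hinv hu] at h
  simp at h
  linarith

end TranslationInvariant

/-! ### Invariant symplectic forms and the infinitesimal generators -/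

section InvariantForm

variable {E : Type*} [NormedAddCommGroup E] [NormedSpace ℝ E]
  {F : Type*} [NormedAddCommGroup F] [NormedSpace ℝ F]
  {V : Type*} [NormedAddCommGroup V] [NormedSpace ℝ V]
  {M : Type*} [TopologicalSpace M] [ChartedSpace E M]
  {T : Type*} [CommGroup T] [TopologicalSpace T] [ChartedSpace F T] [MulAction T M]
  [IsManifold 𝓘(ℝ, E) ∞ M] [ContMDiffSMul 𝓘(ℝ, F) 𝓘(ℝ, E) ∞ T M]
  {σ : TwoForm E M} {p : V → T} {x₀ : M}

theorem contDiffAt_pullForm_apply (hσ : IsSymplecticForm σ) (hp : ContMDiff 𝓘(ℝ, V) 𝓘(ℝ, F) ∞ p)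
    (h0 : p 0 = 1) {u : E} (hu : u ∈ (chartAt E x₀).target) :
    ∀ m : Fin 2 → V × E, ContDiffAt ℝ ∞ (fun q => pullForm σ p x₀ q m) (0, u) := by
  intro m
  obtain ⟨h1, h2, h3⟩ := pullForm_eventuallyEq (σ := σ) hp h0 hu
  have h4 : ContDiffAt ℝ ∞ (σ.inChart x₀) ((chartAt E x₀ ∘ actChart p x₀) (0, u)) := by
    rw [h2]
    exact (hσ.smooth x₀).contDiffAt ((chartAt E x₀).open_target.mem_nhds hu)
  have h5 := h4.comp (0, u) h1
  have h6 : ContDiffAt ℝ ∞ (fderiv ℝ (chartAt E x₀ ∘ actChart p x₀)) (0, u) :=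
    h1.fderiv_right (by simp)
  refine ContDiffAt.congr_of_eventuallyEq ?_ (h3.fun_comp fun η => η m)
  -- On the underlying multilinear maps, pulling back is linear in the form and multilinear in the
  -- derivatives, hence smooth in both.
  have h7 := (ContinuousAlternatingMap.toContinuousMultilinearMapCLM ℝ :
    (E [⋀^Fin 2]→L[ℝ] ℝ) →L[ℝ] _).contDiff (n := ∞) |>.contDiffAt.comp (0, u) h5
  have h8' : ContDiff ℝ ∞ (ContinuousMultilinearMap.compContinuousLinearMapContinuousMultilinear ℝ
      (fun _ : Fin 2 => V × E) (fun _ : Fin 2 => E) ℝ) :=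
    ContinuousMultilinearMap.contDiff (𝕜 := ℝ) (ι := Fin 2) (E := fun _ => V × E →L[ℝ] E)
      (F := (E [×2]→L[ℝ] ℝ) →L[ℝ] (V × E) [×2]→L[ℝ] ℝ) _
  have h8 := h8'.contDiffAt.comp (0, u) (contDiffAt_pi.2 fun _ => h6)
  have h9 := (ContinuousMultilinearMap.apply ℝ (fun _ : Fin 2 => V × E) ℝ m).contDiff (n := ∞)
    |>.contDiffAt.comp (0, u) (h8.clm_apply h7)
  exact h9

theorem extDeriv_pullForm (hσ : IsSymplecticForm σ) (hp : ContMDiff 𝓘(ℝ, V) 𝓘(ℝ, F) ∞ p)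
    (h0 : p 0 = 1) {u : E} (hu : u ∈ (chartAt E x₀).target) :
    extDeriv (pullForm σ p x₀) (0, u) = 0 := by
  obtain ⟨h1, h2, h3⟩ := pullForm_eventuallyEq (σ := σ) hp h0 hu
  have h4 : DifferentiableAt ℝ (σ.inChart x₀) ((chartAt E x₀ ∘ actChart p x₀) (0, u)) := by
    rw [h2]
    exact ((hσ.smooth x₀).contDiffAt ((chartAt E x₀).open_target.mem_nhds hu)).differentiableAt
      (by simp)
  rw [h3.extDeriv_eq, extDeriv_pullback h4 h1 (r := ∞) (by
    rw [minSmoothness_of_isRCLikeNormedField]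
    exact ENat.LEInfty.out), h2, hσ.closed x₀ u hu]
  ext; rfl


theorem differentiableAt_pullForm (hσ : IsSymplecticForm σ)
    (hp : ContMDiff 𝓘(ℝ, V) 𝓘(ℝ, F) ∞ p) (h0 : p 0 = 1) {u : E}
    (hu : u ∈ (chartAt E x₀).target) : DifferentiableAt ℝ (pullForm σ p x₀) (0, u) := by
  obtain ⟨h1, h2, h3⟩ := pullForm_eventuallyEq (σ := σ) hp h0 hu
  have h4 : DifferentiableAt ℝ (σ.inChart x₀) ((chartAt E x₀ ∘ actChart p x₀) (0, u)) := by
    rw [h2]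
    exact ((hσ.smooth x₀).contDiffAt ((chartAt E x₀).open_target.mem_nhds hu)).differentiableAt
      (by simp)
  have h6 : ContDiffAt ℝ ∞ (fderiv ℝ (chartAt E x₀ ∘ actChart p x₀)) (0, u) :=
    h1.fderiv_right (by simp)
  refine DifferentiableAt.congr_of_eventuallyEq ?_ h3
  exact (h4.comp (0, u) (h1.differentiableAt (by simp))
    ).continuousAlternatingMapCompContinuousLinearMap (h6.differentiableAt (by simp))

theorem infAct_eq_mfderiv_actChart (hp : ContMDiff 𝓘(ℝ, V) 𝓘(ℝ, F) ∞ p) {u : E}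
    (hu : u ∈ (chartAt E x₀).target) (a : V) :
    mfderiv 𝓘(ℝ, V × E) 𝓘(ℝ, E) (actChart p x₀) (0, u) (a, 0) =
      infAct E p ((chartAt E x₀).symm u) a := by
  have h1 : HasMFDerivAt 𝓘(ℝ, V) 𝓘(ℝ, V × E) (fun b : V => (b, u)) 0
      (ContinuousLinearMap.inl ℝ V E) :=
    (hasFDerivAt_prodMk_left (𝕜 := ℝ) (0 : V) u).hasMFDerivAt
  have h2 := (mdifferentiableAt_actChart (x₀ := x₀) hp (q := (0, u)) hu).hasMFDerivAt
  exact (congrArg (fun L : V →L[ℝ] E => L a) (h2.comp (0 : V) h1).mfderiv).symm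

theorem mfderiv_chart_symm_eq_mfderiv_actChart (hp : ContMDiff 𝓘(ℝ, V) 𝓘(ℝ, F) ∞ p)
    (h0 : p 0 = 1) {u : E} (hu : u ∈ (chartAt E x₀).target) (v : E) :
    mfderiv 𝓘(ℝ, V × E) 𝓘(ℝ, E) (actChart p x₀) (0, u) (0, v) =
      mfderiv 𝓘(ℝ, E) 𝓘(ℝ, E) (chartAt E x₀).symm u v := by
  have h1 : HasMFDerivAt 𝓘(ℝ, E) 𝓘(ℝ, V × E) (fun b : E => ((0 : V), b)) u
      (ContinuousLinearMap.inr ℝ V E) :=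
    (hasFDerivAt_prodMk_right (𝕜 := ℝ) (0 : V) u).hasMFDerivAt
  have h2 := (mdifferentiableAt_actChart (x₀ := x₀) hp (q := (0, u)) hu).hasMFDerivAt
  have h3 : actChart p x₀ ∘ (fun b : E => ((0 : V), b)) = (chartAt E x₀).symm := by
    funext b
    simp [actChart, h0]
  have h4 := h2.comp u h1
  rw [h3] at h4
  exact (congrArg (fun L : E →L[ℝ] E => L v) h4.mfderiv).symm

theorem pullForm_apply_left (hp : ContMDiff 𝓘(ℝ, V) 𝓘(ℝ, F) ∞ p) (h0 : p 0 = 1) {u : E}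
    (hu : u ∈ (chartAt E x₀).target) (a b : V) :
    pullForm σ p x₀ (0, u) ![(a, 0), (b, 0)] =
      σ ((chartAt E x₀).symm u) ![infAct E p ((chartAt E x₀).symm u) a,
        infAct E p ((chartAt E x₀).symm u) b] := by
  rw [← infAct_eq_mfderiv_actChart hp hu, ← infAct_eq_mfderiv_actChart hp hu]
  have h : actChart p x₀ (0, u) = (chartAt E x₀).symm u := by simp [actChart, h0]
  let σ' : M → E [⋀^Fin 2]→L[ℝ] ℝ := σ
  change σ' (actChart p x₀ (0, u)) _ = σ' _ _
  rw [h]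
  congr 1
  funext i
  fin_cases i <;> rfl

theorem pullForm_apply_mixed (hp : ContMDiff 𝓘(ℝ, V) 𝓘(ℝ, F) ∞ p) (h0 : p 0 = 1) {u : E}
    (hu : u ∈ (chartAt E x₀).target) (a : V) (v : E) :
    pullForm σ p x₀ (0, u) ![(a, 0), (0, v)] =
      σ ((chartAt E x₀).symm u) ![infAct E p ((chartAt E x₀).symm u) a,
        mfderiv 𝓘(ℝ, E) 𝓘(ℝ, E) (chartAt E x₀).symm u v] := by
  rw [← infAct_eq_mfderiv_actChart hp hu, ← mfderiv_chart_symm_eq_mfderiv_actChart hp h0 hu]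
  have h : actChart p x₀ (0, u) = (chartAt E x₀).symm u := by simp [actChart, h0]
  let σ' : M → E [⋀^Fin 2]→L[ℝ] ℝ := σ
  change σ' (actChart p x₀ (0, u)) _ = σ' _ _
  rw [h]
  congr 1
  funext i
  fin_cases i <;> rfl

/-- The infinitesimal generators of an action of an abelian group by symplectomorphisms have
constant symplectic products. -/
theorem isLocallyConstant_symplectic_infAct (hσ : IsSymplecticForm σ) (hσT : IsInvariantForm T σ)
    (hp : ContMDiff 𝓘(ℝ, V) 𝓘(ℝ, F) ∞ p) (h0 : p 0 = 1) (hadd : ∀ u v, p (u + v) = p u * p v)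
    (a b : V) : IsLocallyConstant fun x : M => σ x ![infAct E p x a, infAct E p x b] := by
  rw [IsLocallyConstant.iff_exists_open]
  intro x₀
  set c := chartAt E x₀ with hc
  have hx : c x₀ ∈ c.target := c.map_source (mem_chart_source E x₀)
  obtain ⟨r, hr, hball⟩ := Metric.isOpen_iff.1 c.open_target _ hx
  have hz : ∀ u ∈ c.target,
      fderiv ℝ (fun u' => pullForm σ p x₀ (0, u') ![(a, 0), (b, 0)]) u = 0 := fun u hu =>
    fderiv_two_form_eq_zero c.open_target (fun u hu => differentiableAt_pullForm hσ hp h0 hu)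
      (fun u hu a' => by simpa using pullForm_translate hp hadd hσT a' 0 hu)
      (fun u hu => extDeriv_pullForm hσ hp h0 hu) hu a b
  have hd : ∀ u ∈ c.target,
      DifferentiableAt ℝ (fun u' => pullForm σ p x₀ (0, u') ![(a, 0), (b, 0)]) u := by
    intro u hu
    exact (differentiableAt_two_form_apply (differentiableAt_pullForm hσ hp h0 hu)
      ![(a, 0), (b, 0)]).comp u (f := fun u' : E => ((0 : V), u')) (by fun_prop)
  refine ⟨c.source ∩ c ⁻¹' Metric.ball (c x₀) r, c.isOpen_inter_preimage Metric.isOpen_ball,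
    ⟨mem_chart_source E x₀, Metric.mem_ball_self hr⟩, fun y hy => ?_⟩
  -- A function with vanishing derivative on a ball is constant there.
  have key := (convex_ball (c x₀) r).is_const_of_fderivWithin_eq_zero (𝕜 := ℝ)
    (f := fun u' => pullForm σ p x₀ (0, u') ![(a, 0), (b, 0)])
    (fun u hu => (hd u (hball hu)).differentiableWithinAt)
    (fun u hu => by rw [fderivWithin_of_isOpen Metric.isOpen_ball hu, hz u (hball hu)])
    hy.2 (Metric.mem_ball_self hr)
  rw [pullForm_apply_left hp h0 (hball hy.2), pullForm_apply_left hp h0 hx] at key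
  let g : M → ℝ := fun x => σ x ![infAct E p x a, infAct E p x b]
  change g (c.symm (c y)) = g (c.symm (c x₀)) at key
  rwa [c.left_inv hy.1, c.left_inv (mem_chart_source E x₀)] at key

end InvariantForm

/-! ### Symplectic linear algebra -/

section LinearAlgebra

variable {E : Type*} [NormedAddCommGroup E] [NormedSpace ℝ E]

/-- The bilinear form defined by an alternating two-form. -/
def ContinuousAlternatingMap.toBilin (η : E [⋀^Fin 2]→L[ℝ] ℝ) : E →ₗ[ℝ] E →ₗ[ℝ] ℝ :=
  have hu : ∀ v x : E, Function.update ![v, 0] 1 x = ![v, x] := fun v x => by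
    funext j; fin_cases j <;> simp
  LinearMap.mk₂ ℝ (fun v w => η ![v, w])
    (fun a b w => η.toAlternatingMap.map_vecCons_add ![w] a b)
    (fun c a w => η.toAlternatingMap.map_vecCons_smul ![w] c a)
    (fun v a b => by
      have h := η.map_update_add ![v, 0] 1 a b
      rwa [hu, hu, hu] at h)
    (fun c v a => by
      have h := η.map_update_smul ![v, 0] 1 c a
      rwa [hu, hu] at h)

theorem ContinuousAlternatingMap.toBilin_swap (η : E [⋀^Fin 2]→L[ℝ] ℝ) (v w : E) :
    η ![v, w] = - η ![w, v] := by
  have h := η.toAlternatingMap.map_swap ![w, v] (i := 0) (j := 1) (by decide)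
  have h2 : ![w, v] ∘ Equiv.swap (0 : Fin 2) 1 = ![v, w] := by
    funext i; fin_cases i <;> simp
  rw [h2] at h
  exact h

/-- Nondegeneracy makes `a ↦ B (A a) (A ·)` an injection of `V` into its dual, hence a bijection.
The functional `B v (A ·)` is therefore represented by some `a`, and `A a` is the component of `v`
in the range. -/
theorem isCompl_orthogonal_range {V : Type*} [AddCommGroup V] [Module ℝ V] [FiniteDimensional ℝ V]
    (B : E →ₗ[ℝ] E →ₗ[ℝ] ℝ) (A : V →ₗ[ℝ] E) (hnd : ∀ a, (∀ b, B (A a) (A b) = 0) → a = 0)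
    (W : Submodule ℝ E) (hW : ∀ v, v ∈ W ↔ ∀ b, B v (A b) = 0) :
    IsCompl W (LinearMap.range A) := by
  rw [isCompl_iff, Submodule.disjoint_def, codisjoint_iff, Submodule.eq_top_iff']
  constructor
  · rintro v hv ⟨a, rfl⟩
    rw [hnd a ((hW _).1 hv), map_zero]
  · intro v
    let D : V →ₗ[ℝ] Module.Dual ℝ V := (B.compl₁₂ A A)
    have hinj : Function.Injective D := by
      rw [injective_iff_map_eq_zero]
      intro a ha
      exact hnd a fun b => LinearMap.congr_fun ha b
    have hsurj : Function.Surjective D :=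
      (LinearMap.injective_iff_surjective_of_finrank_eq_finrank
        Subspace.dual_finrank_eq.symm).1 hinj
    obtain ⟨a, ha⟩ := hsurj ((B v).comp A)
    refine Submodule.mem_sup.2 ⟨v - A a, (hW _).2 fun b => ?_, A a, ⟨a, rfl⟩, by simp⟩
    have := LinearMap.congr_fun ha b
    simp only [D, LinearMap.compl₁₂_apply, LinearMap.comp_apply] at this
    rw [map_sub, LinearMap.sub_apply, this, sub_self]

end LinearAlgebra

/-! ### Local moment maps -/

section MomentMap

variable {E : Type*} [NormedAddCommGroup E] [NormedSpace ℝ E]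
  {M : Type*} [TopologicalSpace M] [ChartedSpace E M] [IsManifold 𝓘(ℝ, E) ∞ M]

theorem mfderiv_chartAt_symm_comp_mfderiv_chartAt {x₀ y : M} (hy : y ∈ (chartAt E x₀).source)
    (v : TangentSpace 𝓘(ℝ, E) y) :
    mfderiv 𝓘(ℝ, E) 𝓘(ℝ, E) (chartAt E x₀).symm (chartAt E x₀ y)
      (mfderiv 𝓘(ℝ, E) 𝓘(ℝ, E) (chartAt E x₀) y v) = v := by
  set c := chartAt E x₀
  have h1 : MDifferentiableAt 𝓘(ℝ, E) 𝓘(ℝ, E) c.symm (c y) :=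
    mdifferentiableAt_atlas_symm (chart_mem_atlas E x₀) (c.map_source hy)
  have h2 : MDifferentiableAt 𝓘(ℝ, E) 𝓘(ℝ, E) c y :=
    mdifferentiableAt_atlas (chart_mem_atlas E x₀) hy
  have h3 := (h1.hasMFDerivAt.comp y h2.hasMFDerivAt).mfderiv
  have h4 : c.symm ∘ c =ᶠ[𝓝 y] id := by
    filter_upwards [c.open_source.mem_nhds hy] with z hz using c.left_inv hz
  have h5 := h4.mfderiv_eq (I := 𝓘(ℝ, E)) (I' := 𝓘(ℝ, E))
  have h6 : (mfderiv 𝓘(ℝ, E) 𝓘(ℝ, E) (c.symm ∘ c) y : E →L[ℝ] E) = ContinuousLinearMap.id ℝ E :=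
    h5.trans mfderiv_id
  exact (congrArg (fun L : E →L[ℝ] E => L v) (h3.symm.trans h6))

variable [FiniteDimensional ℝ E]
  {F : Type*} [NormedAddCommGroup F] [NormedSpace ℝ F]
  {T : Type*} [CommGroup T] [TopologicalSpace T] [ChartedSpace F T] [MulAction T M]
  [ContMDiffSMul 𝓘(ℝ, F) 𝓘(ℝ, E) ∞ T M]
  {σ : TwoForm E M} {n : ℕ} {p : (Fin n → ℝ) → T}

/-- The contractions of an invariant symplectic form with the infinitesimal generators are, locally,
the differentials of the components of a moment map. -/
theorem exists_local_moment_map (hσ : IsSymplecticForm σ) (hσT : IsInvariantForm T σ)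
    (hp : ContMDiff 𝓘(ℝ, Fin n → ℝ) 𝓘(ℝ, F) ∞ p) (h0 : p 0 = 1)
    (hadd : ∀ u v, p (u + v) = p u * p v) (x₀ : M) :
    ∃ (U : Set M) (μ : M → (Fin n → ℝ)), IsOpen U ∧ x₀ ∈ U ∧ U ⊆ (chartAt E x₀).source ∧
      ContMDiffOn 𝓘(ℝ, E) 𝓘(ℝ, Fin n → ℝ) ∞ μ U ∧
      ∀ y ∈ U, ∀ (v : TangentSpace 𝓘(ℝ, E) y) (i : Fin n),
        (mfderiv 𝓘(ℝ, E) 𝓘(ℝ, Fin n → ℝ) μ y v : Fin n → ℝ) i =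
          σ y ![infAct E p y (Pi.single i 1), v] := by
  set c := chartAt E x₀ with hc
  have hx : c x₀ ∈ c.target := c.map_source (mem_chart_source E x₀)
  obtain ⟨r, hr, hball⟩ := Metric.isOpen_iff.1 c.open_target _ hx
  set B := Metric.ball (c x₀) r
  -- The contractions of the pullback with the basis vectors of `ℝⁿ`, assembled into one `ℝⁿ`-valued
  -- one-form on the chart.
  let α : E → E →L[ℝ] (Fin n → ℝ) := fun u => ContinuousLinearMap.pi fun i =>
    ((pullForm σ p x₀ (0, u)).toContinuousMultilinearMap.toContinuousLinearMap
      ![(Pi.single i 1, 0), 0] 1).comp (ContinuousLinearMap.inr ℝ (Fin n → ℝ) E)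
  have hα : ∀ u v i, α u v i = pullForm σ p x₀ (0, u) ![(Pi.single i 1, 0), (0, v)] := by
    intro u v i
    change pullForm σ p x₀ (0, u) (Function.update ![(Pi.single i 1, 0), 0] 1 (0, v)) = _
    congr 1
    funext j
    fin_cases j <;> simp
  have hev : ∀ u ∈ c.target, ∀ m, ContDiffAt ℝ ∞ (fun u' => pullForm σ p x₀ (0, u') m) u := by
    intro u hu m
    exact (contDiffAt_pullForm_apply hσ hp h0 hu m).comp u
        (f := fun u' : E => ((0 : Fin n → ℝ), u'))
      (by fun_prop)
  have hαs : ContDiffOn ℝ ∞ α c.target := by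
    rw [contDiffOn_clm_apply]
    intro v u hu
    refine (contDiffAt_pi.2 fun i => ?_).contDiffWithinAt
    simp only [hα]
    exact hev u hu _
  have hαd : ∀ u ∈ c.target, DifferentiableAt ℝ α u := fun u hu =>
    (hαs.contDiffAt (c.open_target.mem_nhds hu)).differentiableAt (by simp)
  have hsymm : ∀ u ∈ B, ∀ v w, fderiv ℝ α u v w = fderiv ℝ α u w v := by
    have hcalc : ∀ u ∈ B, ∀ v w i, fderiv ℝ α u v w i =
        fderiv ℝ (fun u' => pullForm σ p x₀ (0, u') ![(Pi.single i 1, 0), (0, w)]) u v := by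
      intro u hu v w i
      let L : (E →L[ℝ] (Fin n → ℝ)) →L[ℝ] ℝ :=
        (ContinuousLinearMap.proj (R := ℝ) (φ := fun _ : Fin n => ℝ) i).comp
          (ContinuousLinearMap.apply ℝ (Fin n → ℝ) w)
      have h1 : HasFDerivAt (fun u' => α u' w i) (L.comp (fderiv ℝ α u)) u :=
        L.hasFDerivAt.comp u (hαd u (hball hu)).hasFDerivAt
      simp only [hα] at h1
      rw [h1.fderiv]
      rfl
    intro u hu v w
    funext i
    rw [hcalc u hu, hcalc u hu]
    exact fderiv_two_form_symm c.open_target (fun u hu => differentiableAt_pullForm hσ hp h0 hu)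
      (fun u hu a' => by simpa using pullForm_translate hp hadd hσT a' 0 hu)
      (fun u hu => extDeriv_pullForm hσ hp h0 hu) (hball hu) _ _ _
  -- The Poincaré lemma on a ball: a one-form with symmetric derivative is exact. The primitive `f`
  -- is smooth because its derivative `α` is.
  obtain ⟨f, hf⟩ := (convex_ball (c x₀) r).exists_forall_hasFDerivAt_of_fderiv_symmetric
    Metric.isOpen_ball (fun u hu => (hαd u (hball hu)).differentiableWithinAt) hsymm
  have hfs : ContDiffOn ℝ ∞ f B := by
    rw [contDiffOn_infty_iff_fderiv_of_isOpen Metric.isOpen_ball]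
    refine ⟨fun u hu => (hf u hu).differentiableAt.differentiableWithinAt, ?_⟩
    exact (hαs.mono hball).congr fun u hu => (hf u hu).fderiv
  refine ⟨c.source ∩ c ⁻¹' B, f ∘ c, c.isOpen_inter_preimage Metric.isOpen_ball,
    ⟨mem_chart_source E x₀, Metric.mem_ball_self hr⟩, inter_subset_left, ?_, ?_⟩
  · exact (contMDiffOn_iff_contDiffOn.2 hfs).comp
      ((contMDiffOn_chart (I := 𝓘(ℝ, E))).mono inter_subset_left) fun y hy => hy.2
  · intro y hy v i
    have h1 : MDifferentiableAt 𝓘(ℝ, E) 𝓘(ℝ, E) c y :=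
      mdifferentiableAt_atlas (chart_mem_atlas E x₀) hy.1
    have h2 := ((hf _ hy.2).hasMFDerivAt.comp y h1.hasMFDerivAt).mfderiv
    have h3 : mfderiv 𝓘(ℝ, E) 𝓘(ℝ, Fin n → ℝ) (f ∘ c) y v =
        α (c y) (mfderiv 𝓘(ℝ, E) 𝓘(ℝ, E) c y v) :=
      congrArg (fun L : E →L[ℝ] (Fin n → ℝ) => L v) h2
    have h4 := hα (c y) (mfderiv 𝓘(ℝ, E) 𝓘(ℝ, E) c y v) i
    rw [← h3] at h4
    refine h4.trans ((pullForm_apply_mixed hp h0 (hball hy.2) _ _).trans ?_)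
    rw [mfderiv_chartAt_symm_comp_mfderiv_chartAt hy.1]
    let g : M → ℝ := fun z => (show E [⋀^Fin 2]→L[ℝ] ℝ from σ z)
      ![(infAct E p z (Pi.single i 1) : E), v]
    change g (c.symm (c y)) = g y
    rw [c.left_inv hy.1]

end MomentMap

/-! ### Tangent spaces of the orbits and their symplectic complements -/

/-- The chain rule, as an equation between linear maps of the model spaces. -/
theorem mfderiv_comp_model {𝕜 : Type*} [NontriviallyNormedField 𝕜]
    {E₁ : Type*} [NormedAddCommGroup E₁] [NormedSpace 𝕜 E₁] {H₁ : Type*} [TopologicalSpace H₁]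
    {I₁ : ModelWithCorners 𝕜 E₁ H₁} {M₁ : Type*} [TopologicalSpace M₁] [ChartedSpace H₁ M₁]
    {E₂ : Type*} [NormedAddCommGroup E₂] [NormedSpace 𝕜 E₂] {H₂ : Type*} [TopologicalSpace H₂]
    {I₂ : ModelWithCorners 𝕜 E₂ H₂} {M₂ : Type*} [TopologicalSpace M₂] [ChartedSpace H₂ M₂]
    {E₃ : Type*} [NormedAddCommGroup E₃] [NormedSpace 𝕜 E₃] {H₃ : Type*} [TopologicalSpace H₃]
    {I₃ : ModelWithCorners 𝕜 E₃ H₃} {M₃ : Type*} [TopologicalSpace M₃] [ChartedSpace H₃ M₃]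
    {g : M₂ → M₃} {f : M₁ → M₂} {x : M₁} {y : M₂} (hg : MDifferentiableAt I₂ I₃ g y)
    (hf : MDifferentiableAt I₁ I₂ f x) (hy : f x = y) :
    (mfderiv I₁ I₃ (g ∘ f) x : E₁ →L[𝕜] E₃) =
      (mfderiv I₂ I₃ g y : E₂ →L[𝕜] E₃).comp (mfderiv I₁ I₂ f x : E₁ →L[𝕜] E₂) := by
  subst hy
  exact mfderiv_comp x hg hf

section OrbitTangent

/-- Local freeness: a generator that vanishes at `x` pairs to zero with all others, so nondegeneracy
kills it. -/
theorem infAct_injective {E : Type*} [NormedAddCommGroup E] [NormedSpace ℝ E] {M : Type*}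
    [TopologicalSpace M] [ChartedSpace E M] {T V : Type*} [CommGroup T] [MulAction T M]
    [NormedAddCommGroup V] [NormedSpace ℝ V] {σ : TwoForm E M} {p : V → T}
    (hnd : ∀ x a, (∀ b, σ x ![infAct E p x a, infAct E p x b] = 0) → a = 0)
    (x : M) : Function.Injective (infAct E p x) := by
  rw [injective_iff_map_eq_zero]
  intro a ha
  refine hnd x a fun b => ?_
  rw [ha]
  exact (σ x).map_coord_zero (m := ![0, _]) 0 rfl

variable {E : Type*} [NormedAddCommGroup E] [NormedSpace ℝ E]
  {F : Type*} [NormedAddCommGroup F] [NormedSpace ℝ F]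
  {M : Type*} [TopologicalSpace M] [ChartedSpace E M]
  {T : Type*} [CommGroup T] [TopologicalSpace T] [ChartedSpace F T] [MulAction T M]
  [ContMDiffSMul 𝓘(ℝ, F) 𝓘(ℝ, E) ∞ T M]

theorem contMDiff_orbitMap (x : M) :
    ContMDiff 𝓘(ℝ, F) 𝓘(ℝ, E) ∞ (fun t : T => t • x) :=
  ContMDiff.smul (I := 𝓘(ℝ, F)) (f := fun t : T => t) (g := fun _ => x) contMDiff_id contMDiff_const

theorem contMDiff_smulMap (E F : Type*) [NormedAddCommGroup E] [NormedSpace ℝ E]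
    [NormedAddCommGroup F] [NormedSpace ℝ F] {M : Type*} [TopologicalSpace M] [ChartedSpace E M]
    {T : Type*} [CommGroup T] [TopologicalSpace T] [ChartedSpace F T] [MulAction T M]
    [ContMDiffSMul 𝓘(ℝ, F) 𝓘(ℝ, E) ∞ T M] (t : T) :
    ContMDiff 𝓘(ℝ, E) 𝓘(ℝ, E) ∞ (fun y : M => t • y) :=
  ContMDiffSMul.contMDiff_const_smul (I := 𝓘(ℝ, F)) t

theorem mdifferentiable_smulMap (E F : Type*) [NormedAddCommGroup E] [NormedSpace ℝ E]
    [NormedAddCommGroup F] [NormedSpace ℝ F] {M : Type*} [TopologicalSpace M] [ChartedSpace E M]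
    {T : Type*} [CommGroup T] [TopologicalSpace T] [ChartedSpace F T] [MulAction T M]
    [ContMDiffSMul 𝓘(ℝ, F) 𝓘(ℝ, E) ∞ T M] (t : T) :
    MDifferentiable 𝓘(ℝ, E) 𝓘(ℝ, E) (fun y : M => t • y) :=
  (contMDiff_smulMap E F t).mdifferentiable (by simp)

theorem mfderiv_smul_mfderiv_smul_inv {E : Type*} (F : Type*) [NormedAddCommGroup E]
    [NormedSpace ℝ E] [NormedAddCommGroup F] [NormedSpace ℝ F] {M : Type*} [TopologicalSpace M]
    [ChartedSpace E M] {T : Type*} [CommGroup T] [TopologicalSpace T] [ChartedSpace F T]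
    [MulAction T M] [ContMDiffSMul 𝓘(ℝ, F) 𝓘(ℝ, E) ∞ T M] (t : T) (x : M)
    (v : TangentSpace 𝓘(ℝ, E) (t • x)) :
    mfderiv 𝓘(ℝ, E) 𝓘(ℝ, E) (fun y : M => t • y) x
      (mfderiv 𝓘(ℝ, E) 𝓘(ℝ, E) (fun y : M => t⁻¹ • y) (t • x) v) = v := by
  have h := mfderiv_comp_model (I₁ := 𝓘(ℝ, E)) (I₂ := 𝓘(ℝ, E))
    (I₃ := 𝓘(ℝ, E)) (x := t • x) (f := fun y : M => t⁻¹ • y) (g := fun y : M => t • y) (y := x)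
    (mdifferentiable_smulMap E F t x) (mdifferentiable_smulMap E F t⁻¹ (t • x)) (by simp)
  have h2 : ((fun y : M => t • y) ∘ fun y => t⁻¹ • y) = id := by
    funext b
    simp
  rw [h2] at h
  exact (congrArg (fun L : E →L[ℝ] E => L v) (mfderiv_id.symm.trans h)).symm

variable {p : (Fin (Module.finrank ℝ F) → ℝ) → T} (hp : IsTorusParam p)
include hp

theorem IsTorusParam.infAct_apply (x : M) (a : Fin (Module.finrank ℝ F) → ℝ) :
    infAct E p x a = mfderiv 𝓘(ℝ, F) 𝓘(ℝ, E) (fun t : T => t • x) 1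
      (mfderiv 𝓘(ℝ, Fin (Module.finrank ℝ F) → ℝ) 𝓘(ℝ, F) p 0 a) := by
  have h := mfderiv_comp_model (I₁ := 𝓘(ℝ, Fin (Module.finrank ℝ F) → ℝ)) (I₂ := 𝓘(ℝ, F))
    (I₃ := 𝓘(ℝ, E)) (x := 0) (f := p) (g := fun t : T => t • x) (y := 1)
    ((contMDiff_orbitMap (E := E) (F := F) x).mdifferentiable (by simp) 1)
    (hp.contMDiff.mdifferentiable (by simp) 0) hp.map_zero
  exact congrArg (fun L : (Fin (Module.finrank ℝ F) → ℝ) →L[ℝ] E => L a) h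

/-- The differential of `p` at `0` is onto, so the generators indexed by `ℝᵏ` fill the tangent space
of the orbit. -/
theorem IsTorusParam.mem_orbitTangent_iff {x : M} {v : TangentSpace 𝓘(ℝ, E) x} :
    v ∈ orbitTangent E F T x ↔ ∃ a, infAct E p x a = v := by
  constructor
  · rintro ⟨w, rfl⟩
    have hs := hp.surjective_mfderiv 0
    rw [hp.map_zero] at hs
    obtain ⟨a, ha⟩ := hs w
    exact ⟨a, (hp.infAct_apply x a).trans (congrArg _ ha)⟩
  · rintro ⟨a, rfl⟩
    exact ⟨_, (hp.infAct_apply x a).symm⟩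

theorem IsTorusParam.orbitTangent_eq (x : M) :
    orbitTangent E F T x = LinearMap.range (infAct E p x).toLinearMap := by
  ext v
  exact hp.mem_orbitTangent_iff

theorem IsTorusParam.mem_orbitOrthogonal_iff {σ : TwoForm E M} {x : M}
    {v : TangentSpace 𝓘(ℝ, E) x} :
    v ∈ orbitOrthogonal F T σ x ↔ ∀ a, σ x ![v, infAct E p x a] = 0 := by
  constructor
  · exact fun h a => h _ (hp.mem_orbitTangent_iff.2 ⟨a, rfl⟩)
  · intro h w hw
    obtain ⟨a, rfl⟩ := hp.mem_orbitTangent_iff.1 hw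
    exact h a

/-- Since `T` is commutative, the action of `t` commutes with that of `p b`, so the generators are
`T`-invariant vector fields. -/
theorem IsTorusParam.mfderiv_smul_infAct (t : T) (x : M) (a : Fin (Module.finrank ℝ F) → ℝ) :
    mfderiv 𝓘(ℝ, E) 𝓘(ℝ, E) (fun y : M => t • y) x (infAct E p x a) = infAct E p (t • x) a := by
  have h := mfderiv_comp_model (I₁ := 𝓘(ℝ, Fin (Module.finrank ℝ F) → ℝ)) (I₂ := 𝓘(ℝ, E))
    (I₃ := 𝓘(ℝ, E)) (x := 0) (f := fun b => p b • x) (g := fun y : M => t • y) (y := x)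
    (mdifferentiable_smulMap E F t x)
    (((contMDiff_orbitMap (E := E) (F := F) x).comp hp.contMDiff).mdifferentiable (by simp) 0)
    (by simp [hp.map_zero])
  have h2 : ((fun y : M => t • y) ∘ fun b => p b • x) = fun b => p b • t • x := by
    funext b
    simp [smul_smul, mul_comm]
  rw [h2] at h
  exact (congrArg (fun L : (Fin (Module.finrank ℝ F) → ℝ) →L[ℝ] E => L a) h).symm

theorem IsTorusParam.mem_orbitOrthogonal_smul {σ : TwoForm E M} (hσT : IsInvariantForm T σ) (t : T)
    (x : M) {v : TangentSpace 𝓘(ℝ, E) x} (hv : v ∈ orbitOrthogonal F T σ x) :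
    (mfderiv 𝓘(ℝ, E) 𝓘(ℝ, E) (fun y : M => t • y) x v : TangentSpace 𝓘(ℝ, E) (t • x)) ∈
      orbitOrthogonal F T σ (t • x) := by
  rw [hp.mem_orbitOrthogonal_iff] at hv ⊢
  intro a
  rw [← hp.mfderiv_smul_infAct]
  have h := congrArg (fun η : E [⋀^Fin 2]→L[ℝ] ℝ => η ![v, (infAct E p x a : E)]) (hσT t x)
  refine Eq.trans ?_ (h.trans (hv a))
  change σ (t • x) _ = σ (t • x) _
  congr 1
  funext i
  fin_cases i <;> rfl

theorem IsTorusParam.isInvariantDistribution {σ : TwoForm E M} (hσT : IsInvariantForm T σ) :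
    IsInvariantDistribution T (orbitOrthogonal F T σ) := by
  intro t x
  apply le_antisymm
  · rintro _ ⟨v, hv, rfl⟩
    exact hp.mem_orbitOrthogonal_smul hσT t x hv
  · intro v hv
    refine ⟨mfderiv 𝓘(ℝ, E) 𝓘(ℝ, E) (fun y : M => t⁻¹ • y) (t • x) v, ?_,
      mfderiv_smul_mfderiv_smul_inv F t x v⟩
    have h := hp.mem_orbitOrthogonal_smul hσT t⁻¹ (t • x) hv
    -- With the vector taken in `E`, the base point `t⁻¹ • t • x` can be replaced by `x`.
    let P : (x : M) → E → Prop := fun y w => (show TangentSpace 𝓘(ℝ, E) y from w) ∈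
      orbitOrthogonal F T σ y
    have h' : P (t⁻¹ • t • x) (mfderiv 𝓘(ℝ, E) 𝓘(ℝ, E) (fun y : M => t⁻¹ • y) (t • x) v) := h
    rw [inv_smul_smul] at h'
    exact h'

variable {σ : TwoForm E M}

theorem IsTorusParam.isCompl (hnd : ∀ x a, (∀ b, σ x ![infAct E p x a, infAct E p x b] = 0) → a = 0)
    (x : M) : IsCompl (orbitOrthogonal F T σ x) (orbitTangent E F T x) := by
  rw [hp.orbitTangent_eq]
  exact isCompl_orthogonal_range
    (ContinuousAlternatingMap.toBilin (show E [⋀^Fin 2]→L[ℝ] ℝ from σ x))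
    (infAct E p x).toLinearMap (hnd x) (orbitOrthogonal F T σ x)
    fun v => hp.mem_orbitOrthogonal_iff (σ := σ) (x := x) (v := v)

theorem IsTorusParam.finrank_orbitTangent
    (hnd : ∀ x a, (∀ b, σ x ![infAct E p x a, infAct E p x b] = 0) → a = 0) (x : M) :
    Module.finrank ℝ (orbitTangent E F T x) = Module.finrank ℝ F := by
  rw [hp.orbitTangent_eq]
  have key : ∀ A : (Fin (Module.finrank ℝ F) → ℝ) →ₗ[ℝ] E, Function.Injective A →
      Module.finrank ℝ (LinearMap.range A) = Module.finrank ℝ F :=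
    fun A h => (LinearMap.finrank_range_of_inj h).trans (Module.finrank_fin_fun ℝ)
  exact key _ (infAct_injective hnd x)

theorem IsTorusParam.finrank_add [FiniteDimensional ℝ E]
    (hnd : ∀ x a, (∀ b, σ x ![infAct E p x a, infAct E p x b] = 0) → a = 0) (x : M) :
    Module.finrank ℝ (orbitOrthogonal F T σ x) + Module.finrank ℝ F = Module.finrank ℝ E := by
  rw [← hp.finrank_orbitTangent hnd x]
  have key : ∀ A B : Submodule ℝ E, IsCompl A B →
      Module.finrank ℝ A + Module.finrank ℝ B = Module.finrank ℝ E :=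
    fun A B h => Submodule.finrank_add_eq_of_isCompl h
  exact key _ _ (hp.isCompl hnd x)

/-- By `finrank_add`, the truncated subtraction in `sliceDim` is a genuine one. -/
theorem IsTorusParam.finrank_orbitOrthogonal [FiniteDimensional ℝ E]
    (hnd : ∀ x a, (∀ b, σ x ![infAct E p x a, infAct E p x b] = 0) → a = 0) (x : M) :
    Module.finrank ℝ (orbitOrthogonal F T σ x) = sliceDim E F := by
  have := hp.finrank_add hnd x
  unfold sliceDim
  omega

end OrbitTangent

/-! ### Derivatives of partial diffeomorphisms and of charts -/

section LocalDiffeomorph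

variable {E₁ : Type*} [NormedAddCommGroup E₁] [NormedSpace ℝ E₁] {H₁ : Type*} [TopologicalSpace H₁]
  {I : ModelWithCorners ℝ E₁ H₁} {N : Type*} [TopologicalSpace N] [ChartedSpace H₁ N]
  {E₂ : Type*} [NormedAddCommGroup E₂] [NormedSpace ℝ E₂] {H₂ : Type*} [TopologicalSpace H₂]
  {J : ModelWithCorners ℝ E₂ H₂} {P : Type*} [TopologicalSpace P] [ChartedSpace H₂ P]

theorem PartialDiffeomorph.mfderiv_symm_mfderiv (Ψ : PartialDiffeomorph I J N P ∞) {y : N}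
    (hy : y ∈ Ψ.source) (v : E₁) :
    (mfderiv J I Ψ.symm (Ψ y) (mfderiv I J Ψ y v) : E₁) = v := by
  have hΨy : Ψ y ∈ Ψ.symm.source := Ψ.map_source hy
  have h := mfderiv_comp_model (x := y) (y := Ψ y) (Ψ.symm.mdifferentiableAt (by simp) hΨy)
    (Ψ.mdifferentiableAt (by simp) hy) rfl
  have h4 : (Ψ.symm : P → N) ∘ Ψ =ᶠ[𝓝 y] id := by
    filter_upwards [Ψ.open_source.mem_nhds hy] with z hz using Ψ.left_inv hz
  have h6 : (mfderiv I I ((Ψ.symm : P → N) ∘ Ψ) y : E₁ →L[ℝ] E₁) = ContinuousLinearMap.id ℝ E₁ :=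
    h4.mfderiv_eq.trans mfderiv_id
  exact congrArg (fun L : E₁ →L[ℝ] E₁ => L v) (h.symm.trans h6)

theorem PartialDiffeomorph.bijective_mfderiv (Ψ : PartialDiffeomorph I J N P ∞) {y : N}
    (hy : y ∈ Ψ.source) : Function.Bijective (mfderiv I J Ψ y) :=
  ((Ψ.isLocalDiffeomorphAt (I := I) (J := J) (n := ∞) hy).mfderivToContinuousLinearEquiv
    (by simp)).bijective

theorem PartialDiffeomorph.mfderiv_mfderiv_symm (Ψ : PartialDiffeomorph I J N P ∞) {y : N}
    (hy : y ∈ Ψ.source) (w : E₂) :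
    (mfderiv I J Ψ y (mfderiv J I Ψ.symm (Ψ y) w) : E₂) = w := by
  obtain ⟨v, hv⟩ := (Ψ.bijective_mfderiv hy).2 w
  have := Ψ.mfderiv_symm_mfderiv hy v
  rw [← hv]
  exact congrArg (mfderiv I J Ψ y : E₁ →L[ℝ] E₂) this

end LocalDiffeomorph

theorem bijective_mfderiv_of_mem_maximalAtlas {E : Type*} [NormedAddCommGroup E] [NormedSpace ℝ E]
    {M : Type*} [TopologicalSpace M] [ChartedSpace E M] [IsManifold 𝓘(ℝ, E) ∞ M]
    {e : OpenPartialHomeomorph M E} (he : e ∈ IsManifold.maximalAtlas 𝓘(ℝ, E) ∞ M) {x : M}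
    (hx : x ∈ e.source) : Function.Bijective (mfderiv 𝓘(ℝ, E) 𝓘(ℝ, E) e x) :=
  ((IsLocalDiffeomorphAt.of_inverse e.open_source e.open_target hx (e.map_source hx)
    (contMDiffOn_of_mem_maximalAtlas he) (contMDiffOn_symm_of_mem_maximalAtlas he)
    (fun _ h => e.left_inv h) (fun _ h => e.right_inv h)).mfderivToContinuousLinearEquiv
    (by simp)).bijective

/-! ### Spreading of nondegeneracy, and flat coordinates for `Ω` -/

section FlatChart

variable {E : Type*} [NormedAddCommGroup E] [NormedSpace ℝ E]
  {F : Type*} [NormedAddCommGroup F] [NormedSpace ℝ F]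
  {M : Type*} [TopologicalSpace M] [ChartedSpace E M] [IsManifold 𝓘(ℝ, E) ∞ M]
  {T : Type*} [CommGroup T] [TopologicalSpace T] [ChartedSpace F T] [MulAction T M]
  [ContMDiffSMul 𝓘(ℝ, F) 𝓘(ℝ, E) ∞ T M]
  {p : (Fin (Module.finrank ℝ F) → ℝ) → T} {σ : TwoForm E M}

/-- Nondegeneracy on the tangent space of the orbit only gives `X_a = 0` at `x`. That `a = 0`
follows from the dimension of the orbit: the map of `ℝᵏ` onto a space of dimension `dim T` is
injective. -/
theorem IsTorusParam.nondegenerate_of_isSymplecticOrbit (hp : IsTorusParam p) {x : M}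
    (hx : IsSymplecticOrbit F T σ x) (a : Fin (Module.finrank ℝ F) → ℝ)
    (ha : ∀ b, σ x ![infAct E p x a, infAct E p x b] = 0) : a = 0 := by
  obtain ⟨hemb, hnd⟩ := hx
  have hxo : x ∈ MulAction.orbit T x := MulAction.mem_orbit_self x
  obtain ⟨e, he, hxe, W, hW, -, hτ⟩ := hemb x hxo
  let A : (Fin (Module.finrank ℝ F) → ℝ) →ₗ[ℝ] E := (infAct E p x).toLinearMap
  let L : E →ₗ[ℝ] E := (mfderiv 𝓘(ℝ, E) 𝓘(ℝ, E) e x).toLinearMap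
  have hL : Function.Bijective L := bijective_mfderiv_of_mem_maximalAtlas he hxe
  have hrange : LinearMap.range A = W.comap L := by
    ext v
    exact (hp.mem_orbitTangent_iff (x := x) (v := v)).symm.trans (hτ v)
  have hfin : Module.finrank ℝ (W.comap L) = Module.finrank ℝ W := by
    have h : Module.finrank ℝ ((W.comap L).map L) = Module.finrank ℝ (W.comap L) :=
      (LinearEquiv.ofBijective L hL).finrank_map_eq (W.comap L)
    rw [← h, Submodule.map_comap_eq_of_surjective hL.2]
  have hinj : Function.Injective A := by
    rw [← LinearMap.ker_eq_bot, ← Submodule.finrank_eq_zero (R := ℝ)]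
    have := A.finrank_range_add_finrank_ker
    rw [hrange, hfin, hW, Module.finrank_fin_fun] at this
    omega
  apply (injective_iff_map_eq_zero A).1 hinj
  refine hnd x hxo _ (hp.mem_orbitTangent_iff.2 ⟨a, rfl⟩) fun w hw => ?_
  obtain ⟨b, rfl⟩ := hp.mem_orbitTangent_iff.1 hw
  exact ha b

/-- The symplectic products of generators are locally constant, hence constant on the connected `M`,
so they may be evaluated on the given symplectic orbit. -/
theorem IsTorusParam.nondegenerate [ConnectedSpace M] (hp : IsTorusParam p)
    (hσ : IsSymplecticForm σ) (hσT : IsInvariantForm T σ)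
    (horb : ∃ x : M, IsSymplecticOrbit F T σ x)
    (x : M) (a : Fin (Module.finrank ℝ F) → ℝ)
    (ha : ∀ b, σ x ![infAct E p x a, infAct E p x b] = 0) : a = 0 := by
  obtain ⟨x₀, hx₀⟩ := horb
  refine hp.nondegenerate_of_isSymplecticOrbit hx₀ a fun b => ?_
  rw [← ha b]
  exact (isLocallyConstant_symplectic_infAct hσ hσT hp.contMDiff hp.map_zero hp.map_add a b
    ).apply_eq_of_preconnectedSpace x₀ x

variable [FiniteDimensional ℝ E] (hp : IsTorusParam p) (hσ : IsSymplecticForm σ)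
  (hσT : IsInvariantForm T σ)
  (hnd : ∀ x a, (∀ b, σ x ![infAct E p x a, infAct E p x b] = 0) → a = 0)
include hp hσ hσT hnd

/-- Locally, the symplectic complements of the orbits are the tangent spaces of the leaves
`ℝᵏ × {c}` of a smooth system of coordinates. -/
theorem IsTorusParam.exists_flat_chart (x₀ : M) :
    ∃ Ψ : PartialDiffeomorph 𝓘(ℝ, E)
        𝓘(ℝ, EuclideanSpace ℝ (Fin (sliceDim E F)) × (Fin (Module.finrank ℝ F) → ℝ)) M
        (EuclideanSpace ℝ (Fin (sliceDim E F)) × (Fin (Module.finrank ℝ F) → ℝ)) ∞,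
      x₀ ∈ Ψ.source ∧ ∀ y ∈ Ψ.source, ∀ v : TangentSpace 𝓘(ℝ, E) y,
        v ∈ orbitOrthogonal F T σ y ↔
          ((mfderiv 𝓘(ℝ, E) 𝓘(ℝ, EuclideanSpace ℝ (Fin (sliceDim E F)) ×
            (Fin (Module.finrank ℝ F) → ℝ)) Ψ y v : EuclideanSpace ℝ (Fin (sliceDim E F)) ×
            (Fin (Module.finrank ℝ F) → ℝ))).2 = 0 := by
  obtain ⟨U, μ, hU, hx₀, hUc, hμ, hdμ⟩ :=
    exists_local_moment_map hσ hσT hp.contMDiff hp.map_zero hp.map_add x₀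
  set c := chartAt E x₀ with hc
  let K := EuclideanSpace ℝ (Fin (sliceDim E F))
  let V := Fin (Module.finrank ℝ F) → ℝ
  let Ω : Submodule ℝ E := orbitOrthogonal F T σ x₀
  have hΩ : Module.finrank ℝ Ω = sliceDim E F := hp.finrank_orbitOrthogonal hnd x₀
  -- The moment map gives `dim T` coordinates. The other coordinates come from a linear extension
  -- `P` of an isomorphism of `Ω` at `x₀` with `K`; being injective on this kernel of `dμ`, it makes
  -- the joint differential injective at `x₀`.
  let j : Ω ≃ₗ[ℝ] K := LinearEquiv.ofFinrankEq _ _ (by rw [hΩ, finrank_euclideanSpace_fin])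
  obtain ⟨g, hg⟩ := (j : Ω →ₗ[ℝ] K).exists_extend
  let P : E →L[ℝ] K := g.toContinuousLinearMap
  have hP : ∀ v ∈ Ω, P v = 0 → v = 0 := by
    intro v hv h
    have h2 : j ⟨v, hv⟩ = 0 := (LinearMap.congr_fun hg ⟨v, hv⟩).symm.trans h
    exact congrArg Subtype.val (j.map_eq_zero_iff.1 h2)
  let e : M → K × V := fun y => (P (c y), μ y)
  have hPc : ContMDiffOn 𝓘(ℝ, E) 𝓘(ℝ, K) ∞ (P ∘ c) U :=
    P.contDiff.contMDiff.comp_contMDiffOn ((contMDiffOn_chart (I := 𝓘(ℝ, E))).mono hUc)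
  have he : ContMDiffOn 𝓘(ℝ, E) 𝓘(ℝ, K × V) ∞ e U := hPc.prodMk_space hμ
  have hed : ∀ y ∈ U, MDifferentiableAt 𝓘(ℝ, E) 𝓘(ℝ, K × V) e y := fun y hy =>
    (he.contMDiffAt (hU.mem_nhds hy)).mdifferentiableAt (by simp)
  have h2 : ∀ y ∈ U, ∀ v : E, (mfderiv 𝓘(ℝ, E) 𝓘(ℝ, K × V) e y v : K × V).2 =
      mfderiv 𝓘(ℝ, E) 𝓘(ℝ, V) μ y v := by
    intro y hy v
    have h := mfderiv_comp_model (x := y) (y := e y) (I₃ := 𝓘(ℝ, V))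
      ((ContinuousLinearMap.snd ℝ K V).hasFDerivAt.hasMFDerivAt.mdifferentiableAt) (hed y hy) rfl
    rw [(ContinuousLinearMap.snd ℝ K V).hasFDerivAt.hasMFDerivAt.mfderiv] at h
    exact (congrArg (fun L : E →L[ℝ] V => L v) h).symm
  have h1 : ∀ y ∈ U, ∀ v : E, (mfderiv 𝓘(ℝ, E) 𝓘(ℝ, K × V) e y v : K × V).1 =
      P (mfderiv 𝓘(ℝ, E) 𝓘(ℝ, E) c y v) := by
    intro y hy v
    have h := mfderiv_comp_model (x := y) (y := e y) (I₃ := 𝓘(ℝ, K))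
      ((ContinuousLinearMap.fst ℝ K V).hasFDerivAt.hasMFDerivAt.mdifferentiableAt) (hed y hy) rfl
    rw [(ContinuousLinearMap.fst ℝ K V).hasFDerivAt.hasMFDerivAt.mfderiv] at h
    have h' := mfderiv_comp_model (x := y) (y := c y) (I₃ := 𝓘(ℝ, K))
      (P.hasFDerivAt.hasMFDerivAt.mdifferentiableAt)
      (mdifferentiableAt_atlas (I := 𝓘(ℝ, E)) (chart_mem_atlas E x₀) (hUc hy)) rfl
    rw [P.hasFDerivAt.hasMFDerivAt.mfderiv] at h'
    exact (congrArg (fun L : E →L[ℝ] K => L v) h).symm.trans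
      (congrArg (fun L : E →L[ℝ] K => L v) h')
  -- `Ω` is the kernel of `dμ`: up to sign, the components of `dμ` are the products with the basis
  -- generators.
  have hker : ∀ y ∈ U, ∀ v : TangentSpace 𝓘(ℝ, E) y, v ∈ orbitOrthogonal F T σ y ↔
      (mfderiv 𝓘(ℝ, E) 𝓘(ℝ, K × V) e y v : K × V).2 = 0 := by
    intro y hy v
    rw [h2 y hy v, hp.mem_orbitOrthogonal_iff]
    have hneg : ∀ a, σ y ![v, infAct E p y a] = - σ y ![infAct E p y a, v] := fun a =>
      ContinuousAlternatingMap.toBilin_swap (show E [⋀^Fin 2]→L[ℝ] ℝ from σ y) v (infAct E p y a)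
    simp only [hneg, neg_eq_zero]
    constructor
    · intro h
      funext i
      exact (hdμ y hy v i).trans (h _)
    · intro h a
      let B : V →ₗ[ℝ] ℝ := ((ContinuousAlternatingMap.toBilin
        (show E [⋀^Fin 2]→L[ℝ] ℝ from σ y)).flip v).comp (infAct E p y).toLinearMap
      have hB : B = 0 := by
        refine LinearMap.pi_ext' fun i => LinearMap.ext_ring ?_
        have := hdμ y hy v i
        rw [h] at this
        exact this.symm
      exact LinearMap.congr_fun hB a
  have hinj : Function.Injective (mfderiv 𝓘(ℝ, E) 𝓘(ℝ, K × V) e x₀) := by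
    rw [injective_iff_map_eq_zero]
    intro v hv
    have hv' : (mfderiv 𝓘(ℝ, E) 𝓘(ℝ, K × V) e x₀ v : K × V) = 0 := hv
    have hvΩ : v ∈ orbitOrthogonal F T σ x₀ := (hker x₀ hx₀ v).2 (by rw [hv']; rfl)
    refine hP v hvΩ ?_
    have h3 := h1 x₀ hx₀ v
    rw [hv'] at h3
    have hid : (mfderiv 𝓘(ℝ, E) 𝓘(ℝ, E) c x₀ v : E) = v := by
      rw [mfderiv_chartAt_eq_tangentCoordChange (mem_chart_source E x₀)]
      exact tangentCoordChange_self (I := 𝓘(ℝ, E)) (mem_extChartAt_source x₀)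
    rw [hid] at h3
    exact h3.symm
  have hfr : Module.finrank ℝ E = Module.finrank ℝ (K × V) := by
    have := hp.finrank_add hnd x₀
    rw [Module.finrank_prod, finrank_euclideanSpace_fin, Module.finrank_fin_fun]
    rw [hp.finrank_orbitOrthogonal hnd x₀] at this
    exact this.symm
  let L : E →ₗ[ℝ] K × V := (mfderiv 𝓘(ℝ, E) 𝓘(ℝ, K × V) e x₀).toLinearMap
  have hbij : Function.Bijective (mfderiv 𝓘(ℝ, E) 𝓘(ℝ, K × V) e x₀) :=
    ⟨hinj, (LinearMap.injective_iff_surjective_of_finrank_eq_finrank (f := L) hfr).1 hinj⟩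
  obtain ⟨Ψ, hxΨ, hΨ⟩ := isLocalDiffeomorphAt_of_bijective_mfderiv hU hx₀ he hbij
  -- The chart is rebuilt with `e` itself as forward map and a source inside `U`, so that `hker`
  -- applies verbatim to its derivative.
  refine ⟨PartialDiffeomorph.ofInverse (f := e) (g := Ψ.symm) (A := U ∩ Ψ.source) (B := Ψ.target)
    (hU.inter Ψ.open_source) Ψ.open_target (he.mono inter_subset_left) Ψ.symm.contMDiffOn ?_ ?_,
    ⟨⟨hx₀, hxΨ⟩, ?_⟩, ?_⟩
  · intro a ha
    rw [hΨ ha.2]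
    exact Ψ.left_inv ha.2
  · intro b hb
    exact (hΨ (Ψ.map_target hb)).trans (Ψ.right_inv hb)
  · rw [mem_preimage, hΨ hxΨ]
    exact Ψ.map_source hxΨ
  · intro y hy v
    exact hker y hy.1.1 v

/-- The coordinate vector fields of the first factor of a flat chart, pulled back to `M`, are
independent sections of `Ω`, as many as its rank. -/
theorem IsTorusParam.isSmoothDistribution :
    IsSmoothDistribution (orbitOrthogonal F T σ) (sliceDim E F) := by
  intro x
  obtain ⟨Ψ, hx, hΨ⟩ := hp.exists_flat_chart hσ hσT hnd x
  let K := EuclideanSpace ℝ (Fin (sliceDim E F))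
  let V := Fin (Module.finrank ℝ F) → ℝ
  let w : Fin (sliceDim E F) → K × V := fun i => (EuclideanSpace.single i 1, 0)
  let X : Fin (sliceDim E F) → ∀ y : M, TangentSpace 𝓘(ℝ, E) y := fun i =>
    VectorField.mpullback 𝓘(ℝ, E) 𝓘(ℝ, K × V) Ψ (fun _ => w i)
  have hinv : ∀ y ∈ Ψ.source, (mfderiv 𝓘(ℝ, E) 𝓘(ℝ, K × V) Ψ y).IsInvertible := fun y hy =>
    ⟨(Ψ.isLocalDiffeomorphAt (I := 𝓘(ℝ, E)) (J := 𝓘(ℝ, K × V)) (n := ∞)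
      hy).mfderivToContinuousLinearEquiv (by simp), rfl⟩
  have hX : ∀ y ∈ Ψ.source, ∀ i, (mfderiv 𝓘(ℝ, E) 𝓘(ℝ, K × V) Ψ y (X i y) : K × V) = w i :=
    fun y hy i => (hinv y hy).self_apply_inverse (w i)
  have hwli : LinearIndependent ℝ w := by
    have h := (EuclideanSpace.basisFun (Fin (sliceDim E F)) ℝ).toBasis.linearIndependent.map'
      (LinearMap.inl ℝ K V) (LinearMap.ker_eq_bot.2 LinearMap.inl_injective)
    have hw : w = LinearMap.inl ℝ K V ∘
      (EuclideanSpace.basisFun (Fin (sliceDim E F)) ℝ).toBasis := by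
      funext i
      simp only [Function.comp_apply, OrthonormalBasis.coe_toBasis, EuclideanSpace.basisFun_apply]
      rfl
    rw [hw]
    exact h
  refine ⟨Ψ.source, Ψ.open_source, hx, X, fun i y hy => ?_, fun y hy => ?_⟩
  · refine (ContMDiffAt.mpullback_vectorField_preimage (n := ∞) ?_
      (Ψ.contMDiffOn.contMDiffAt (Ψ.open_source.mem_nhds hy)) (hinv y hy)
      (by simp)).contMDiffWithinAt
    exact contMDiffAt_vectorSpace_iff_contDiffAt.2 contDiffAt_const
  · let L : E →ₗ[ℝ] K × V := (mfderiv 𝓘(ℝ, E) 𝓘(ℝ, K × V) Ψ y).toLinearMap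
    have hLX : ∀ i, L (X i y) = w i := hX y hy
    have hli : LinearIndependent ℝ (fun i => (X i y : E)) := by
      refine LinearIndependent.of_comp L ?_
      convert hwli using 1
      funext i
      exact hLX i
    refine ⟨hli, ?_⟩
    have key : ∀ (A : Submodule ℝ E) (Y : Fin (sliceDim E F) → E), LinearIndependent ℝ Y →
        Module.finrank ℝ A = sliceDim E F → (∀ i, Y i ∈ A) →
        Submodule.span ℝ (range fun i => Y i) = A := by
      intro A Y hY hA hYA
      refine Submodule.eq_of_le_of_finrank_eq (Submodule.span_le.2 ?_) ?_
      · rintro _ ⟨i, rfl⟩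
        exact hYA i
      · rw [finrank_span_eq_card hY, hA, Fintype.card_fin]
    refine key _ _ hli (hp.finrank_orbitOrthogonal hnd y) fun i => ?_
    refine (hΨ y hy (X i y)).2 ?_
    exact congrArg Prod.snd (hX y hy i)

/-- The integral manifold is the leaf of a flat chart through `x`, on which the second coordinate is
constant. -/
theorem IsTorusParam.isIntegrable : IsIntegrable (orbitOrthogonal F T σ) (sliceDim E F) := by
  intro x
  obtain ⟨Ψ, hx, hΨ⟩ := hp.exists_flat_chart hσ hσT hnd x
  let K := EuclideanSpace ℝ (Fin (sliceDim E F))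
  let V := Fin (Module.finrank ℝ F) → ℝ
  let ι : K → K × V := fun z => Ψ x + (z, 0)
  have hιs : ContDiff ℝ ∞ ι := by fun_prop
  have hιd : ∀ z, HasFDerivAt ι (ContinuousLinearMap.inl ℝ K V) z := fun z =>
    (ContinuousLinearMap.inl ℝ K V).hasFDerivAt.const_add (Ψ x)
  have hW : IsOpen (ι ⁻¹' Ψ.target) := Ψ.open_target.preimage hιs.continuous
  have hmap : ∀ z ∈ ι ⁻¹' Ψ.target, Ψ.symm (ι z) ∈ Ψ.source ∧ Ψ (Ψ.symm (ι z)) = ι z :=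
    fun z hz => ⟨Ψ.map_target hz, Ψ.right_inv hz⟩
  have hι0 : ι 0 = Ψ x := by simp [ι]
  have hder : ∀ z ∈ ι ⁻¹' Ψ.target, ∀ u : K,
      (mfderiv 𝓘(ℝ, K) 𝓘(ℝ, E) ((Ψ.symm : K × V → M) ∘ ι) z u : E) =
        mfderiv 𝓘(ℝ, K × V) 𝓘(ℝ, E) Ψ.symm (Ψ (Ψ.symm (ι z))) ((u, 0) : K × V) := by
    intro z hz u
    have h := mfderiv_comp_model (x := z) (y := Ψ (Ψ.symm (ι z))) (I₁ := 𝓘(ℝ, K))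
      (Ψ.symm.mdifferentiableAt (by simp) (Ψ.map_source (hmap z hz).1))
      (hιd z).hasMFDerivAt.mdifferentiableAt (hmap z hz).2.symm
    rw [(hιd z).hasMFDerivAt.mfderiv] at h
    exact congrArg (fun L : K →L[ℝ] E => L u) h
  refine ⟨(Ψ.symm : K × V → M) ∘ ι, ι ⁻¹' Ψ.target, hW, ?_, ?_, ?_, ?_, fun z hz => ⟨?_, ?_⟩⟩
  · rw [mem_preimage, hι0]
    exact Ψ.map_source hx
  · rw [Function.comp_apply, hι0]
    exact Ψ.left_inv hx
  · exact Ψ.symm.contMDiffOn.comp hιs.contMDiff.contMDiffOn fun z hz => hz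
  · intro z hz z' hz' h
    have h2 := Ψ.symm.injOn hz hz' h
    simpa [ι] using h2
  · intro u u' h
    have h' := (hder z hz u).symm.trans (h.trans (hder z hz u'))
    have h2 := congrArg (mfderiv 𝓘(ℝ, E) 𝓘(ℝ, K × V) Ψ (Ψ.symm (ι z)) : E →L[ℝ] K × V) h'
    have h3 := (Ψ.mfderiv_mfderiv_symm (hmap z hz).1 (u, 0)).symm.trans
      (h2.trans (Ψ.mfderiv_mfderiv_symm (hmap z hz).1 (u', 0)))
    exact congrArg Prod.fst h3
  · intro u
    rw [Function.comp_apply, hΨ _ (hmap z hz).1]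
    constructor
    · intro h
      refine ⟨(mfderiv 𝓘(ℝ, E) 𝓘(ℝ, K × V) Ψ (Ψ.symm (ι z)) u : K × V).1, ?_⟩
      refine (hder z hz _).trans ?_
      refine Eq.trans ?_ (Ψ.mfderiv_symm_mfderiv (hmap z hz).1 u)
      congr 1
      exact Prod.ext rfl h.symm
    · rintro ⟨w, rfl⟩
      have h := Ψ.mfderiv_mfderiv_symm (hmap z hz).1 ((w, 0) : K × V)
      have h2 := (congrArg (mfderiv 𝓘(ℝ, E) 𝓘(ℝ, K × V) Ψ (Ψ.symm (ι z)) : E →L[ℝ] K × V)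
        (hder z hz w)).trans h
      exact congrArg Prod.snd h2

end FlatChart

/-! ### Slices and stabilizers -/

section Slice

variable {E : Type*} [NormedAddCommGroup E] [NormedSpace ℝ E]
  {F : Type*} [NormedAddCommGroup F] [NormedSpace ℝ F]
  {M : Type*} [TopologicalSpace M] [ChartedSpace E M]
  {T : Type*} [CommGroup T] [TopologicalSpace T] [ChartedSpace F T]
  [MulAction T M] [ContMDiffSMul 𝓘(ℝ, F) 𝓘(ℝ, E) ∞ T M]
  {p : (Fin (Module.finrank ℝ F) → ℝ) → T} {σ : TwoForm E M}

variable (hp : IsTorusParam p)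
  (hnd : ∀ x a, (∀ b, σ x ![infAct E p x a, infAct E p x b] = 0) → a = 0)
include hp hnd

theorem IsTorusParam.injective_mfderiv_orbitMap (x : M) :
    Function.Injective (mfderiv 𝓘(ℝ, F) 𝓘(ℝ, E) (fun t : T => t • x) 1) := by
  rw [injective_iff_map_eq_zero]
  intro v hv
  have hs := hp.surjective_mfderiv 0
  rw [hp.map_zero] at hs
  obtain ⟨a, rfl⟩ := hs v
  have h : infAct E p x a = 0 := (hp.infAct_apply x a).trans hv
  have ha : a = 0 := infAct_injective hnd x (h.trans (_root_.map_zero _).symm)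
  rw [ha]
  exact _root_.map_zero _

variable [FiniteDimensional ℝ E] [FiniteDimensional ℝ F] [IsManifold 𝓘(ℝ, E) ∞ M]
  [LieGroup 𝓘(ℝ, F) ∞ T]

/-- A slice tangent to the symplectic complement of the orbit gives a local diffeomorphism
`(t, z) ↦ t • s z`. -/
theorem IsTorusParam.isLocalDiffeomorphAt_slice {x : M}
    {s : EuclideanSpace ℝ (Fin (sliceDim E F)) → M}
    {S : Set (EuclideanSpace ℝ (Fin (sliceDim E F)))}
    (hS : IsOpen S) (h0 : (0 : EuclideanSpace ℝ (Fin (sliceDim E F))) ∈ S)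
    (hs : ContMDiffOn 𝓘(ℝ, EuclideanSpace ℝ (Fin (sliceDim E F))) 𝓘(ℝ, E) ∞ s S) (hs0 : s 0 = x)
    (hinj : Function.Injective (mfderiv 𝓘(ℝ, EuclideanSpace ℝ (Fin (sliceDim E F))) 𝓘(ℝ, E) s 0))
    (hΩ : ∀ w, (mfderiv 𝓘(ℝ, EuclideanSpace ℝ (Fin (sliceDim E F))) 𝓘(ℝ, E) s 0 w : E) ∈
      (orbitOrthogonal F T σ x : Submodule ℝ E)) :
    IsLocalDiffeomorphAt (𝓘(ℝ, F).prod 𝓘(ℝ, EuclideanSpace ℝ (Fin (sliceDim E F)))) 𝓘(ℝ, E) ∞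
      (fun q : T × EuclideanSpace ℝ (Fin (sliceDim E F)) => q.1 • s q.2) (1, 0) := by
  let K := EuclideanSpace ℝ (Fin (sliceDim E F))
  have : IsManifold 𝓘(ℝ, F) ∞ T := inferInstance
  have hsm : ContMDiffOn (𝓘(ℝ, F).prod 𝓘(ℝ, K)) 𝓘(ℝ, E) ∞ (fun q : T × K => q.1 • s q.2)
      (univ ×ˢ S) :=
    ContMDiffOn.smul (I := 𝓘(ℝ, F)) (f := fun q : T × K => q.1) (g := fun q => s q.2)
      contMDiff_fst.contMDiffOn (hs.comp contMDiff_snd.contMDiffOn fun q hq => hq.2)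
  have hU : IsOpen ((univ : Set T) ×ˢ S) := isOpen_univ.prod hS
  refine isLocalDiffeomorphAt_of_bijective_mfderiv hU ⟨mem_univ _, h0⟩ hsm ?_
  have hd : MDifferentiableAt (𝓘(ℝ, F).prod 𝓘(ℝ, K)) 𝓘(ℝ, E)
      (fun q : T × K => q.1 • s q.2) (1, 0) :=
    (hsm.contMDiffAt (hU.mem_nhds ⟨mem_univ _, h0⟩)).mdifferentiableAt (by simp)
  let L : F × K →ₗ[ℝ] E :=
    (mfderiv (𝓘(ℝ, F).prod 𝓘(ℝ, K)) 𝓘(ℝ, E) (fun q : T × K => q.1 • s q.2) (1, 0)).toLinearMap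
  let A : F →L[ℝ] E := mfderiv 𝓘(ℝ, F) 𝓘(ℝ, E) (fun t : T => t • x) 1
  let B : K →L[ℝ] E := mfderiv 𝓘(ℝ, K) 𝓘(ℝ, E) s 0
  -- The differential at `(1, 0)` is the sum of those of the orbit map and of the slice. Both are
  -- injective, with ranges in the complementary spaces `T_x(T · x)` and `Ω_x`; equality of
  -- dimensions then gives bijectivity.
  have hL : ∀ v : F × K, L v = A v.1 + B v.2 := by
    intro v
    have h := mfderiv_prod_eq_add_apply (v := v) hd
    have eA : (mfderiv 𝓘(ℝ, F) 𝓘(ℝ, E) (fun t : T => t • s 0) 1 : F →L[ℝ] E) = A := by rw [hs0]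
    have eB : (mfderiv 𝓘(ℝ, K) 𝓘(ℝ, E) (fun z : K => (1 : T) • s z) 0 : K →L[ℝ] E) = B := by
      have key : ∀ f g : K → M, f = g → (mfderiv 𝓘(ℝ, K) 𝓘(ℝ, E) f 0 : K →L[ℝ] E) =
          mfderiv 𝓘(ℝ, K) 𝓘(ℝ, E) g 0 := by
        rintro f _ rfl
        rfl
      exact key _ _ (funext fun z => one_smul T (s z))
    exact h.trans (congrArg₂ (fun (L : F →L[ℝ] E) (L' : K →L[ℝ] E) => L v.1 + L' v.2) eA eB)
  have hLinj : Function.Injective L := by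
    rw [injective_iff_map_eq_zero]
    rintro ⟨f, w⟩ h
    rw [hL] at h
    have hA : A f ∈ (orbitTangent E F T x : Submodule ℝ E) := ⟨f, rfl⟩
    have hdis := (hp.isCompl hnd x).disjoint
    have hB0 : B w = 0 := by
      refine Submodule.disjoint_def.1 (show Disjoint (orbitOrthogonal F T σ x : Submodule ℝ E)
        (orbitTangent E F T x : Submodule ℝ E) from hdis) _ (hΩ w) ?_
      rw [eq_neg_of_add_eq_zero_right h]
      exact Submodule.neg_mem _ hA
    have hA0 : A f = 0 := by simpa [hB0] using h
    have hf : f = 0 := hp.injective_mfderiv_orbitMap hnd x (hA0.trans (_root_.map_zero A).symm)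
    have hw : w = 0 := hinj (hB0.trans (_root_.map_zero B).symm)
    rw [hf, hw]
    rfl
  have hfr : Module.finrank ℝ (F × K) = Module.finrank ℝ E := by
    have := hp.finrank_add hnd x
    rw [hp.finrank_orbitOrthogonal hnd x] at this
    rw [Module.finrank_prod, finrank_euclideanSpace_fin]
    omega
  exact ⟨hLinj, (LinearMap.injective_iff_surjective_of_finrank_eq_finrank (f := L) hfr).1 hLinj⟩

/-- The stabilizer is closed in the compact `T`. It is discrete because `(t, z) ↦ t • s z` is
injective near `(1, 0)`, whereas a stabilizing `t` gives `(t, 0)` and `(1, 0)` the same image. -/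
theorem IsTorusParam.finite_stabilizer [T2Space M] (x : M) :
    Finite (MulAction.stabilizer T x) := by
  let K := EuclideanSpace ℝ (Fin (sliceDim E F))
  have : IsTopologicalGroup T := topologicalGroup_of_lieGroup 𝓘(ℝ, F) ∞
  have : CompactSpace T := hp.compactSpace
  let Ω : Submodule ℝ E := orbitOrthogonal F T σ x
  have hΩ : Module.finrank ℝ Ω = sliceDim E F := hp.finrank_orbitOrthogonal hnd x
  let j : K ≃ₗ[ℝ] Ω := LinearEquiv.ofFinrankEq _ _ (by rw [hΩ, finrank_euclideanSpace_fin])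
  let J : K →L[ℝ] E := (Ω.subtype.comp (j : K →ₗ[ℝ] Ω)).toContinuousLinearMap
  have hJ : ∀ w, J w = (j w : E) := fun w => rfl
  set c := chartAt E x with hc
  -- Equivariance plays no role yet, so the slice can be the affine plane of direction `Ω` in the
  -- chart at `x`, whose differential at `x` is the identity.
  let g : K → E := fun z => c x + J z
  have hg : ContDiff ℝ ∞ g := by fun_prop
  have hgd : HasFDerivAt g J 0 := J.hasFDerivAt.const_add (c x)
  have hg0 : g 0 = c x := by simp [g]
  have hxt : c x ∈ c.target := c.map_source (mem_chart_source E x)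
  have hd : ∀ w, (mfderiv 𝓘(ℝ, K) 𝓘(ℝ, E) (c.symm ∘ g) 0 w : E) = J w := by
    intro w
    have h := mfderiv_comp_model (x := (0 : K)) (y := c x) (I₁ := 𝓘(ℝ, K)) (I₃ := 𝓘(ℝ, E))
      (mdifferentiableAt_atlas_symm (I := 𝓘(ℝ, E)) (chart_mem_atlas E x) hxt)
      hgd.hasMFDerivAt.mdifferentiableAt hg0
    rw [hgd.hasMFDerivAt.mfderiv] at h
    have h2 := mfderiv_chartAt_symm_comp_mfderiv_chartAt (mem_chart_source E x) (J w)
    have hid : (mfderiv 𝓘(ℝ, E) 𝓘(ℝ, E) c x (J w) : E) = J w := by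
      rw [mfderiv_chartAt_eq_tangentCoordChange (mem_chart_source E x)]
      exact tangentCoordChange_self (I := 𝓘(ℝ, E)) (mem_extChartAt_source x)
    exact (congrArg (fun L : K →L[ℝ] E => L w) h).trans
      ((congrArg (mfderiv 𝓘(ℝ, E) 𝓘(ℝ, E) c.symm (c x) : E →L[ℝ] E) hid.symm).trans h2)
  have hld := hp.isLocalDiffeomorphAt_slice hnd (x := x) (s := c.symm ∘ g) (S := g ⁻¹' c.target)
    (c.open_target.preimage hg.continuous) (by rw [mem_preimage, hg0]; exact hxt)
    ((contMDiffOn_chart_symm (I := 𝓘(ℝ, E))).comp hg.contMDiff.contMDiffOn fun z hz => hz)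
    (by rw [Function.comp_apply, hg0]; exact c.left_inv (mem_chart_source E x))
    (by
      intro w w' h
      have h' := (hd w).symm.trans (h.trans (hd w'))
      exact j.injective (Subtype.ext h'))
    (by
      intro w
      rw [hd w]
      exact (j w).2)
  obtain ⟨Ψ, hΨ0, hΨ⟩ := hld
  have hxs : (c.symm ∘ g) 0 = x := by
    rw [Function.comp_apply, hg0]
    exact c.left_inv (mem_chart_source E x)
  have : ContinuousSMul T M := ContMDiffSMul.continuousSMul (I := 𝓘(ℝ, F)) (I' := 𝓘(ℝ, E)) ∞
  have hclosed : IsClosed (MulAction.stabilizer T x : Set T) := by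
    have : (MulAction.stabilizer T x : Set T) = (fun t : T => t • x) ⁻¹' {x} := by
      ext t
      simp [MulAction.mem_stabilizer_iff]
    rw [this]
    exact isClosed_singleton.preimage (by fun_prop)
  have : CompactSpace (MulAction.stabilizer T x) := isCompact_iff_compactSpace.1 hclosed.isCompact
  have hdisc : DiscreteTopology (MulAction.stabilizer T x) := by
    apply discreteTopology_of_isOpen_singleton_one
    have : ({1} : Set (MulAction.stabilizer T x)) =
        (fun h : MulAction.stabilizer T x => ((h : T), (0 : K))) ⁻¹' Ψ.source := by
      ext h
      constructor
      · rintro rfl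
        exact hΨ0
      · intro hh
        have e1 : Ψ ((h : T), (0 : K)) = Ψ (1, 0) := by
          refine (hΨ hh).symm.trans (Eq.trans ?_ (hΨ hΨ0))
          simp only [hxs, one_smul]
          exact h.2
        have e2 := Ψ.injOn hh hΨ0 e1
        exact Subtype.ext (congrArg Prod.fst e2)
    rw [this]
    exact Ψ.open_source.preimage (by fun_prop)
  exact finite_of_compact_of_discrete

end Slice

/-! ### The isotropy representation and equivariant charts -/

section Isotropy

variable {E : Type*} [NormedAddCommGroup E] [NormedSpace ℝ E]
  (F : Type*) [NormedAddCommGroup F] [NormedSpace ℝ F]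
  {M : Type*} [TopologicalSpace M] [ChartedSpace E M]
  {T : Type*} [CommGroup T] [TopologicalSpace T] [ChartedSpace F T]
  [MulAction T M] [ContMDiffSMul 𝓘(ℝ, F) 𝓘(ℝ, E) ∞ T M]

/-- The differential at `x` of the action of `t`, as a linear map of the model space. -/
def smulDeriv (E : Type*) [NormedAddCommGroup E] [NormedSpace ℝ E] {M : Type*} [TopologicalSpace M]
    [ChartedSpace E M] {T : Type*} [CommGroup T] [MulAction T M] (t : T) (x : M) : E →L[ℝ] E :=
  mfderiv 𝓘(ℝ, E) 𝓘(ℝ, E) (fun y : M => t • y) x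

/-- The isotropy representation of the stabilizer of `x` on the tangent space at `x`. -/
def isotropyRep (E F : Type*) [NormedAddCommGroup E] [NormedSpace ℝ E]
    [NormedAddCommGroup F] [NormedSpace ℝ F]
    {M : Type*} [TopologicalSpace M] [ChartedSpace E M]
    (T : Type*) [CommGroup T] [TopologicalSpace T] [ChartedSpace F T]
    [MulAction T M] [ContMDiffSMul 𝓘(ℝ, F) 𝓘(ℝ, E) ∞ T M] (x : M) :
    Representation ℝ (MulAction.stabilizer T x) E where
  toFun h := (smulDeriv E (h : T) x).toLinearMap
  map_one' := by
    have h : (fun y : M => ((1 : MulAction.stabilizer T x) : T) • y) = id := by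
      funext y
      simp
    refine LinearMap.ext fun v => ?_
    rw [smulDeriv, h]
    exact congrArg (fun L : E →L[ℝ] E => L v) (mfderiv_id (I := 𝓘(ℝ, E)) (x := x))
  map_mul' g h := by
    have e := mfderiv_comp_model (x := x) (y := x) (I₁ := 𝓘(ℝ, E)) (I₂ := 𝓘(ℝ, E))
      (I₃ := 𝓘(ℝ, E)) (f := fun y : M => (h : T) • y) (g := fun y : M => (g : T) • y)
      (mdifferentiable_smulMap E F (g : T) x) (mdifferentiable_smulMap E F (h : T) x) h.2
    have h2 : ((fun y : M => (g : T) • y) ∘ fun y : M => (h : T) • y) =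
        fun y : M => ((g * h : MulAction.stabilizer T x) : T) • y := by
      funext y
      simp [mul_smul]
    rw [h2] at e
    refine LinearMap.ext fun v => ?_
    exact congrArg (fun L : E →L[ℝ] E => L v) e

theorem IsTorusParam.isotropyRep_mem_orbitOrthogonal
    {p : (Fin (Module.finrank ℝ F) → ℝ) → T} {σ : TwoForm E M}
    (hp : IsTorusParam p) (hσT : IsInvariantForm T σ) {x : M}
    (h : MulAction.stabilizer T x) {v : E}
    (hv : v ∈ (orbitOrthogonal F T σ x : Submodule ℝ E)) :
    isotropyRep E F T x h v ∈ (orbitOrthogonal F T σ x : Submodule ℝ E) := by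
  have h1 := hp.mem_orbitOrthogonal_smul hσT (h : T) x hv
  let P : (x : M) → E → Prop := fun y w => w ∈ (orbitOrthogonal F T σ y : Submodule ℝ E)
  have h2 : P ((h : T) • x) (isotropyRep E F T x h v) := h1
  rw [show (h : T) • x = x from h.2] at h2
  exact h2

/-- The centred chart is averaged over the finite stabilizer: `e` is the sum of the maps `y ↦ dh (c
(h⁻¹ y) - c x)`. Each summand has the identity as differential at `x`, so the unnormalized sum has
`|T_x|` times the identity. Equivariance is a reindexing of the sum, and so holds for every `y`,
even outside the chart domain. -/
theorem exists_equivariant_chart [IsManifold 𝓘(ℝ, E) ∞ M] [FiniteDimensional ℝ E] (x : M)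
    [Finite (MulAction.stabilizer T x)] :
    ∃ (e : M → E) (U : Set M), IsOpen U ∧ x ∈ U ∧ ContMDiffOn 𝓘(ℝ, E) 𝓘(ℝ, E) ∞ e U ∧ e x = 0 ∧
      (∀ (h : MulAction.stabilizer T x) (y : M), e ((h : T) • y) = isotropyRep E F T x h (e y)) ∧
      ∀ v : E, (mfderiv 𝓘(ℝ, E) 𝓘(ℝ, E) e x v : E) =
          (Nat.card (MulAction.stabilizer T x) : ℝ) • v := by
  classical
  have := Fintype.ofFinite (MulAction.stabilizer T x)
  set c := chartAt E x with hc
  let A : MulAction.stabilizer T x → E →L[ℝ] E := fun h => smulDeriv E (h : T) x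
  have hA : ∀ h v, A h v = isotropyRep E F T x h v := fun _ _ => rfl
  have hAinv : ∀ h v, A h (isotropyRep E F T x h⁻¹ v) = v := by
    intro h v
    rw [hA, ← Module.End.mul_apply, ← map_mul]
    simp
  let f : MulAction.stabilizer T x → M → E := fun h y => A h (c ((h : T)⁻¹ • y) - c x)
  let U : Set M := ⋂ h : MulAction.stabilizer T x, (fun y : M => (h : T)⁻¹ • y) ⁻¹' c.source
  have hfix : ∀ h : MulAction.stabilizer T x, (h : T)⁻¹ • x = x := fun h => (h⁻¹).2
  have hxU : x ∈ U := mem_iInter.2 fun h => by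
    rw [mem_preimage, hfix]
    exact mem_chart_source E x
  have hUo : IsOpen U := isOpen_iInter_of_finite fun h =>
    c.open_source.preimage (contMDiff_smulMap E F (h : T)⁻¹).continuous
  have hfs : ∀ h, ContMDiffOn 𝓘(ℝ, E) 𝓘(ℝ, E) ∞ (f h) U := by
    intro h
    have h1 : ContMDiffOn 𝓘(ℝ, E) 𝓘(ℝ, E) ∞ (c ∘ fun y : M => (h : T)⁻¹ • y) U :=
      (contMDiffOn_chart (I := 𝓘(ℝ, E))).comp (contMDiff_smulMap E F (h : T)⁻¹).contMDiffOn
        fun y hy => mem_iInter.1 hy h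
    have h2 : ContDiff ℝ ∞ fun v : E => A h (v - c x) := by fun_prop
    exact h2.contMDiff.comp_contMDiffOn h1
  have hcx : ∀ v : E, (mfderiv 𝓘(ℝ, E) 𝓘(ℝ, E) c x v : E) = v := by
    intro v
    rw [mfderiv_chartAt_eq_tangentCoordChange (mem_chart_source E x)]
    exact tangentCoordChange_self (I := 𝓘(ℝ, E)) (mem_extChartAt_source x)
  have hfd : ∀ h, HasMFDerivAt 𝓘(ℝ, E) 𝓘(ℝ, E) (f h) x (ContinuousLinearMap.id ℝ E) := by
    intro h
    have h1 : MDifferentiableAt 𝓘(ℝ, E) 𝓘(ℝ, E) (f h) x :=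
      ((hfs h).contMDiffAt (hUo.mem_nhds hxU)).mdifferentiableAt (by simp)
    have h2 : HasFDerivAt (fun v : E => A h (v - c x)) (A h) (c x) :=
      (A h).hasFDerivAt.comp (c x) ((hasFDerivAt_id (c x)).sub_const (c x))
    have e1 := mfderiv_comp_model (x := x) (y := x) (I₁ := 𝓘(ℝ, E)) (I₃ := 𝓘(ℝ, E))
      (mdifferentiableAt_atlas (I := 𝓘(ℝ, E)) (chart_mem_atlas E x) (mem_chart_source E x))
      (mdifferentiable_smulMap E F (h : T)⁻¹ x) (hfix h)
    have hm : MDifferentiableAt 𝓘(ℝ, E) 𝓘(ℝ, E) (c ∘ fun y : M => (h : T)⁻¹ • y) x := by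
      refine MDifferentiableAt.comp x ?_ (mdifferentiable_smulMap E F (h : T)⁻¹ x)
      rw [hfix h]
      exact mdifferentiableAt_atlas (I := 𝓘(ℝ, E)) (chart_mem_atlas E x) (mem_chart_source E x)
    have e2 := mfderiv_comp_model (x := x) (y := c x) (I₁ := 𝓘(ℝ, E)) (I₃ := 𝓘(ℝ, E))
      h2.hasMFDerivAt.mdifferentiableAt hm (congrArg c (hfix h))
    rw [h2.hasMFDerivAt.mfderiv] at e2
    have e3 : (mfderiv 𝓘(ℝ, E) 𝓘(ℝ, E) (f h) x : E →L[ℝ] E) = ContinuousLinearMap.id ℝ E := by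
      refine e2.trans (ContinuousLinearMap.ext fun v => ?_)
      have e4 := congrArg (fun L : E →L[ℝ] E => L v) e1
      exact (congrArg (A h) (e4.trans (hcx _))).trans (hAinv h v)
    rw [← e3]
    exact h1.hasMFDerivAt
  refine ⟨fun y => ∑ h, f h y, U, hUo, hxU, ?_, ?_, ?_, ?_⟩
  · intro y hy
    exact ContMDiffWithinAt.sum fun h _ => hfs h y hy
  · simp [f, hfix]
  · intro g y
    rw [map_sum]
    -- The substitution `h ↦ g⁻¹ h`.
    refine Fintype.sum_equiv (Equiv.mulLeft g⁻¹) _ _ fun h => ?_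
    simp only [f, Equiv.coe_mulLeft, hA]
    rw [← Module.End.mul_apply, ← map_mul]
    simp [mul_smul]
  · intro v
    have hs : HasMFDerivAt 𝓘(ℝ, E) 𝓘(ℝ, E) (fun y => ∑ h, f h y) x
        (∑ _h : MulAction.stabilizer T x, ContinuousLinearMap.id ℝ E) := by
      have key : ∀ (S : Finset (MulAction.stabilizer T x)) (L : E →L[ℝ] E),
          L = ∑ _h ∈ S, ContinuousLinearMap.id ℝ E →
          HasMFDerivAt 𝓘(ℝ, E) 𝓘(ℝ, E) (fun y => ∑ h ∈ S, f h y) x L := by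
        intro S
        induction S using Finset.induction_on with
        | empty =>
          intro L hL
          rw [hL, Finset.sum_empty]
          simp only [Finset.sum_empty]
          exact hasMFDerivAt_const (I := 𝓘(ℝ, E)) (0 : E) x
        | insert a S ha ih =>
          intro L hL
          have hf : (fun y => ∑ h ∈ insert a S, f h y) = f a + fun y => ∑ h ∈ S, f h y :=
            funext fun y => Finset.sum_insert ha
          rw [hf, hL.trans (Finset.sum_insert ha)]
          exact (hfd a).add (ih _ rfl)
      exact key Finset.univ _ rfl
    rw [hs.mfderiv]
    change (∑ _h : MulAction.stabilizer T x, ContinuousLinearMap.id ℝ E) v = _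
    simp only [Finset.sum_const, Finset.card_univ, Nat.card_eq_fintype_card,
      Nat.cast_smul_eq_nsmul]
    rfl

end Isotropy

/-! ### Orthogonal models of representations of finite groups -/

section OrthogonalModel

/-- This is the averaging of an inner product: `w ↦ (g w)_g` embeds `W` in a Euclidean sum over `Γ`,
where acting by `h` only permutes the components. An orthonormal basis of the image gives the model.
Its use is that round disks become invariant. -/
theorem exists_orthogonal_model {Γ W : Type*} [Group Γ] [Finite Γ] [AddCommGroup W] [Module ℝ W]
    [FiniteDimensional ℝ W] {n : ℕ} (hn : Module.finrank ℝ W = n) (A : Representation ℝ Γ W) :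
    ∃ (ρ : Representation ℝ Γ (EuclideanSpace ℝ (Fin n))) (j : EuclideanSpace ℝ (Fin n) ≃ₗ[ℝ] W),
      (∀ h z, ‖ρ h z‖ = ‖z‖) ∧ ∀ h z, j (ρ h z) = A h (j z) := by
  classical
  have := Fintype.ofFinite Γ
  let K := EuclideanSpace ℝ (Fin n)
  let j₀ : W ≃ₗ[ℝ] K := LinearEquiv.ofFinrankEq _ _ (by rw [hn, finrank_euclideanSpace_fin])
  let J : W →ₗ[ℝ] PiLp 2 (fun _ : Γ => K) :=
    (WithLp.linearEquiv 2 ℝ (Γ → K)).symm.toLinearMap.comp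
      (LinearMap.pi fun g => (j₀ : W →ₗ[ℝ] K).comp (A g))
  have hJ : ∀ w g, J w g = j₀ (A g w) := fun _ _ => rfl
  have hJinj : Function.Injective J := by
    intro w w' h
    have h1 := congrArg (fun q : PiLp 2 (fun _ : Γ => K) => q 1) h
    simp only [hJ, map_one] at h1
    exact j₀.injective h1
  have hJA : ∀ h w, ‖J (A h w)‖ = ‖J w‖ := by
    intro h w
    rw [PiLp.norm_eq_of_L2, PiLp.norm_eq_of_L2]
    congr 1
    refine Fintype.sum_equiv (Equiv.mulRight h) _ _ fun g => ?_
    rw [hJ, hJ, Equiv.coe_mulRight, map_mul, Module.End.mul_apply]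
  have hfr : Module.finrank ℝ (LinearMap.range J) = n :=
    (LinearMap.finrank_range_of_inj hJinj).trans hn
  let b := (stdOrthonormalBasis ℝ (LinearMap.range J)).reindex (finCongr hfr)
  let j : K ≃ₗ[ℝ] W := ((LinearEquiv.ofInjective J hJinj).trans b.repr.toLinearEquiv).symm
  have hj : ∀ z, ‖J (j z)‖ = ‖z‖ := by
    intro z
    obtain ⟨w, rfl⟩ := j.symm.surjective z
    rw [j.apply_symm_apply]
    exact (b.repr.norm_map (LinearEquiv.ofInjective J hJinj w)).symm
  refine ⟨j.symm.conjRingEquiv.toMulEquiv.toMonoidHom.comp A, j, ?_, ?_⟩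
  · intro h z
    rw [← hj, ← hj z, ← hJA h (j z)]
    congr 2
    simp [LinearEquiv.conjRingEquiv]
  · intro h z
    simp [LinearEquiv.conjRingEquiv]

end OrthogonalModel

/-! ### Existence of tubes -/

section TubeExistence

variable {E : Type*} [NormedAddCommGroup E] [NormedSpace ℝ E]
  {F : Type*} [NormedAddCommGroup F] [NormedSpace ℝ F]
  {M : Type*} [TopologicalSpace M] [ChartedSpace E M]
  {T : Type*} [CommGroup T] [TopologicalSpace T] [ChartedSpace F T]
  [MulAction T M]

/-- The inequality is an open condition on `(z, z', g)` and holds on `{(z₀, z₀)} × C`, so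
compactness of `C` gives a neighbourhood uniform in `g`. In the tube theorem this excludes group
elements far from the stabilizer. -/
theorem eventually_forall_smul_ne [T2Space M] [ContinuousSMul T M] {K : Type*} [TopologicalSpace K]
    {C : Set T} (hC : IsCompact C) {x : M} (hx : ∀ g ∈ C, g • x ≠ x) {s : K → M} {z₀ : K}
    (hs : ContinuousAt s z₀) (hs0 : s z₀ = x) :
    ∀ᶠ q : K × K in 𝓝 (z₀, z₀), ∀ g ∈ C, g • s q.1 ≠ s q.2 := by
  refine hC.eventually_forall_of_forall_eventually fun g hg => ?_
  have h1 : ContinuousAt (fun q : (K × K) × T => q.2 • s q.1.1) ((z₀, z₀), g) :=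
    continuousAt_snd.smul
      (ContinuousAt.comp (f := fun q : (K × K) × T => q.1.1) hs (by fun_prop))
  have h2 : ContinuousAt (fun q : (K × K) × T => s q.1.2) ((z₀, z₀), g) :=
    ContinuousAt.comp (f := fun q : (K × K) × T => q.1.2) hs (by fun_prop)
  exact (h1.prodMk h2).eventually_mem
    (isClosed_diagonal.isOpen_compl.mem_nhds (by simpa [hs0] using hx g hg))

theorem IsLocalDiffeomorphAt.comp_inclusion {E F M T : Type*} [NormedAddCommGroup E]
    [NormedSpace ℝ E] [NormedAddCommGroup F] [NormedSpace ℝ F] [TopologicalSpace M]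
    [ChartedSpace E M] [TopologicalSpace T] [ChartedSpace F T] {K : Type*}
    [NormedAddCommGroup K] [NormedSpace ℝ K]
    {f : T × K → M} {D : Opens K} {t : T} {z : D}
    (hf : IsLocalDiffeomorphAt (𝓘(ℝ, F).prod 𝓘(ℝ, K)) 𝓘(ℝ, E) ∞ f (t, (z : K))) :
    IsLocalDiffeomorphAt (𝓘(ℝ, F).prod 𝓘(ℝ, K)) 𝓘(ℝ, E) ∞
      (fun q : T × D => f (q.1, (q.2 : K))) (t, z) := by
  classical
  obtain ⟨Ψ, hz, hΨ⟩ := hf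
  let i : T × D → T × K := fun q => (q.1, (q.2 : K))
  have hi : ContMDiff (𝓘(ℝ, F).prod 𝓘(ℝ, K)) (𝓘(ℝ, F).prod 𝓘(ℝ, K)) ∞ i :=
    contMDiff_fst.prodMk (contMDiff_subtype_val.comp contMDiff_snd)
  -- A left inverse of the inclusion. Its value off `D` is irrelevant, since `B` only contains
  -- points whose second coordinate lies in `D`.
  let r : K → D := fun k => if h : k ∈ D then ⟨k, h⟩ else z
  have hr : ∀ k ∈ D, (r k : K) = k := fun k hk => by simp [r, hk]
  let B : Set M := Ψ.target ∩ Ψ.symm ⁻¹' (univ ×ˢ (D : Set K))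
  have hB : IsOpen B := Ψ.contMDiffOn_invFun.continuousOn.isOpen_inter_preimage Ψ.open_target
    (isOpen_univ.prod D.isOpen)
  have hsrc : ∀ q : T × D, i q ∈ Ψ.source → f (i q) ∈ B := by
    intro q hq
    rw [hΨ hq]
    refine ⟨Ψ.map_source hq, mem_univ _, ?_⟩
    rw [show Ψ.symm (Ψ (i q)) = i q from Ψ.left_inv hq]
    exact q.2.2
  refine IsLocalDiffeomorphAt.of_inverse (f := fun q : T × D => f (i q)) (A := i ⁻¹' Ψ.source)
    (g := fun y => ((Ψ.symm y).1, r (Ψ.symm y).2)) (B := B)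
    (Ψ.open_source.preimage hi.continuous) hB hz (hsrc _ hz) ?_ ?_ ?_ ?_
  · exact (Ψ.contMDiffOn_toFun.congr hΨ).comp hi.contMDiffOn fun q hq => hq
  · have h1 : ContMDiffOn 𝓘(ℝ, E) (𝓘(ℝ, F).prod 𝓘(ℝ, K)) ∞ Ψ.symm B :=
      Ψ.contMDiffOn_invFun.mono inter_subset_left
    refine ContMDiffOn.prodMk (contMDiff_fst.comp_contMDiffOn h1) fun y hy => ?_
    rw [← ContMDiffWithinAt.subtypeVal_comp_iff]
    exact (contMDiff_snd.comp_contMDiffOn h1 y hy).congr (fun y' hy' => hr _ hy'.2.2) (hr _ hy.2.2)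
  · intro q hq
    have h : Ψ.symm (f (i q)) = i q := by
      rw [hΨ hq]
      exact Ψ.left_inv hq
    simp only [h]
    exact Prod.ext rfl (Subtype.ext (hr _ q.2.2))
  · intro y hy
    have h : i ((Ψ.symm y).1, r (Ψ.symm y).2) = Ψ.symm y := Prod.ext rfl (hr _ hy.2.2)
    simp only [h]
    rw [hΨ (Ψ.symm.map_source hy.1)]
    exact Ψ.right_inv hy.1

/-- By equivariance, a local inverse at `(t, z)` is the one at `(1, z)` conjugated with the
translations by `t` on `T` and on `M`. -/
theorem IsLocalDiffeomorphAt.smul_slice [LieGroup 𝓘(ℝ, F) ∞ T] [ContMDiffSMul 𝓘(ℝ, F) 𝓘(ℝ, E) ∞ T M]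
    {K : Type*} [NormedAddCommGroup K] [NormedSpace ℝ K] {s : K → M} {z : K} (t : T)
    (hs : IsLocalDiffeomorphAt (𝓘(ℝ, F).prod 𝓘(ℝ, K)) 𝓘(ℝ, E) ∞
      (fun q : T × K => q.1 • s q.2) (1, z)) :
    IsLocalDiffeomorphAt (𝓘(ℝ, F).prod 𝓘(ℝ, K)) 𝓘(ℝ, E) ∞
      (fun q : T × K => q.1 • s q.2) (t, z) := by
  obtain ⟨Ψ, hz, hΨ⟩ := hs
  have hτ : ∀ u : T, ContMDiff (𝓘(ℝ, F).prod 𝓘(ℝ, K)) (𝓘(ℝ, F).prod 𝓘(ℝ, K)) ∞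
      (fun q : T × K => (u * q.1, q.2)) := fun u =>
    (contMDiff_mul_left.comp contMDiff_fst).prodMk contMDiff_snd
  have hf : ∀ q : T × K, t • ((t⁻¹ * q.1) • s q.2) = q.1 • s q.2 := by
    intro q
    rw [← mul_smul, mul_inv_cancel_left]
  refine IsLocalDiffeomorphAt.of_inverse
    (A := (fun q : T × K => (t⁻¹ * q.1, q.2)) ⁻¹' Ψ.source)
    (g := fun y => (t * (Ψ.symm (t⁻¹ • y)).1, (Ψ.symm (t⁻¹ • y)).2))
    (B := (fun y : M => t⁻¹ • y) ⁻¹' Ψ.target)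
    (Ψ.open_source.preimage (hτ _).continuous)
    (Ψ.open_target.preimage (contMDiff_smulMap E F t⁻¹).continuous)
      (by simpa using hz) ?_ ?_ ?_ ?_ ?_
  · have h : (1 : T) • s z = Ψ (1, z) := hΨ hz
    simp only [mem_preimage, inv_smul_smul]
    rw [one_smul] at h
    rw [h]
    exact Ψ.map_source hz
  · have h1 : ContMDiffOn (𝓘(ℝ, F).prod 𝓘(ℝ, K)) 𝓘(ℝ, E) ∞
        (fun q : T × K => t • ((t⁻¹ * q.1) • s q.2))
        ((fun q : T × K => (t⁻¹ * q.1, q.2)) ⁻¹' Ψ.source) :=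
      (contMDiff_smulMap E F t).comp_contMDiffOn
        ((Ψ.contMDiffOn_toFun.congr hΨ).comp (hτ t⁻¹).contMDiffOn fun q hq => hq)
    exact h1.congr fun q _ => (hf q).symm
  · exact (hτ t).comp_contMDiffOn
      (Ψ.contMDiffOn_invFun.comp (contMDiff_smulMap E F t⁻¹).contMDiffOn fun y hy => hy)
  · intro q hq
    have h : Ψ.symm (t⁻¹ • (q.1 • s q.2)) = (t⁻¹ * q.1, q.2) := by
      rw [← mul_smul]
      rw [show (t⁻¹ * q.1) • s q.2 = Ψ (t⁻¹ * q.1, q.2) from hΨ hq]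
      exact Ψ.left_inv hq
    simp only [h, mul_inv_cancel_left]
  · intro y hy
    have h : (Ψ.symm (t⁻¹ • y)).1 • s (Ψ.symm (t⁻¹ • y)).2 = t⁻¹ • y :=
      (hΨ (Ψ.symm.map_source hy)).trans (Ψ.right_inv hy)
    simp only [mul_smul, h, smul_inv_smul]

variable [ContMDiffSMul 𝓘(ℝ, F) 𝓘(ℝ, E) ∞ T M] {p : (Fin (Module.finrank ℝ F) → ℝ) → T}
  {σ : TwoForm E M} [FiniteDimensional ℝ E] [FiniteDimensional ℝ F] [IsManifold 𝓘(ℝ, E) ∞ M]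
  [LieGroup 𝓘(ℝ, F) ∞ T] [T2Space M]

/-- The slice is the inverse of the averaged chart, restricted to the invariant subspace `Ω_x` in an
orthogonal parametrization. Since that chart has a multiple of the identity as differential at `x`,
the slice is tangent to `Ω_x`, hence transverse to the orbit. -/
theorem IsTorusParam.exists_equivariant_slice (hp : IsTorusParam p) (hσT : IsInvariantForm T σ)
    (hnd : ∀ x a, (∀ b, σ x ![infAct E p x a, infAct E p x b] = 0) → a = 0) (x : M) :
    ∃ (ρ : Representation ℝ (MulAction.stabilizer T x) (EuclideanSpace ℝ (Fin (sliceDim E F))))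
      (s : EuclideanSpace ℝ (Fin (sliceDim E F)) → M),
      (∀ h z, ‖ρ h z‖ = ‖z‖) ∧ s 0 = x ∧ ContinuousAt s 0 ∧
      (∀ᶠ z in 𝓝 0, ∀ h, s (ρ h z) = (h : T) • s z) ∧
      IsLocalDiffeomorphAt (𝓘(ℝ, F).prod 𝓘(ℝ, EuclideanSpace ℝ (Fin (sliceDim E F)))) 𝓘(ℝ, E) ∞
        (fun q : T × EuclideanSpace ℝ (Fin (sliceDim E F)) => q.1 • s q.2) (1, 0) := by
  let K := EuclideanSpace ℝ (Fin (sliceDim E F))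
  have hfin : Finite (MulAction.stabilizer T x) := hp.finite_stabilizer hnd x
  obtain ⟨e, U, hU, hxU, he, hex, heq, hde⟩ := exists_equivariant_chart (E := E) F (T := T) x
  have hN : (Nat.card (MulAction.stabilizer T x) : ℝ) ≠ 0 := by
    exact_mod_cast Nat.card_pos.ne'
  have hbij : Function.Bijective (mfderiv 𝓘(ℝ, E) 𝓘(ℝ, E) e x) := by
    constructor
    · intro v w h
      have h' := (hde v).symm.trans (h.trans (hde w))
      exact smul_right_injective E hN h'
    · intro v
      refine ⟨((Nat.card (MulAction.stabilizer T x) : ℝ)⁻¹ • v : E), (hde _).trans ?_⟩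
      exact smul_inv_smul₀ hN (v : E)
  obtain ⟨Λ, hxΛ, heΛ⟩ := isLocalDiffeomorphAt_of_bijective_mfderiv hU hxU he hbij
  have hΛx : Λ x = 0 := (heΛ hxΛ).symm.trans hex
  let Ω : Submodule ℝ E := orbitOrthogonal F T σ x
  let A : Representation ℝ (MulAction.stabilizer T x) Ω :=
    { toFun := fun h => (isotropyRep E F T x h).restrict
        fun v hv => hp.isotropyRep_mem_orbitOrthogonal F hσT h hv
      map_one' := by
        ext v
        simp [LinearMap.restrict_apply]
      map_mul' := by
        intro g h
        ext v
        simp [LinearMap.restrict_apply] }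
  have : FiniteDimensional ℝ Ω := FiniteDimensional.finiteDimensional_submodule Ω
  have hfr : Module.finrank ℝ Ω = sliceDim E F := hp.finrank_orbitOrthogonal hnd x
  obtain ⟨ρ, j, hρ, hj⟩ := exists_orthogonal_model hfr A
  let J : K →L[ℝ] E := (Ω.subtype.comp (j : K →ₗ[ℝ] Ω)).toContinuousLinearMap
  have hJ : ∀ w, J w = (j w : E) := fun w => rfl
  have hJρ : ∀ h z, J (ρ h z) = isotropyRep E F T x h (J z) := by
    intro h z
    rw [hJ, hj]
    rfl
  have h0 : J 0 ∈ Λ.target := by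
    rw [_root_.map_zero, ← hΛx]
    exact Λ.map_source hxΛ
  have hS : IsOpen (J ⁻¹' Λ.target) := Λ.open_target.preimage J.continuous
  have hs : ContMDiffOn 𝓘(ℝ, K) 𝓘(ℝ, E) ∞ (Λ.symm ∘ J) (J ⁻¹' Λ.target) :=
    Λ.contMDiffOn_invFun.comp J.contMDiff.contMDiffOn fun z hz => hz
  have hs0 : (Λ.symm ∘ J) 0 = x := by
    rw [Function.comp_apply, _root_.map_zero, ← hΛx]
    exact Λ.left_inv hxΛ
  have hsa : ContMDiffAt 𝓘(ℝ, K) 𝓘(ℝ, E) ∞ (Λ.symm ∘ J) 0 := hs.contMDiffAt (hS.mem_nhds h0)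
  have hd : ∀ w, (Nat.card (MulAction.stabilizer T x) : ℝ) •
      (mfderiv 𝓘(ℝ, K) 𝓘(ℝ, E) (Λ.symm ∘ J) 0 w : E) = J w := by
    intro w
    have h1 := mfderiv_comp_model (x := (0 : K)) (y := x) (I₁ := 𝓘(ℝ, K)) (I₂ := 𝓘(ℝ, E))
      (I₃ := 𝓘(ℝ, E)) (Λ.mdifferentiableAt (by simp) hxΛ) (hsa.mdifferentiableAt (by simp)) hs0
    have h2 : (Λ : M → E) ∘ (Λ.symm ∘ J) =ᶠ[𝓝 0] J := by
      filter_upwards [hS.mem_nhds h0] with z hz using Λ.right_inv hz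
    have h3 : (mfderiv 𝓘(ℝ, K) 𝓘(ℝ, E) ((Λ : M → E) ∘ (Λ.symm ∘ J)) 0 : K →L[ℝ] E) = J :=
      h2.mfderiv_eq.trans J.hasMFDerivAt.mfderiv
    have h4 : (mfderiv 𝓘(ℝ, E) 𝓘(ℝ, E) Λ x : E →L[ℝ] E) = mfderiv 𝓘(ℝ, E) 𝓘(ℝ, E) e x := by
      refine Filter.EventuallyEq.mfderiv_eq ?_
      filter_upwards [Λ.open_source.mem_nhds hxΛ] with y hy using (heΛ hy).symm
    refine (hde _).symm.trans ?_
    refine (congrArg (fun L : E →L[ℝ] E => L _) h4.symm).trans ?_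
    exact congrArg (fun L : K →L[ℝ] E => L w) (h1.symm.trans h3)
  refine ⟨ρ, Λ.symm ∘ J, hρ, hs0, hsa.continuousAt, ?_,
    hp.isLocalDiffeomorphAt_slice hnd hS h0 hs hs0 ?_ ?_⟩
  · have h1 : ∀ᶠ z in 𝓝 (0 : K), ∀ h : MulAction.stabilizer T x,
        (h : T) • (Λ.symm ∘ J) z ∈ Λ.source := by
      refine Filter.eventually_all.2 fun h => ?_
      have hc : ContinuousAt (fun z => (h : T) • (Λ.symm ∘ J) z) 0 :=
        (contMDiff_smulMap E F (h : T)).continuous.continuousAt.comp hsa.continuousAt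
      refine hc.eventually_mem (Λ.open_source.mem_nhds ?_)
      rw [hs0, show (h : T) • x = x from h.2]
      exact hxΛ
    filter_upwards [h1, hS.mem_nhds h0] with z hz hzS h
    have hzs : (Λ.symm ∘ J) z ∈ Λ.source := Λ.symm.map_source hzS
    have h2 : Λ ((h : T) • (Λ.symm ∘ J) z) = J (ρ h z) := by
      rw [← heΛ (hz h), heq, heΛ hzs, hJρ]
      congr 1
      exact Λ.right_inv hzS
    rw [Function.comp_apply, ← h2]
    exact Λ.left_inv (hz h)
  · intro w w' h
    have h' := (hd w).symm.trans ((congrArg _ h).trans (hd w'))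
    exact j.injective (Subtype.ext h')
  · intro w
    have h1 : (mfderiv 𝓘(ℝ, K) 𝓘(ℝ, E) (Λ.symm ∘ J) 0 w : E) =
        (Nat.card (MulAction.stabilizer T x) : ℝ)⁻¹ • J w := by
      rw [← hd w]
      exact (inv_smul_smul₀ hN _).symm
    rw [h1]
    exact Submodule.smul_mem _ _ (j w).2

/-- The tube theorem. -/
theorem IsTorusParam.nonempty_tube (hp : IsTorusParam p) (hσT : IsInvariantForm T σ)
    (hnd : ∀ x a, (∀ b, σ x ![infAct E p x a, infAct E p x b] = 0) → a = 0) (x : M) :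
    Nonempty (Tube E F T x) := by
  let K := EuclideanSpace ℝ (Fin (sliceDim E F))
  have : IsTopologicalGroup T := topologicalGroup_of_lieGroup 𝓘(ℝ, F) ∞
  have : CompactSpace T := hp.compactSpace
  have : ContinuousSMul T M := ContMDiffSMul.continuousSMul (I := 𝓘(ℝ, F)) (I' := 𝓘(ℝ, E)) ∞
  have hfin : Finite (MulAction.stabilizer T x) := hp.finite_stabilizer hnd x
  obtain ⟨ρ, s, hρ, hs0, hsc, hsρ, Ψ, hΨ0, hΨ⟩ := hp.exists_equivariant_slice hσT hnd x
  obtain ⟨N, hN, B, hB, hNB⟩ : ∃ N ∈ 𝓝 (1 : T), ∃ B ∈ 𝓝 (0 : K), N ×ˢ B ⊆ Ψ.source :=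
    mem_nhds_prod_iff.1 (Ψ.open_source.mem_nhds hΨ0)
  obtain ⟨N', hN'N, hN'o, h1N'⟩ := mem_nhds_iff.1 hN
  -- `C` is the complement of the neighbourhood `N' · T_x` of the stabilizer: a compact set none of
  -- whose elements fixes `x`.
  let C : Set T := (⋃ h : MulAction.stabilizer T x, (fun t : T => t * (h : T)⁻¹) ⁻¹' N')ᶜ
  have hC : IsCompact C := by
    refine (isOpen_iUnion fun h => hN'o.preimage (by fun_prop)).isClosed_compl.isCompact
  have hCx : ∀ g ∈ C, g • x ≠ x := by
    intro g hg hgx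
    refine hg (mem_iUnion.2 ⟨⟨g, hgx⟩, ?_⟩)
    simpa using h1N'
  have hsep := eventually_forall_smul_ne hC hCx hsc hs0
  rw [nhds_prod_eq] at hsep
  obtain ⟨B', hB', hsep⟩ := (Filter.eventually_prod_self_iff
    (r := fun z z' => ∀ g ∈ C, g • s z ≠ s z')).1 hsep
  obtain ⟨r, hr, hrB⟩ := Metric.mem_nhds_iff.1 (Filter.inter_mem (Filter.inter_mem hB hB') hsρ)
  have hball : ∀ z ∈ disk (sliceDim E F) r, z ∈ B ∧ z ∈ B' ∧ ∀ h, s (ρ h z) = (h : T) • s z :=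
    fun z hz => ⟨(hrB hz).1.1, (hrB hz).1.2, (hrB hz).2⟩
  have hρmem : ∀ h, ∀ z ∈ disk (sliceDim E F) r, ρ h z ∈ disk (sliceDim E F) r := by
    intro h z hz
    have hz' : z ∈ Metric.ball (0 : K) r := hz
    change ρ h z ∈ Metric.ball (0 : K) r
    rw [mem_ball_zero_iff] at hz' ⊢
    rwa [hρ]
  refine ⟨{
    r := r
    r_pos := hr
    ρ := ρ
    ρ_mem := hρmem
    Φ := fun q => q.1 • s q.2
    Φ_center := fun z hz => by
      rw [hz, hs0]
      exact one_smul T x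
    Φ_equivariant := fun u t z => mul_smul u t (s z)
    Φ_induces := ⟨fun q => ?_, fun a b => ⟨fun hab => ?_, ?_⟩⟩ }⟩
  · have h1 : IsLocalDiffeomorphAt (𝓘(ℝ, F).prod 𝓘(ℝ, K)) 𝓘(ℝ, E) ∞
        (fun q : T × K => q.1 • s q.2) (1, (q.2 : K)) :=
      ⟨Ψ, hNB ⟨mem_of_mem_nhds hN, (hball _ q.2.2).1⟩, hΨ⟩
    exact (h1.smul_slice q.1).comp_inclusion
  · have hg : (b.1⁻¹ * a.1) • s a.2 = s b.2 := by
      rw [mul_smul, inv_smul_eq_iff]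
      exact hab
    have hgC : b.1⁻¹ * a.1 ∉ C := fun hgC =>
      hsep _ (hball _ a.2.2).2.1 _ (hball _ b.2.2).2.1 _ hgC hg
    obtain ⟨h, hh⟩ := mem_iUnion.1 (not_not.1 hgC)
    have hmem : ρ h (a.2 : K) ∈ disk (sliceDim E F) r := hρmem h _ a.2.2
    -- Since `b.1⁻¹ * a.1` lies in `N' · T_x`, dividing by the factor `h` and moving it onto the
    -- slice brings both points into `N × B`, where `Ψ` is injective.
    have e1 : (b.1⁻¹ * a.1 * (h : T)⁻¹) • s (ρ h a.2) = (1 : T) • s b.2 := by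
      rw [(hball _ a.2.2).2.2 h, ← mul_smul, inv_mul_cancel_right, hg, one_smul]
    have m1 : (b.1⁻¹ * a.1 * (h : T)⁻¹, ρ h (a.2 : K)) ∈ Ψ.source :=
      hNB ⟨hN'N hh, (hball _ hmem).1⟩
    have m2 : ((1 : T), (b.2 : K)) ∈ Ψ.source :=
      hNB ⟨mem_of_mem_nhds hN, (hball _ b.2.2).1⟩
    have e2 := Ψ.injOn m1 m2 ((hΨ m1).symm.trans (e1.trans (hΨ m2)))
    refine ⟨h, ?_, (congrArg Prod.snd e2).symm⟩
    have e3 : b.1⁻¹ * a.1 * (h : T)⁻¹ = 1 := congrArg Prod.fst e2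
    rw [mul_assoc, inv_mul_eq_one] at e3
    exact e3
  · rintro ⟨h, h1, h2⟩
    change a.1 • s a.2 = b.1 • s b.2
    rw [h1, h2, (hball _ a.2.2).2.2 h, ← mul_smul, inv_mul_cancel_right]

end TubeExistence

/-! ### Orbits are embedded -/

section EmbeddedOrbits

theorem PartialDiffeomorph.mem_maximalAtlas {E : Type*} [NormedAddCommGroup E] [NormedSpace ℝ E]
    {M : Type*} [TopologicalSpace M] [ChartedSpace E M] [IsManifold 𝓘(ℝ, E) ∞ M]
    (Λ : PartialDiffeomorph 𝓘(ℝ, E) 𝓘(ℝ, E) M E ∞) :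
    Λ.toOpenPartialHomeomorph ∈ IsManifold.maximalAtlas 𝓘(ℝ, E) ∞ M := by
  have h1 : ∀ f ∈ atlas E M, ContDiffOn ℝ ∞ (f ∘ Λ.symm) (Λ.target ∩ Λ.symm ⁻¹' f.source) := by
    intro f hf
    rw [← contMDiffOn_iff_contDiffOn]
    exact (contMDiffOn_of_mem_maximalAtlas (I := 𝓘(ℝ, E))
      (IsManifold.subset_maximalAtlas hf)).comp
      (Λ.contMDiffOn_invFun.mono inter_subset_left) fun y hy => hy.2
  have h2 : ∀ f ∈ atlas E M, ContDiffOn ℝ ∞ (Λ ∘ f.symm) (f.target ∩ f.symm ⁻¹' Λ.source) := by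
    intro f hf
    rw [← contMDiffOn_iff_contDiffOn]
    exact Λ.contMDiffOn_toFun.comp ((contMDiffOn_symm_of_mem_maximalAtlas (I := 𝓘(ℝ, E))
      (IsManifold.subset_maximalAtlas hf)).mono inter_subset_left) fun y hy => hy.2
  refine mem_maximalAtlas_iff.2 fun f hf => ⟨?_, ?_⟩
  · refine mem_groupoid_of_pregroupoid.2 ⟨?_, ?_⟩
    · refine (h1 f hf).mono fun u hu => ?_
      simpa [contDiffPregroupoid] using hu.1
    · refine (h2 f hf).mono fun u hu => ?_
      simpa [contDiffPregroupoid] using hu.1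
  · refine mem_groupoid_of_pregroupoid.2 ⟨?_, ?_⟩
    · refine (h2 f hf).mono fun u hu => ?_
      simpa [contDiffPregroupoid] using hu.1
    · refine (h1 f hf).mono fun u hu => ?_
      simpa [contDiffPregroupoid] using hu.1

variable {E : Type*} [NormedAddCommGroup E] [NormedSpace ℝ E]
  {F : Type*} [NormedAddCommGroup F] [NormedSpace ℝ F]
  {M : Type*} [TopologicalSpace M] [ChartedSpace E M]
  {T : Type*} [CommGroup T] [TopologicalSpace T] [ChartedSpace F T] [MulAction T M]

/-- The origin of the disk of a tube. -/
def Tube.origin {x : M} (τ : Tube E F T x) : disk (sliceDim E F) τ.r :=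
  ⟨0, Metric.mem_ball_self τ.r_pos⟩

theorem Tube.Φ_origin {x : M} (τ : Tube E F T x) (t : T) : τ.Φ (t, τ.origin) = t • x := by
  have h := τ.Φ_equivariant t 1 τ.origin
  rwa [mul_one, τ.Φ_center τ.origin rfl] at h

/-- The linear action fixes the origin, so the orbit of `x` is the zero section of the tube. -/
theorem Tube.Φ_mem_orbit_iff {x : M} (τ : Tube E F T x) (q : T × disk (sliceDim E F) τ.r) :
    τ.Φ q ∈ MulAction.orbit T x ↔ (q.2 : EuclideanSpace ℝ (Fin (sliceDim E F))) = 0 := by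
  constructor
  · rintro ⟨t, ht⟩
    have ht' : τ.Φ (t, τ.origin) = τ.Φ q := (τ.Φ_origin t).trans ht
    obtain ⟨h, -, h2⟩ := (τ.Φ_induces.2 _ _).1 ht'
    rw [h2]
    exact map_zero (τ.ρ h)
  · intro h
    refine ⟨q.1, (τ.Φ_origin q.1).symm.trans ?_⟩
    congr 1
    exact Prod.ext rfl (Subtype.ext h.symm)

variable [ContMDiffSMul 𝓘(ℝ, F) 𝓘(ℝ, E) ∞ T M] {p : (Fin (Module.finrank ℝ F) → ℝ) → T}
  {σ : TwoForm E M} [FiniteDimensional ℝ E] [IsManifold 𝓘(ℝ, E) ∞ M]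

/-- In the tube the orbit is `T × {0}`. Composing a local inverse of `Φ` with one of `p` gives
coordinates in `V × K`, and a linear identification with `E` makes them a chart that flattens the
orbit to the image `W` of `V`. -/
theorem IsTorusParam.exists_orbit_chart (hp : IsTorusParam p)
    (hnd : ∀ x a, (∀ b, σ x ![infAct E p x a, infAct E p x b] = 0) → a = 0) {x : M}
    (τ : Tube E F T x) :
    ∃ e ∈ IsManifold.maximalAtlas 𝓘(ℝ, E) ∞ M, x ∈ e.source ∧
      ∃ W : Submodule ℝ E, Module.finrank ℝ W = Module.finrank ℝ F ∧
        (∀ q ∈ e.source, q ∈ MulAction.orbit T x ↔ e q - e x ∈ W) ∧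
        ∀ v : TangentSpace 𝓘(ℝ, E) x, v ∈ orbitTangent E F T x ↔
          mfderiv 𝓘(ℝ, E) 𝓘(ℝ, E) e x v ∈ W := by
  classical
  let K := EuclideanSpace ℝ (Fin (sliceDim E F))
  let V := Fin (Module.finrank ℝ F) → ℝ
  let D := disk (sliceDim E F) τ.r
  have hfr : Module.finrank ℝ (V × K) = Module.finrank ℝ E := by
    have := hp.finrank_add hnd x
    rw [hp.finrank_orbitOrthogonal hnd x] at this
    rw [Module.finrank_prod, finrank_euclideanSpace_fin, Module.finrank_fin_fun]
    omega
  let L : (V × K) ≃L[ℝ] E := ContinuousLinearEquiv.ofFinrankEq hfr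
  obtain ⟨Ψ, hΨ0, hΨ⟩ := τ.Φ_induces.1 (1, τ.origin)
  obtain ⟨P, hP0, hP⟩ := hp.isLocalDiffeomorph 0
  have hP1 : P 0 = 1 := (hP hP0).symm.trans hp.map_zero
  have hΨx : Ψ (1, τ.origin) = x := by
    rw [← hΨ hΨ0, τ.Φ_origin, one_smul]
  let r : K → D := fun k => if h : k ∈ D then ⟨k, h⟩ else τ.origin
  have hr : ∀ k ∈ D, (r k : K) = k := fun k hk => by simp [r, hk]
  have hr' : ∀ z : D, r z = z := fun z => Subtype.ext (hr _ z.2)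
  have hrs : ContMDiffOn 𝓘(ℝ, K) 𝓘(ℝ, K) ∞ r D := by
    intro k hk
    rw [← ContMDiffWithinAt.subtypeVal_comp_iff]
    exact contMDiffWithinAt_id.congr (fun k' hk' => hr _ hk') (hr _ hk)
  let f : M → E := fun q => L (P.symm (Ψ.symm q).1, ((Ψ.symm q).2 : K))
  let A : Set M := Ψ.target ∩ (fun q => (Ψ.symm q).1) ⁻¹' P.target
  have hΨs1 : ContMDiffOn 𝓘(ℝ, E) 𝓘(ℝ, F) ∞ (fun q => (Ψ.symm q).1) Ψ.target :=
    contMDiff_fst.comp_contMDiffOn Ψ.contMDiffOn_invFun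
  have hΨs2 : ContMDiffOn 𝓘(ℝ, E) 𝓘(ℝ, K) ∞ (fun q => (Ψ.symm q).2) Ψ.target :=
    contMDiff_snd.comp_contMDiffOn Ψ.contMDiffOn_invFun
  have hA : IsOpen A := hΨs1.continuousOn.isOpen_inter_preimage Ψ.open_target P.open_target
  have hf : ContMDiffOn 𝓘(ℝ, E) 𝓘(ℝ, E) ∞ f A := by
    have h1 : ContMDiffOn 𝓘(ℝ, E) 𝓘(ℝ, V) ∞ (fun q => P.symm (Ψ.symm q).1) A :=
      P.contMDiffOn_invFun.comp (hΨs1.mono inter_subset_left) fun q hq => hq.2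
    have h2 : ContMDiffOn 𝓘(ℝ, E) 𝓘(ℝ, K) ∞ (fun q => ((Ψ.symm q).2 : K)) A :=
      contMDiff_subtype_val.comp_contMDiffOn (hΨs2.mono inter_subset_left)
    exact L.contDiff.contMDiff.comp_contMDiffOn (h1.prodMk_space h2)
  let B₀ : Set E := (fun u => (L.symm u).1) ⁻¹' P.source ∩ (fun u => (L.symm u).2) ⁻¹' (D : Set K)
  have hB₀ : IsOpen B₀ := (P.open_source.preimage (by fun_prop)).inter
    (D.isOpen.preimage (by fun_prop))
  let i : E → T × D := fun u => (P (L.symm u).1, r (L.symm u).2)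
  have hi : ContMDiffOn 𝓘(ℝ, E) (𝓘(ℝ, F).prod 𝓘(ℝ, K)) ∞ i B₀ := by
    have h1 : ContMDiff 𝓘(ℝ, E) 𝓘(ℝ, V) ∞ (fun u => (L.symm u).1) :=
      ContDiff.contMDiff (by fun_prop)
    have h2 : ContMDiff 𝓘(ℝ, E) 𝓘(ℝ, K) ∞ (fun u => (L.symm u).2) :=
      ContDiff.contMDiff (by fun_prop)
    exact ContMDiffOn.prodMk (P.contMDiffOn_toFun.comp h1.contMDiffOn fun u hu => hu.1)
      (hrs.comp h2.contMDiffOn fun u hu => hu.2)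
  let B : Set E := B₀ ∩ i ⁻¹' Ψ.source
  have hB : IsOpen B := hi.continuousOn.isOpen_inter_preimage hB₀ Ψ.open_source
  have hg : ContMDiffOn 𝓘(ℝ, E) 𝓘(ℝ, E) ∞ (Ψ ∘ i) B :=
    Ψ.contMDiffOn_toFun.comp (hi.mono inter_subset_left) fun u hu => hu.2
  have hif : ∀ q ∈ A, i (f q) = Ψ.symm q := by
    intro q hq
    simp only [i, f, ContinuousLinearEquiv.symm_apply_apply]
    exact Prod.ext (P.right_inv hq.2) (hr' _)
  have hgf : ∀ q ∈ A, (Ψ ∘ i) (f q) = q := by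
    intro q hq
    rw [Function.comp_apply, hif q hq]
    exact Ψ.right_inv hq.1
  have hfg : ∀ u ∈ B, f ((Ψ ∘ i) u) = u := by
    intro u hu
    have h1 : Ψ.symm (Ψ (i u)) = i u := Ψ.left_inv hu.2
    have h2 : P.symm (P (L.symm u).1) = (L.symm u).1 := P.left_inv hu.1.1
    simp only [f, Function.comp_apply, h1, i, h2, hr _ hu.1.2]
    exact L.apply_symm_apply u
  let Λ := PartialDiffeomorph.ofInverse hA hB hf hg hgf hfg
  have hsymx : Ψ.symm x = (1, τ.origin) :=
    (congrArg (fun q => Ψ.symm q) hΨx.symm).trans (Ψ.left_inv hΨ0)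
  have hxt : x ∈ Ψ.target := by
    have h := Ψ.map_source hΨ0
    rwa [hΨx] at h
  have hP1s : P.symm 1 = 0 := by
    rw [← hP1]
    exact P.left_inv hP0
  have hxA : x ∈ A := by
    refine ⟨hxt, ?_⟩
    rw [mem_preimage, hsymx, ← hP1]
    exact P.map_source hP0
  have hfx : f x = 0 := by
    simp only [f, hsymx, hP1s]
    exact L.map_zero
  have hxB : f x ∈ B := by
    have h1 : i (f x) ∈ Ψ.source := by
      rw [hif x hxA]
      exact Ψ.symm.map_source hxA.1
    refine ⟨?_, h1⟩
    rw [hfx]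
    refine ⟨?_, ?_⟩
    · simpa using hP0
    · have h0 : (0 : K) ∈ D := τ.origin.2
      simpa using h0
  have hxΛ : x ∈ Λ.source := ⟨hxA, hxB⟩
  let W : Submodule ℝ E := (LinearMap.range (LinearMap.inl ℝ V K)).map (L : V × K →ₗ[ℝ] E)
  have hW : ∀ (a : V) (z : K), L (a, z) ∈ W ↔ z = 0 := by
    intro a z
    constructor
    · rintro ⟨_, ⟨b, rfl⟩, h⟩
      have := L.injective h
      exact (congrArg Prod.snd this).symm
    · rintro rfl
      exact ⟨(a, 0), ⟨a, rfl⟩, rfl⟩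
  -- In these coordinates `p a • x = Φ (p a, 0)` is `L (a, 0)` for small `a`.
  have hder : ∀ a : V, (mfderiv 𝓘(ℝ, E) 𝓘(ℝ, E) f x (infAct E p x a) : E) = L (a, 0) := by
    intro a
    have hm : MDifferentiableAt 𝓘(ℝ, V) 𝓘(ℝ, E) (fun a : V => p a • x) 0 :=
      ((contMDiff_orbitMap (E := E) (F := F) x).comp hp.contMDiff).mdifferentiable (by simp) 0
    have h0 : (fun a : V => p a • x) 0 = x := by
      simp [hp.map_zero]
    have h1 := mfderiv_comp_model (x := (0 : V)) (y := x) (I₁ := 𝓘(ℝ, V)) (I₂ := 𝓘(ℝ, E))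
      (I₃ := 𝓘(ℝ, E)) ((hf.contMDiffAt (hA.mem_nhds hxA)).mdifferentiableAt (by simp)) hm h0
    let L₀ : V →L[ℝ] E := (L : V × K →L[ℝ] E).comp (ContinuousLinearMap.inl ℝ V K)
    have h2 : f ∘ (fun a : V => p a • x) =ᶠ[𝓝 0] L₀ := by
      have hc : Continuous fun a : V => (p a, τ.origin) := hp.continuous.prodMk continuous_const
      have hmem : (p 0, τ.origin) ∈ Ψ.source := by rwa [hp.map_zero]
      filter_upwards [P.open_source.mem_nhds hP0,
        hc.continuousAt.eventually_mem (Ψ.open_source.mem_nhds hmem)] with b hb hb'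
      have h3 : Ψ.symm (p b • x) = (p b, τ.origin) := by
        rw [← τ.Φ_origin, hΨ hb']
        exact Ψ.left_inv hb'
      have h4 : P.symm (p b) = b := by
        rw [hP hb]
        exact P.left_inv hb
      simp only [Function.comp_apply, f, h3, h4]
      rfl
    have h3 : (mfderiv 𝓘(ℝ, V) 𝓘(ℝ, E) (f ∘ fun a : V => p a • x) 0 : V →L[ℝ] E) = L₀ :=
      h2.mfderiv_eq.trans L₀.hasMFDerivAt.mfderiv
    exact congrArg (fun L : V →L[ℝ] E => L a) (h1.symm.trans h3)
  refine ⟨Λ.toOpenPartialHomeomorph, Λ.mem_maximalAtlas, hxΛ, W, ?_, ?_, ?_⟩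
  · rw [LinearEquiv.finrank_map_eq L.toLinearEquiv,
      LinearMap.finrank_range_of_inj LinearMap.inl_injective, Module.finrank_fin_fun]
  · intro q hq
    have h1 : τ.Φ (Ψ.symm q) = q := (hΨ (Ψ.symm.map_source hq.1.1)).trans (Ψ.right_inv hq.1.1)
    change _ ↔ f q - f x ∈ W
    rw [hfx, sub_zero, hW, ← τ.Φ_mem_orbit_iff, h1]
  · intro v
    change _ ↔ (mfderiv 𝓘(ℝ, E) 𝓘(ℝ, E) f x v : E) ∈ W
    rw [hp.mem_orbitTangent_iff]
    constructor
    · rintro ⟨a, rfl⟩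
      exact ⟨(a, 0), ⟨a, rfl⟩, (hder a).symm⟩
    · rintro ⟨_, ⟨a, rfl⟩, h⟩
      exact ⟨a, (Λ.bijective_mfderiv hxΛ).1 ((hder a).trans h)⟩

theorem IsTorusParam.isSymplecticOrbit (hp : IsTorusParam p)
    (hnd : ∀ x a, (∀ b, σ x ![infAct E p x a, infAct E p x b] = 0) → a = 0)
    (τ : ∀ x : M, Tube E F T x) (x : M) : IsSymplecticOrbit F T σ x := by
  refine ⟨fun y hy => ?_, fun y _ v hv hvw => ?_⟩
  · rw [← MulAction.orbit_eq_iff.2 hy]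
    exact hp.exists_orbit_chart hnd (τ y)
  · obtain ⟨a, rfl⟩ := hp.mem_orbitTangent_iff.1 hv
    have ha : a = 0 := hnd y a fun b => hvw _ (hp.mem_orbitTangent_iff.2 ⟨b, rfl⟩)
    rw [ha]
    exact _root_.map_zero _

end EmbeddedOrbits

/-! ### The orbifold atlas of a family of tubes -/

section TubeCharts

variable {E : Type*} [NormedAddCommGroup E] [NormedSpace ℝ E]
  {F : Type*} [NormedAddCommGroup F] [NormedSpace ℝ F]
  {M : Type*} [TopologicalSpace M] [ChartedSpace E M]
  {T : Type*} [CommGroup T] [TopologicalSpace T] [ChartedSpace F T] [MulAction T M]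

theorem Tube.Φ_eq_smul {x : M} (τ : Tube E F T x) (t : T) (z : disk (sliceDim E F) τ.r) :
    τ.Φ (t, z) = t • τ.Φ (1, z) := by
  rw [← τ.Φ_equivariant, mul_one]

theorem Tube.continuous_Φ {x : M} (τ : Tube E F T x) : Continuous τ.Φ :=
  τ.Φ_induces.1.contMDiff.continuous

theorem Tube.orbitProj_Φ {x : M} (τ : Tube E F T x) (q : T × disk (sliceDim E F) τ.r) :
    orbitProj T (τ.Φ q) = τ.chart.φ q.2 := by
  rw [show τ.Φ q = q.1 • τ.Φ (1, q.2) from τ.Φ_eq_smul q.1 q.2, orbitProj_smul]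
  rfl

theorem Tube.range_φ {x : M} (τ : Tube E F T x) : range τ.chart.φ = τ.chart.U := by
  ext p
  constructor
  · rintro ⟨z, rfl⟩
    exact ⟨_, ⟨(1, z), rfl⟩, rfl⟩
  · rintro ⟨_, ⟨q, rfl⟩, rfl⟩
    exact ⟨q.2, (τ.orbitProj_Φ q).symm⟩

theorem Tube.φ_eq_iff {x : M} (τ : Tube E F T x) (z w : disk (sliceDim E F) τ.r) :
    τ.chart.φ z = τ.chart.φ w ↔ ∃ h, τ.permHom h z = w := by
  change orbitProj T _ = orbitProj T _ ↔ _
  rw [orbitProj_eq_iff]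
  constructor
  · rintro ⟨t, ht⟩
    rw [← τ.Φ_eq_smul] at ht
    obtain ⟨h, -, h2⟩ := (τ.Φ_induces.2 _ _).1 ht.symm
    exact ⟨h, Subtype.ext h2.symm⟩
  · rintro ⟨h, rfl⟩
    refine ⟨(h : T)⁻¹, ?_⟩
    rw [← τ.Φ_eq_smul]
    exact ((τ.Φ_induces.2 (1, z) ((h : T)⁻¹, τ.permHom h z)).2 ⟨h, (one_mul _).symm, rfl⟩).symm

theorem Tube.continuous_φ {x : M} (τ : Tube E F T x) : Continuous τ.chart.φ :=
  continuous_quot_mk.comp (τ.continuous_Φ.comp (by fun_prop))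

theorem Tube.contMDiff_permHom {x : M} (τ : Tube E F T x) (h : MulAction.stabilizer T x) :
    ContMDiff 𝓘(ℝ, EuclideanSpace ℝ (Fin (sliceDim E F)))
      𝓘(ℝ, EuclideanSpace ℝ (Fin (sliceDim E F))) ∞ (τ.permHom h) := by
  rw [← ContMDiff.subtypeVal_comp_iff]
  exact (τ.ρ h).toContinuousLinearMap.contMDiff.comp contMDiff_subtype_val

theorem Tube.mem_chart_U {x : M} (τ : Tube E F T x) : orbitProj T x ∈ τ.chart.U :=
  ⟨x, ⟨(1, τ.origin), τ.Φ_center _ rfl⟩, rfl⟩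

/-- If `t` carries `Φ' (1, w)` to `Φ (1, z)`, the transition is the disk component of a local
inverse of `Φ'` applied to `Φ (1, ·)`. The inverse transition uses `Φ` and `Φ' (t, ·)` in the same
way. The two are mutually inverse by equivariance, as the discarded `T`-components only translate
the `T`-coordinate. -/
theorem Tube.exists_transition [LieGroup 𝓘(ℝ, F) ∞ T] {x y : M} (τ : Tube E F T x)
  (τ' : Tube E F T y)
    (z : disk (sliceDim E F) τ.r) (w : disk (sliceDim E F) τ'.r)
    (hzw : τ.chart.φ z = τ'.chart.φ w) :
    ∃ ψ : OpenPartialHomeomorph (disk (sliceDim E F) τ.r) (disk (sliceDim E F) τ'.r),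
      z ∈ ψ.source ∧ ψ z = w ∧
      ContMDiffOn 𝓘(ℝ, EuclideanSpace ℝ (Fin (sliceDim E F)))
        𝓘(ℝ, EuclideanSpace ℝ (Fin (sliceDim E F))) ∞ ψ ψ.source ∧
      ContMDiffOn 𝓘(ℝ, EuclideanSpace ℝ (Fin (sliceDim E F)))
        𝓘(ℝ, EuclideanSpace ℝ (Fin (sliceDim E F))) ∞ ψ.symm ψ.target ∧
      ∀ y ∈ ψ.source, τ'.chart.φ (ψ y) = τ.chart.φ y := by
  let K := EuclideanSpace ℝ (Fin (sliceDim E F))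
  obtain ⟨t, ht⟩ := orbitProj_eq_iff.1 hzw
  have htw : τ'.Φ (t, w) = τ.Φ (1, z) := (τ'.Φ_eq_smul t w).trans ht
  obtain ⟨Ψ, hz, hΨ⟩ := τ.Φ_induces.1 (1, z)
  obtain ⟨Ψ', hw, hΨ'⟩ := τ'.Φ_induces.1 (t, w)
  have key : ∀ {x y : M} (τ : Tube E F T x) (τ' : Tube E F T y) (s : T)
      (Ψ' : PartialDiffeomorph (𝓘(ℝ, F).prod 𝓘(ℝ, K)) 𝓘(ℝ, E) (T × disk (sliceDim E F) τ'.r) M ∞),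
      IsOpen ((fun z => τ.Φ (s, z)) ⁻¹' Ψ'.target) ∧
      ContMDiffOn 𝓘(ℝ, K) (𝓘(ℝ, F).prod 𝓘(ℝ, K)) ∞ (fun z => Ψ'.symm (τ.Φ (s, z)))
        ((fun z => τ.Φ (s, z)) ⁻¹' Ψ'.target) := by
    intro x y τ τ' s Ψ'
    have h1 : ContMDiff 𝓘(ℝ, K) 𝓘(ℝ, E) ∞ (fun z => τ.Φ (s, z)) :=
      τ.Φ_induces.1.contMDiff.comp (contMDiff_const.prodMk contMDiff_id)
    exact ⟨Ψ'.open_target.preimage h1.continuous,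
      Ψ'.contMDiffOn_invFun.comp h1.contMDiffOn fun z hz => hz⟩
  obtain ⟨hA₀, hα₀⟩ := key τ τ' 1 Ψ'
  obtain ⟨hB₀, hβ₀⟩ := key τ' τ t Ψ
  let α₀ := fun z => Ψ'.symm (τ.Φ (1, z))
  let β₀ := fun w => Ψ.symm (τ'.Φ (t, w))
  -- The second condition keeps the translated pair in the domain where `Ψ.symm` inverts `Φ`;
  -- openness alone does not ensure this.
  let A : Set (disk (sliceDim E F) τ.r) := ((fun z => τ.Φ (1, z)) ⁻¹' Ψ'.target) ∩
    (fun z' => (t * (α₀ z').1⁻¹, z')) ⁻¹' Ψ.source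
  let B : Set (disk (sliceDim E F) τ'.r) := ((fun w => τ'.Φ (t, w)) ⁻¹' Ψ.target) ∩
    (fun w' => ((β₀ w').1⁻¹ * t, w')) ⁻¹' Ψ'.source
  have : IsTopologicalGroup T := topologicalGroup_of_lieGroup 𝓘(ℝ, F) ∞
  have hA : IsOpen A := by
    refine ContinuousOn.isOpen_inter_preimage ?_ hA₀ Ψ.open_source
    exact ((continuousOn_const.mul (hα₀.continuousOn.fst).inv)).prodMk continuousOn_id
  have hB : IsOpen B := by
    refine ContinuousOn.isOpen_inter_preimage ?_ hB₀ Ψ'.open_source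
    exact (((hβ₀.continuousOn.fst).inv).mul continuousOn_const).prodMk continuousOn_id
  have hα₁ : ∀ z' ∈ A, τ'.Φ (α₀ z') = τ.Φ (1, z') := fun z' hz' =>
    (hΨ' (Ψ'.symm.map_source hz'.1)).trans (Ψ'.right_inv hz'.1)
  have hβ₁ : ∀ w' ∈ B, τ.Φ (β₀ w') = τ'.Φ (t, w') := fun w' hw' =>
    (hΨ (Ψ.symm.map_source hw'.1)).trans (Ψ.right_inv hw'.1)
  have hα₂ : ∀ z' ∈ A, β₀ (α₀ z').2 = (t * (α₀ z').1⁻¹, z') := by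
    intro z' hz'
    have h1 : τ'.Φ (t, (α₀ z').2) = τ.Φ (t * (α₀ z').1⁻¹, z') := by
      rw [τ.Φ_eq_smul, ← hα₁ z' hz', ← τ'.Φ_equivariant, inv_mul_cancel_right]
    change Ψ.symm (τ'.Φ (t, (α₀ z').2)) = _
    rw [h1, hΨ hz'.2]
    exact Ψ.left_inv hz'.2
  have hβ₂ : ∀ w' ∈ B, α₀ (β₀ w').2 = ((β₀ w').1⁻¹ * t, w') := by
    intro w' hw'
    have h1 : τ.Φ (1, (β₀ w').2) = τ'.Φ ((β₀ w').1⁻¹ * t, w') := by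
      rw [τ'.Φ_equivariant, ← hβ₁ w' hw', ← τ.Φ_equivariant, inv_mul_cancel]
    change Ψ'.symm (τ.Φ (1, (β₀ w').2)) = _
    rw [h1, hΨ' hw'.2]
    exact Ψ'.left_inv hw'.2
  have hαz : α₀ z = (t, w) := by
    change Ψ'.symm (τ.Φ (1, z)) = _
    rw [← htw, hΨ' hw]
    exact Ψ'.left_inv hw
  have hβw : β₀ w = (1, z) := by
    change Ψ.symm (τ'.Φ (t, w)) = _
    rw [htw, hΨ hz]
    exact Ψ.left_inv hz
  have hzA : z ∈ A := by
    refine ⟨?_, ?_⟩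
    · rw [mem_preimage, ← htw, hΨ' hw]
      exact Ψ'.map_source hw
    · rw [mem_preimage, hαz, mul_inv_cancel]
      exact hz
  have hwB : w ∈ B := by
    refine ⟨?_, ?_⟩
    · rw [mem_preimage, htw, hΨ hz]
      exact Ψ.map_source hz
    · rw [mem_preimage, hβw, inv_one, one_mul]
      exact hw
  let Λ : PartialDiffeomorph 𝓘(ℝ, K) 𝓘(ℝ, K) (disk (sliceDim E F) τ.r)
      (disk (sliceDim E F) τ'.r) ∞ :=
    PartialDiffeomorph.ofInverse (f := fun z => (α₀ z).2) (g := fun w => (β₀ w).2) hA hB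
      (contMDiff_snd.comp_contMDiffOn (hα₀.mono inter_subset_left))
      (contMDiff_snd.comp_contMDiffOn (hβ₀.mono inter_subset_left))
      (fun z' hz' => congrArg Prod.snd (hα₂ z' hz'))
      (fun w' hw' => congrArg Prod.snd (hβ₂ w' hw'))
  refine ⟨Λ.toOpenPartialHomeomorph, ⟨hzA, ?_⟩, congrArg Prod.snd hαz, Λ.contMDiffOn_toFun,
    Λ.contMDiffOn_invFun, fun z' hz' => ?_⟩
  · change (α₀ z).2 ∈ B
    rw [hαz]
    exact hwB
  · exact (τ'.orbitProj_Φ (α₀ z')).symm.trans (congrArg (orbitProj T) (hα₁ z' hz'.1))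

variable [ContinuousSMul T M]

theorem Tube.isOpenMap_φ {x : M} (τ : Tube E F T x) : IsOpenMap τ.chart.φ := by
  intro O hO
  have h1 : τ.chart.φ '' O = orbitProj T '' (τ.Φ '' (univ ×ˢ O)) := by
    ext p
    constructor
    · rintro ⟨z, hz, rfl⟩
      exact ⟨_, ⟨(1, z), ⟨mem_univ _, hz⟩, rfl⟩, rfl⟩
    · rintro ⟨_, ⟨q, hq, rfl⟩, rfl⟩
      exact ⟨q.2, hq.2, (τ.orbitProj_Φ q).symm⟩
  rw [h1]
  exact isOpenQuotientMap_orbitProj.isOpenMap _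
    (τ.Φ_induces.1.isOpenMap _ (isOpen_univ.prod hO))

theorem Tube.exists_homeomorph {x : M} (τ : Tube E F T x) :
    ∃ h : MulAction.orbitRel.Quotient τ.chart.Γ τ.chart.dom ≃ₜ τ.chart.U,
      ∀ z : τ.chart.dom, (h (Quotient.mk _ z) : OrbitSpace M T) = τ.chart.φ z := by
  let φ' : τ.chart.dom → τ.chart.U := fun z => ⟨τ.chart.φ z, τ.range_φ ▸ mem_range_self z⟩
  have hcont : Continuous φ' := τ.continuous_φ.subtype_mk _
  have hopen : IsOpenMap φ' := τ.isOpenMap_φ.subtype_mk _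
  have hrel : ∀ z w, (MulAction.orbitRel τ.chart.Γ τ.chart.dom) z w ↔ φ' z = φ' w := by
    intro z w
    rw [MulAction.orbitRel_apply, eq_comm, Subtype.ext_iff]
    refine Iff.trans ?_ (τ.φ_eq_iff w z).symm
    constructor
    · rintro ⟨⟨_, h, rfl⟩, hg⟩
      exact ⟨h, hg⟩
    · rintro ⟨h, hg⟩
      exact ⟨⟨_, h, rfl⟩, hg⟩
  let Q : MulAction.orbitRel.Quotient τ.chart.Γ τ.chart.dom → τ.chart.U :=
    Quotient.lift φ' fun z w h => (hrel z w).1 h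
  have hQ : Function.Bijective Q := by
    constructor
    · rintro ⟨z⟩ ⟨w⟩ h
      exact Quotient.sound ((hrel z w).2 h)
    · rintro ⟨p, hp⟩
      rw [← τ.range_φ] at hp
      obtain ⟨z, rfl⟩ := hp
      exact ⟨Quotient.mk _ z, rfl⟩
  have hQc : Continuous Q := hcont.quotient_lift _
  have hQo : IsOpenMap Q :=
    IsOpenMap.of_comp (f := Quotient.mk _) continuous_quotient_mk' Quotient.mk_surjective hopen
  exact ⟨(Equiv.ofBijective Q hQ).toHomeomorphOfContinuousOpen hQc hQo, fun z => rfl⟩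

variable [LieGroup 𝓘(ℝ, F) ∞ T]

/-- Several tubes may sit at the same point, so that the union of two atlases is covered along with
a single atlas. -/
theorem isOrbifoldAtlas_chart [∀ x : M, Finite (MulAction.stabilizer T x)] {ι : Type*} {x : ι → M}
    (τ : ∀ i, Tube E F T (x i)) (hcover : ⋃ i, (τ i).chart.U = univ) :
    IsOrbifoldAtlas fun i => (τ i).chart where
  isOpen_U i := by
    rw [← (τ i).range_φ]
    exact (τ i).isOpenMap_φ.isOpen_range
  isConnected_dom i := Metric.isConnected_ball (τ i).r_pos
  continuous_φ i := (τ i).continuous_φ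
  finite_Γ i := Finite.of_surjective _ (τ i).permHom.rangeRestrict_surjective
  smooth_Γ i := by
    rintro _ ⟨h, rfl⟩
    exact (τ i).contMDiff_permHom h
  cover := hcover
  factors i := (τ i).exists_homeomorph
  compatible i j := (τ i).exists_transition (τ j)

theorem isOrbifoldAtlas_tubeAtlas [∀ x : M, Finite (MulAction.stabilizer T x)]
    (τ : ∀ x : M, Tube E F T x) : IsOrbifoldAtlas (tubeAtlas τ) :=
  isOrbifoldAtlas_chart τ (eq_univ_of_forall fun p =>
    Quotient.inductionOn p fun x => mem_iUnion.2 ⟨x, (τ x).mem_chart_U⟩)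

theorem atlasEquivalent_tubeAtlas [∀ x : M, Finite (MulAction.stabilizer T x)]
    (τ τ' : ∀ x : M, Tube E F T x) : AtlasEquivalent (tubeAtlas τ) (tubeAtlas τ') := by
  let υ : ∀ i : M ⊕ M, Tube E F T (Sum.elim id id i) := fun i =>
    match i with
    | Sum.inl x => τ x
    | Sum.inr x => τ' x
  have h : Sum.elim (tubeAtlas τ) (tubeAtlas τ') = fun i => (υ i).chart := by
    funext i
    rcases i with x | x <;> rfl
  rw [AtlasEquivalent, h]
  exact isOrbifoldAtlas_chart υ (eq_univ_of_forall fun p =>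
    Quotient.inductionOn p fun x => mem_iUnion.2 ⟨Sum.inl x, (τ x).mem_chart_U⟩)

end TubeCharts

/-! ### Effectiveness, the principal orbibundle -/

section Effectiveness

variable {E : Type*} [NormedAddCommGroup E] [NormedSpace ℝ E]
  {F : Type*} [NormedAddCommGroup F] [NormedSpace ℝ F]
  {M : Type*} [TopologicalSpace M] [ChartedSpace E M]
  {T : Type*} [CommGroup T] [TopologicalSpace T] [ChartedSpace F T] [MulAction T M]

/-- Commutativity of `T` gives `h • [t, z] = [t h, z] = [t, h z]`, and comparing `T`-components
shows that only `h` itself can identify the two representatives. -/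
theorem Tube.smul_Φ_eq_iff {x : M} (τ : Tube E F T x) (h : MulAction.stabilizer T x)
    (q : T × disk (sliceDim E F) τ.r) : (h : T) • τ.Φ q = τ.Φ q ↔ τ.permHom h q.2 = q.2 := by
  rw [show τ.Φ q = τ.Φ (q.1, q.2) from rfl, ← τ.Φ_equivariant, τ.Φ_induces.2]
  constructor
  · rintro ⟨k, h1, h2⟩
    have hk : k = h := by
      refine Subtype.ext ?_
      have h3 : q.1 = (h : T) * q.1 * (k : T)⁻¹ := h1
      rw [eq_mul_inv_iff_mul_eq, mul_comm] at h3
      exact mul_right_cancel h3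
    subst hk
    exact Subtype.ext h2.symm
  · intro hq
    refine ⟨h, ?_, (congrArg Subtype.val hq).symm⟩
    change q.1 = (h : T) * q.1 * (h : T)⁻¹
    rw [mul_comm (h : T), mul_inv_cancel_right]

/-- For `h` trivial on `D_x`, the interior `S` of its fixed point set contains the whole tube at
`x`. It is open by construction, and closed by linearity in the tubes at its limit points.
Connectedness gives `S = M`, and effectiveness of the action gives `h = 1`. -/
theorem Tube.permHom_injective [T2Space M] [ConnectedSpace M] [ContinuousConstSMul T M]
    [FaithfulSMul T M] (τ : ∀ x : M, Tube E F T x) (x : M) :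
    Function.Injective (τ x).permHom := by
  rw [injective_iff_map_eq_one]
  intro h hh
  let S : Set M := interior {y : M | (h : T) • y = y}
  have hSh : ∀ y ∈ S, (h : T) • y = y := fun y hy =>
    interior_subset (s := {y : M | (h : T) • y = y}) hy
  have hcl : IsClosed {y : M | (h : T) • y = y} := isClosed_eq (by fun_prop) continuous_id
  have hmem : ∀ (y : M) (g : MulAction.stabilizer T y), (g : T) = h →
    (τ y).permHom g = 1 → y ∈ S := by
    intro y g hg hg1
    refine mem_interior.2 ⟨range (τ y).Φ, ?_, (τ y).Φ_induces.1.isOpen_range,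
      ⟨(1, (τ y).origin), (τ y).Φ_center _ rfl⟩⟩
    rintro _ ⟨q, rfl⟩
    change (h : T) • (τ y).Φ q = (τ y).Φ q
    rw [← hg, (τ y).smul_Φ_eq_iff, hg1]
    rfl
  have hSc : IsClosed S := by
    refine isClosed_of_closure_subset fun y hy => ?_
    have hyh : (h : T) • y = y := closure_minimal interior_subset hcl hy
    let g : MulAction.stabilizer T y := ⟨h, hyh⟩
    refine hmem y g rfl ?_
    obtain ⟨_, ⟨q, rfl⟩, hq⟩ := mem_closure_iff.1 hy _ (τ y).Φ_induces.1.isOpen_range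
      ⟨(1, (τ y).origin), (τ y).Φ_center _ rfl⟩
    have hopen : IsOpen ((↑) '' ((fun z => (τ y).Φ (q.1, z)) ⁻¹' S) :
        Set (EuclideanSpace ℝ (Fin (sliceDim E F)))) :=
      (disk (sliceDim E F) (τ y).r).isOpen.isOpenMap_subtype_val _
        (isOpen_interior.preimage ((τ y).continuous_Φ.comp (by fun_prop)))
    -- The tube at the limit point `y` meets `S`, so the linear map `ρ g` fixes a nonempty open set
    -- of vectors and is the identity.
    have htop : LinearMap.eqLocus ((τ y).ρ g) LinearMap.id = ⊤ := by
      refine Submodule.eq_top_of_nonempty_interior' _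
        ⟨q.2, mem_interior.2 ⟨_, ?_, hopen, ⟨q.2, hq, rfl⟩⟩⟩
      rintro _ ⟨z, hz, rfl⟩
      exact congrArg Subtype.val (((τ y).smul_Φ_eq_iff g (q.1, z)).1 (hSh _ hz))
    refine Equiv.ext fun z => Subtype.ext ?_
    have hz : (z : EuclideanSpace ℝ (Fin (sliceDim E F))) ∈
        LinearMap.eqLocus ((τ y).ρ g) LinearMap.id := htop ▸ Submodule.mem_top
    exact hz
  have hS : S = univ := IsClopen.eq_univ ⟨hSc, isOpen_interior⟩ ⟨x, hmem x h rfl hh⟩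
  refine Subtype.ext (FaithfulSMul.eq_of_smul_eq_smul (α := M) fun y => ?_)
  exact (hSh y (hS ▸ mem_univ y)).trans (one_smul T y).symm

theorem isPrincipalOrbibundle_orbitProj [IsManifold 𝓘(ℝ, E) ∞ M]
    [ContMDiffSMul 𝓘(ℝ, F) 𝓘(ℝ, E) ∞ T M] [FaithfulSMul T M]
    [∀ x : M, Finite (MulAction.stabilizer T x)] (τ : ∀ x : M, Tube E F T x) :
    IsPrincipalOrbibundle E τ (orbitProj T : M → OrbitSpace M T) where
  continuous_p := continuous_quot_mk
  surjective_p := Quotient.mk_surjective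
  fibres y y' := by rw [eq_comm, orbitProj_eq_iff]
  finite_stabilizer := inferInstance
  exists_model p x hp := by
    rw [← (τ x).range_φ] at hp
    obtain ⟨z, hz⟩ := hp
    -- The tube itself is the local model, over the whole of `D_x`.
    refine ⟨(τ x).chart.dom, le_rfl, (τ x).ρ_mem, ⟨z, hz⟩, (τ x).Φ, (τ x).Φ_equivariant,
      (τ x).Φ_induces, ?_, fun t v => (τ x).orbitProj_Φ (t, v)⟩
    ext y
    constructor
    · rintro ⟨q, rfl⟩
      exact ⟨q.2, ((τ x).orbitProj_Φ q).symm⟩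
    · rintro ⟨v, hv⟩
      obtain ⟨t, ht⟩ := orbitProj_eq_iff.1 hv.symm
      exact ⟨(t, v), ((τ x).Φ_eq_smul t v).trans ht⟩

theorem orbitProj_preimage_singleton {M T : Type*} [CommGroup T] [MulAction T M] (y : M) :
    (orbitProj T : M → OrbitSpace M T) ⁻¹' {orbitProj T y} = MulAction.orbit T y := by
  ext q
  exact orbitProj_eq_iff

end Effectiveness

end

/-! ### The main theorem -/

theorem mainTheorem12
    {E : Type*} [NormedAddCommGroup E] [NormedSpace ℝ E] [FiniteDimensional ℝ E]
    {F : Type*} [NormedAddCommGroup F] [NormedSpace ℝ F] [FiniteDimensional ℝ F]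
    {M : Type*} [TopologicalSpace M] [ChartedSpace E M] [IsManifold 𝓘(ℝ, E) ∞ M]
    [T2Space M] [CompactSpace M] [ConnectedSpace M]
    {T : Type*} [CommGroup T] [TopologicalSpace T] [ChartedSpace F T] [LieGroup 𝓘(ℝ, F) ∞ T]
    [MulAction T M] [ContMDiffSMul 𝓘(ℝ, F) 𝓘(ℝ, E) ∞ T M] [FaithfulSMul T M]
    (hT : IsTorus (F := F) T)
    (σ : TwoForm E M) (hσ : IsSymplecticForm σ) (hσT : IsInvariantForm T σ)
    (horb : ∃ x : M, IsSymplecticOrbit F T σ x) :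
    -- every orbit is a symplectic submanifold of dimension `dim T`
    (∀ x : M, IsSymplecticOrbit F T σ x) ∧
    -- `Ω` is a smooth `T`-invariant distribution of rank `dim M - dim T`
    IsSmoothDistribution (orbitOrthogonal F T σ) (sliceDim E F) ∧
    IsInvariantDistribution T (orbitOrthogonal F T σ) ∧
    -- `M/T` is metrizable, and tubes exist at all points
    MetrizableSpace (OrbitSpace M T) ∧
    (∀ x : M, Nonempty (Tube E F T x)) ∧
    -- whatever the choice of tubes, their charts form an orbifold atlas with the local groups `T_x`,
    -- for which `π` is a smooth principal orbibundle
    (∀ τ : ∀ x : M, Tube E F T x,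
      IsOrbifoldAtlas (tubeAtlas τ) ∧
      (∀ x : M, Function.Injective (τ x).permHom) ∧
      IsPrincipalOrbibundle E τ (orbitProj T : M → OrbitSpace M T)) ∧
    -- the orbifold structure does not depend on the choice
    (∀ τ τ' : ∀ x : M, Tube E F T x, AtlasEquivalent (tubeAtlas τ) (tubeAtlas τ')) ∧
    -- `Ω` is a flat connection for `π`
    IsFlatConnection (orbitProj T : M → OrbitSpace M T) (orbitOrthogonal F T σ)
      (sliceDim E F) := by
  obtain ⟨p, hp₁, hp₂, hp₃, hp₄⟩ := hT
  have hp : IsTorusParam p := ⟨hp₁, hp₂, hp₃, hp₄⟩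
  have : IsTopologicalGroup T := topologicalGroup_of_lieGroup 𝓘(ℝ, F) ∞
  have : CompactSpace T := hp.compactSpace
  have : T2Space T := hp.t2Space
  have : ContinuousSMul T M := ContMDiffSMul.continuousSMul (I := 𝓘(ℝ, F)) (I' := 𝓘(ℝ, E)) ∞
  -- The symplectic orbit enters only here; afterwards it is used through the nondegeneracy `hnd` at
  -- all points.
  have hnd := hp.nondegenerate hσ hσT horb
  have hfin : ∀ x : M, Finite (MulAction.stabilizer T x) := hp.finite_stabilizer hnd
  have htube : ∀ x : M, Nonempty (Tube E F T x) := hp.nonempty_tube hσT hnd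
  have hsymp : ∀ x : M, IsSymplecticOrbit F T σ x :=
    hp.isSymplecticOrbit hnd fun x => (htube x).some
  have hsmooth := hp.isSmoothDistribution hσ hσT hnd
  refine ⟨hsymp, hsmooth, hp.isInvariantDistribution hσT, metrizableSpace_orbitSpace E M T, htube,
    fun τ => ⟨isOrbifoldAtlas_tubeAtlas τ, Tube.permHom_injective τ,
      isPrincipalOrbibundle_orbitProj τ⟩, atlasEquivalent_tubeAtlas,
    ⟨hsmooth, fun y => ⟨orbitTangent E F T, Module.finrank ℝ F, ?_, hp.isCompl hnd y⟩⟩,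
    hp.isIntegrable hσ hσT hnd⟩
  rw [orbitProj_preimage_singleton]
  exact (hsymp y).1
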